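/- Let $a\in\mathbb C^*$ be generic (not a root of unity) and put $q=a^2$. For $k,\ell\ge 0$ let $E_{k,\ell}$ be the Temperley–Lieb space: the complex vector space with basis the simple diagrams of type $(k,\ell)$, i.e. isotopy classes of crossingless, circle-free planar diagrams in $\mathbb R\times[0,1]$ joining $k$ inputs on the bottom line and $\ell$ outputs on the top line. Composition is stacking (the left factor on top), every closed circle being replaced by $-(a^2+a^{-2})$; $\otimes$ is horizontal juxtaposition; $1_n$ is the diagram with $n$ vertical strands. Let $e_1,\dots,e_{n-1}\in E_{n,n}$ be the usual generators ($e_i$ is a cap joining inputs $i,i+1$, a cup joining outputs $i,i+1$, and vertical strands elsewhere), and let $f_n\in E_{n,n}$ be the Jones–Wenzl idempotent: the unique element such that $f_n-1_n$ is a noncommutative polynomial without constant term in the $e_i$ and $f_ne_i=e_if_n=0$ for all $i$ (so $f_0=1$). For a finite sequence $s=(n_1,\dots,n_m)$ of positive integers put $|s|=n_1+\dots+n_m$, $f_s=f_{n_1}\otimes\cdots\otimes f_{n_m}$, and for $k\ge 0$ and $g\in E_{|s|,k}$ put $\widehat g=f_k\,g\,f_s$ and $$\mathrm{Hom}_{\mathcal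 V(a)}(s,(k))=\{\widehat g : g\in E_{|s|,k}\}$$ (for $k=0$, $(0)$ stands for the empty sequence). A simple diagram $\mathcal D$ of type $(|s|,k)$ is of good type $(s,(k))$ if $\widehat{\mathcal D}\neq 0$. Let $V=\mathbb Cv_0\oplus\mathbb Cv_1$ be the fundamental $U_q(sl_2)$-module, with $Kv_0=qv_0$, $Kv_1=q^{-1}v_1$, $Xv_0=0$, $Xv_1=v_0$, and comultiplication $\Delta(K)=K\otimes K$, $\Delta(X)=1\otimes X+X\otimes K$. Let $\mathcal F$ be the tensor functor from the Temperley–Lieb category to $U_q(sl_2)$-modules with $\mathcal F(n)=V^{\otimes n}$, sending the cup to $1\mapsto v_1\otimes v_0-q\,v_0\otimes v_1$ and the cap to $v_0\otimes v_1\mapsto 1$, $v_1\otimes v_0\mapsto -q^{-1}$, $v_i\otimes v_i\mapsto 0$; put $\widetilde{\mathcal F}(s)=\mathcal F(f_s)V^{\otimes|s|}$. The space of highest weight $b$ of such a module is the space of its vectors $v$ with $Xv=0$ and $Kv=q^bv$. For $0\le j\le\min(n,m)$ let $\mathcal D_{n,m,j}$ be the simple diagram of type $(n+m,n+m-2j)$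 that consists of $n-j$ vertical strands on the left, $j$ nested caps joining the last $j$ of the first $n$ inputs to the first $j$ of the last $m$ inputs, and $m-j$ vertical strands on the right. Let $m\ge 3$, let $s=(n_1,\dots,n_m)$ be a sequence of positive integers, $s'=(n_1,\dots,n_{m-1})$ the truncated sequence, and $k\ge 0$. Let $\{b_1,\dots,b_N\}$ be the (possibly empty) set of integers such that, for each $j$, the space of highest weight $b_j$ of $\widetilde{\mathcal F}(s')$ is nonzero and there is an integer $\ell_j$ with $0\le\ell_j\le\min(b_j,n_m)$ and $b_j+n_m-2\ell_j=k$. Let $\mathcal D_{j,p}$, $1\le p\le p'_j$, be the distinct diagrams of good type $(s',(b_j))$, and put $$\overline{\mathcal D_{j,p}}=\mathcal D_{b_j,n_m,\ell_j}\,(\mathcal D_{j,p}\otimes 1_{n_m}),\qquad 1\le j\le N,\ 1\le p\le p'_j .$$ **Proposition.** The $\overline{\mathcal D_{j,p}}$ are pairwise distinct simple diagrams, and they are exactly the diagrams of good type $(s,(k))$. The diagrams $\overline{\mathcal D_{j,p}}$ form a basis of $\mathrm{Hom}_{\mathcal V(a)}(s,(k))$, in the sense that the family of morphisms $\widehat{\overline{\mathcal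 D_{j,p}}}=f_k\,\overline{\mathcal D_{j,p}}\,f_s$ represented by them is a basis of this space. -/

import Mathlib

noncomputable section

namespace TemperleyLieb

/-! ### Diagrams and the Temperley-Lieb category -/

/-- The way in which a plane diagram with `k` inputs (`Sum.inl`, on the bottom line, from left to
right) and `l` outputs (`Sum.inr`, on the top line, from left to right) connects its boundary
points. A simple diagram (no crossings, no circles) is determined up to isotopy by this datum. -/
abbrev Diagram (k l : ℕ) : Type := Setoid (Fin k ⊕ Fin l)

/-- The position of a boundary point when one goes once around the boundary of the strip:
first the inputs from left to right, then the outputs from right to left. -/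
def boundaryPos {k l : ℕ} : Fin k ⊕ Fin l → ℕ
  | Sum.inl i => i
  | Sum.inr j => k + (Fin.rev j : ℕ)

/-- Simple diagrams: every boundary point is joined by an arc to exactly one other boundary point,
and no two arcs cross. -/
def Diagram.IsSimple {k l : ℕ} (D : Diagram k l) : Prop :=
  (∀ x, ∃! y, y ≠ x ∧ D.r x y) ∧
  ∀ x y z t, boundaryPos x < boundaryPos y → boundaryPos y < boundaryPos z →
    boundaryPos z < boundaryPos t → ¬ (D.r x z ∧ D.r y t)

/-- The diagram with `k` vertical strands. -/
def Diagram.id (k : ℕ) : Diagram k k := Setoid.ker (Sum.elim (fun i : Fin k => i) (fun i => i))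

/-- `D₁` put on top of `D₂`, the outputs of `D₂` being glued to the inputs of `D₁`, as a partition
of the set of inputs of `D₂`, glued points, and outputs of `D₁`. -/
def Diagram.glue {k l m : ℕ} (D₁ : Diagram l m) (D₂ : Diagram k l) :
    Setoid (Fin k ⊕ (Fin l ⊕ Fin m)) :=
  Setoid.map D₂ (Sum.map (fun i => i) Sum.inl) ⊔ Setoid.map D₁ Sum.inr

/-- The boundary points among all the points of the glued diagram. -/
def Diagram.outer {k l m : ℕ} : Fin k ⊕ Fin m → Fin k ⊕ (Fin l ⊕ Fin m) :=
  Sum.map (fun i => i) Sum.inr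

/-- The diagram obtained by stacking `D₁` on top of `D₂` and removing the circles. -/
def Diagram.stack {k l m : ℕ} (D₁ : Diagram l m) (D₂ : Diagram k l) : Diagram k m :=
  Setoid.comap Diagram.outer (D₁.glue D₂)

/-- The number of circles that arise when `D₁` is stacked on top of `D₂`: the components of the
glued diagram that do not reach its boundary. -/
def Diagram.circles {k l m : ℕ} (D₁ : Diagram l m) (D₂ : Diagram k l) : ℕ :=
  Nat.card {c : Quotient (D₁.glue D₂) // ∀ x, c ≠ Quotient.mk (D₁.glue D₂) (Diagram.outer x)}

/-- Juxtaposition, `D` being on the left of `D'`. -/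
def Diagram.juxt {k l k' l' : ℕ} (D : Diagram k l) (D' : Diagram k' l') :
    Diagram (k + k') (l + l') :=
  Setoid.map D (Sum.map (Fin.castAdd k') (Fin.castAdd l')) ⊔
    Setoid.map D' (Sum.map (Fin.natAdd k) (Fin.natAdd l))

/-- Complex linear combinations of diagrams of type `(k, l)`. The morphism space `E k l` of the
Temperley-Lieb category is the subspace spanned by the simple ones. -/
abbrev LinDiagram (k l : ℕ) : Type := Diagram k l →₀ ℂ

/-- A diagram as a morphism. -/
def Diagram.mor {k l : ℕ} (D : Diagram k l) : LinDiagram k l := Finsupp.single D 1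

/-- The space `E_{k,l}`, with basis the simple diagrams of type `(k, l)`. -/
def E (k l : ℕ) : Submodule ℂ (LinDiagram k l) :=
  Submodule.span ℂ {x | ∃ D : Diagram k l, D.IsSimple ∧ x = D.mor}

/-- Composition: bilinear extension of stacking, each circle giving a factor `-(a² + a⁻²)`. -/
def comp (a : ℂ) {k l m : ℕ} : LinDiagram l m →ₗ[ℂ] LinDiagram k l →ₗ[ℂ] LinDiagram k m :=
  Finsupp.linearCombination ℂ fun D₁ : Diagram l m =>
    Finsupp.linearCombination ℂ fun D₂ : Diagram k l =>
      (-(a ^ 2 + (a ^ 2)⁻¹)) ^ D₁.circles D₂ • (D₁.stack D₂).mor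

/-- Tensor product: bilinear extension of juxtaposition. -/
def tensor {k l k' l' : ℕ} :
    LinDiagram k l →ₗ[ℂ] LinDiagram k' l' →ₗ[ℂ] LinDiagram (k + k') (l + l') :=
  Finsupp.linearCombination ℂ fun D : Diagram k l =>
    Finsupp.linearCombination ℂ fun D' : Diagram k' l' => (D.juxt D').mor

/-! ### Jones-Wenzl idempotents -/

/-- The simple diagram `e` of type `(n, n)` (for `i + 1 < n`, counting from `0`) that joins the
inputs `i` and `i + 1`, joins the outputs `i` and `i + 1`, and is vertical elsewhere. -/
def eDiagram (n i : ℕ) : Diagram n n :=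
  Setoid.ker (Sum.elim
    (fun p : Fin n => if (p : ℕ) = i ∨ (p : ℕ) = i + 1 then Sum.inr 0 else Sum.inl (p : ℕ))
    (fun p : Fin n => if (p : ℕ) = i ∨ (p : ℕ) = i + 1 then Sum.inr 1 else Sum.inl (p : ℕ)) :
    Fin n ⊕ Fin n → ℕ ⊕ ℕ)

/-- Nonempty products of the generators. -/
inductive IsEWord (a : ℂ) (n : ℕ) : LinDiagram n n → Prop
  | gen (i : ℕ) (hi : i + 1 < n) : IsEWord a n (eDiagram n i).mor
  | mul (x y : LinDiagram n n) (hx : IsEWord a n x) (hy : IsEWord a n y) :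
      IsEWord a n (comp a x y)

/-- The defining property of the Jones-Wenzl idempotent: `f - 1` is a noncommutative polynomial
without constant term in the generators, and `f` kills the generators on both sides. -/
def IsJonesWenzl (a : ℂ) (n : ℕ) (f : LinDiagram n n) : Prop :=
  f - (Diagram.id n).mor ∈ Submodule.span ℂ {x | IsEWord a n x} ∧
  ∀ i, i + 1 < n →
    comp a f (eDiagram n i).mor = 0 ∧ comp a (eDiagram n i).mor f = 0

/-- The Jones-Wenzl idempotent `f_n`: the element with the defining property (it exists and is
unique for every `n` when `a` is nonzero and not a root of unity; `f_0 = 1`). -/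
def jonesWenzl (a : ℂ) (n : ℕ) : LinDiagram n n := Classical.epsilon (IsJonesWenzl a n)

/-! ### The category of Turaev -/

/-- `|s| = n_1 + ⋯ + n_m` for a sequence `s = (n_1, …, n_m)`. -/
def size : {m : ℕ} → (Fin m → ℕ) → ℕ
  | 0, _ => 0
  | m + 1, s => size (fun i : Fin m => s i.castSucc) + s (Fin.last m)

theorem size_eq_sum : ∀ {m : ℕ} (s : Fin m → ℕ), size s = ∑ i, s i
  | 0, _ => by simp [size]
  | m + 1, s => by rw [size, size_eq_sum, Fin.sum_univ_castSucc]

/-- `f_s = f_{n_1} ⊗ ⋯ ⊗ f_{n_m}`, with `f_∅ = 1`. -/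
def jwSeq (a : ℂ) : {m : ℕ} → (s : Fin m → ℕ) → LinDiagram (size s) (size s)
  | 0, _ => (Diagram.id 0).mor
  | m + 1, s => tensor (jwSeq a fun i : Fin m => s i.castSucc) (jonesWenzl a (s (Fin.last m)))

/-- The linear map `g ↦ ĝ = f_k g f_s`. -/
def hat (a : ℂ) {m : ℕ} (s : Fin m → ℕ) (k : ℕ) :
    LinDiagram (size s) k →ₗ[ℂ] LinDiagram (size s) k :=
  comp a (jonesWenzl a k) ∘ₗ (comp a).flip (jwSeq a s)

/-- The space of morphisms from `s` to `(k)`, the image of `E` under `g ↦ ĝ`. For `k = 0` the target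
`(0)` stands for the empty sequence (and `f_0 = 1`). -/
def HomV (a : ℂ) {m : ℕ} (s : Fin m → ℕ) (k : ℕ) : Submodule ℂ (LinDiagram (size s) k) :=
  (E (size s) k).map (hat a s k)

/-- Diagrams of good type `(s, (k))`. -/
def IsGoodType (a : ℂ) {m : ℕ} (s : Fin m → ℕ) (k : ℕ) (D : Diagram (size s) k) : Prop :=
  D.IsSimple ∧ hat a s k D.mor ≠ 0

/-! ### The functor to modules over the quantum group of `sl₂`

The module `V^{⊗n}` has the basis `v_w = v_{w 0} ⊗ ⋯ ⊗ v_{w (n-1)}`, for `w : Fin n → Fin 2`.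
Vectors are column vectors and operators are matrices in these bases. Here `q = a²`. -/

/-- The eigenvalue of `K` at `v_0` (namely `q`) and at `v_1` (namely `q⁻¹`). -/
def kEigen (q : ℂ) (ε : Fin 2) : ℂ := if ε = 0 then q else q⁻¹

/-- The action of `K` on `V^{⊗n}`, namely `K ⊗ ⋯ ⊗ K`. -/
def actK (q : ℂ) (n : ℕ) : Matrix (Fin n → Fin 2) (Fin n → Fin 2) ℂ :=
  Matrix.diagonal fun w => ∏ i, kEigen q (w i)

/-- The action of `X` on `V^{⊗n}`, namely the sum over `i` of `1 ⊗ ⋯ ⊗ 1 ⊗ X ⊗ K ⊗ ⋯ ⊗ K` with `X` in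
position `i`, according to `Δ(X) = 1 ⊗ X + X ⊗ K`; here `X v_0 = 0` and `X v_1 = v_0`. -/
def actX (q : ℂ) (n : ℕ) : Matrix (Fin n → Fin 2) (Fin n → Fin 2) ℂ :=
  Matrix.of fun w' w => ∑ i, if w i = 1 ∧ w' = Function.update w i 0 then
    ∏ j ∈ Finset.Ioi i, kEigen q (w j) else 0

/-- `d : V ⊗ V → ℂ`, the value of the functor at a cap:
`d (v_0 ⊗ v_1) = 1`, `d (v_1 ⊗ v_0) = -q⁻¹`, `d (v_0 ⊗ v_0) = d (v_1 ⊗ v_1) = 0`. -/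
def capValue (q : ℂ) : Matrix (Fin 2) (Fin 2) ℂ := !![0, 1; -q⁻¹, 0]

/-- `b : ℂ → V ⊗ V`, the value of the functor at a cup: `b (1) = v_1 ⊗ v_0 - q v_0 ⊗ v_1`. -/
def cupValue (q : ℂ) : Matrix (Fin 2) (Fin 2) ℂ := !![0, -q; 1, 0]

open Classical in
/-- The value of the functor at a simple diagram, as a composition of tensor products of `id`, `b` and
`d`: the product of the contributions of its arcs. -/
def functorDiagram (q : ℂ) {k l : ℕ} (D : Diagram k l) :
    Matrix (Fin l → Fin 2) (Fin k → Fin 2) ℂ :=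
  Matrix.of fun w' w =>
    (∏ i, ∏ j, if i < j ∧ D.r (Sum.inl i) (Sum.inl j) then capValue q (w i) (w j) else 1) *
    (∏ i, ∏ j, if i < j ∧ D.r (Sum.inr i) (Sum.inr j) then cupValue q (w' i) (w' j) else 1) *
    (∏ i, ∏ j, if D.r (Sum.inl i) (Sum.inr j) ∧ w i ≠ w' j then 0 else 1)

/-- The functor on morphisms. -/
def functor (q : ℂ) {k l : ℕ} :
    LinDiagram k l →ₗ[ℂ] Matrix (Fin l → Fin 2) (Fin k → Fin 2) ℂ :=
  Finsupp.linearCombination ℂ fun D : Diagram k l => functorDiagram q D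

/-- The space of highest weight `b` of the module attached to `s`, that is, of the image of
`V^{⊗|s|}` under the value of the functor at `f_s`: its vectors `v` with `X v = 0` and
`K v = q ^ b v`, where `q = a²`. -/
def highestWeightSpace (a : ℂ) {m : ℕ} (s : Fin m → ℕ) (b : ℕ) :
    Submodule ℂ ((Fin (size s) → Fin 2) → ℂ) :=
  LinearMap.range (functor (a ^ 2) (jwSeq a s)).mulVecLin ⊓
    LinearMap.ker (actX (a ^ 2) (size s)).mulVecLin ⊓
    LinearMap.ker (actK (a ^ 2) (size s) - ((a ^ 2) ^ b) • 1).mulVecLin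

/-! ### The recursive description -/

/-- The simple diagram `D_{n,m,j}` of type `(n + m, k)`, for `j ≤ min n m` and `k = n + m - 2 j`:
`n - j` vertical strands on the left, `j` nested caps joining the last `j` of the first `n` inputs to
the first `j` of the last `m` inputs, and `m - j` vertical strands on the right. -/
def cgDiagram (n m j k : ℕ) : Diagram (n + m) k :=
  Setoid.ker (Sum.elim
    (fun p : Fin (n + m) =>
      if (p : ℕ) < n - j then Sum.inl (p : ℕ)
      else if (p : ℕ) < n then Sum.inr (n - 1 - (p : ℕ))
      else if (p : ℕ) < n + j then Sum.inr ((p : ℕ) - n)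
      else Sum.inl ((p : ℕ) - 2 * j))
    (fun p : Fin k => Sum.inl (p : ℕ)) : Fin (n + m) ⊕ Fin k → ℕ ⊕ ℕ)

/-- The sequence `s' = (n_1, …, n_{m-1})` obtained from `s = (n_1, …, n_m)`. -/
def trunc {M : ℕ} (s : Fin (M + 1) → ℕ) : Fin M → ℕ := fun i => s i.castSucc

/-- The index set of the pairs `(j, p)`: an integer `b = b_j` such that the space of highest weight
`b` of the module attached to `s'` is nonzero, together with `ℓ = ℓ_j` such that
`0 ≤ ℓ ≤ min b n_m` and `b + n_m - 2 ℓ = k`, and a diagram of good type `(s', (b))`. -/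
structure RecIndex (a : ℂ) {M : ℕ} (s : Fin (M + 1) → ℕ) (k : ℕ) where
  b : ℕ
  dim_pos : 0 < Module.finrank ℂ (highestWeightSpace a (trunc s) b)
  ℓ : ℕ
  ℓ_le : ℓ ≤ min b (s (Fin.last M))
  weight_eq : b + s (Fin.last M) = k + 2 * ℓ
  D : Diagram (size (trunc s)) b
  good : IsGoodType a (trunc s) b D

/-- `D_{b,n_m,ℓ} ∘ (D ⊗ 1_{n_m})`, computed in the Temperley-Lieb category. -/
def RecIndex.bar {a : ℂ} {M : ℕ} {s : Fin (M + 1) → ℕ} {k : ℕ} (x : RecIndex a s k) :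
    LinDiagram (size s) k :=
  comp a (cgDiagram x.b (s (Fin.last M)) x.ℓ k).mor
    (tensor x.D.mor (Diagram.id (s (Fin.last M))).mor)

end TemperleyLieb

end

/-!
A diagram is called clean if it joins no two neighbouring inputs in the same block of `s` and no two
neighbouring outputs. The whole statement rests on the fact that a simple diagram is of good type
exactly when it is clean.

* If `D` is simple and not clean, then `D` factors up to the invertible scalar `-(a² + a⁻²)` through a
  generator `e_i` that is annihilated by `f_s` or by `f_k`, so that `f_k D f_s = 0`
  (`hat_eq_zero_of_not_isClean`).
* The elements `f_s - 1` and `f_k - 1` are combinations of diagrams with a cap inside a block,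
  respectively with a cup. Composition preserves such caps and cups, so passing from `g` to `f_k g f_s`
  does not change the coefficients at clean diagrams (`hat_apply_of_isClean`).

Hence the morphisms `f_k D f_s`, for `D` of good type, are linearly independent, and they span because
those of all other simple diagrams vanish. Here the Jones-Wenzl idempotents are constructed by Wenzl's
recursion (`exists_wenzl`). The laws of the Temperley-Lieb category that it needs are obtained by
counting two-colourings of glued diagrams: this turns stacking into a product of matrices in which
every circle contributes a factor `2`, and such a matrix determines both the diagram and the number of
circles (`colMat_mul`, `eq_of_smul_colMat`).

It remains to match clean diagrams with the recursive index set. In a clean simple diagram the last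
block of inputs has no arc within itself, and neither have the outputs. By planarity the arcs between
the two are nested around the right end of the diagram; removing them leaves a clean simple diagram for
the truncated sequence, and inserting them back is composition with `D_{b,n,ℓ}`
(`Diagram.IsClean.exists_eq_nest`, `comp_cgDiagram_tensor`).

Finally, the index set asks for highest weight vectors of weight `b` whenever there is a clean diagram
of type `(s', (b))`. Let `blockSymmetric q s t` be the space of vectors of weight `|s| - 2 t` killed by
all caps inside the blocks. It is fixed by the idempotent `f_s`, the operator `X` maps it to
`blockSymmetric q s (t - 1)`, and its dimension is the number of tuples `0 ≤ c_i ≤ n_i` with sum `t`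
(`finrank_blockSymmetric`). These numbers are symmetric and unimodal, and the recursive description of
clean diagrams gives a strict increase at the weight `b` (`exists_weightCount_lt`), so that `X` has a
kernel there.
-/

noncomputable section

namespace TemperleyLieb

/-! ### Colourings and the composition of diagrams -/

/-- A two-colouring `(w, v)` of the boundary points that is constant on the classes of `D`. -/
def Diagram.Colors {k l : ℕ} (D : Diagram k l) (w : Fin k → Bool) (v : Fin l → Bool) : Prop :=
  D ≤ Setoid.ker (Sum.elim w v)

theorem setoid_map_le_iff {α β : Type*} {r : Setoid α} {f : α → β} {t : Setoid β} :
    Setoid.map r f ≤ t ↔ r ≤ Setoid.comap f t := by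
  constructor
  · exact fun h => (Setoid.le_comap_map (r := r) (f := f)).trans fun x y hxy => h hxy
  · intro h
    refine Setoid.eqvGen_le fun x y hxy => ?_
    obtain ⟨x, y, hr, rfl, rfl⟩ := hxy
    exact h hr

theorem setoid_eq_of_le_ker_iff {α : Type*} {r s : Setoid α}
    (h : ∀ φ : α → Bool, r ≤ Setoid.ker φ ↔ s ≤ Setoid.ker φ) : r = s := by
  classical
  have key : ∀ r s : Setoid α, (∀ φ : α → Bool, s ≤ Setoid.ker φ → r ≤ Setoid.ker φ) → r ≤ s := by
    intro r s h x y hxy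
    have h1 := h (fun z => decide (s x z)) (fun y z hyz => by
      have : s x y ↔ s x z := ⟨fun h => s.trans' h hyz, fun h => s.trans' h (s.symm' hyz)⟩
      simp [Setoid.ker_def, this]) hxy
    have h2 := (Setoid.ker_def.1 h1).symm
    simpa [s.refl' x] using h2
  exact le_antisymm (key r s fun φ => (h φ).2) (key s r fun φ => (h φ).1)

theorem Diagram.ext_colors {k l : ℕ} {D D' : Diagram k l}
    (h : ∀ w v, D.Colors w v ↔ D'.Colors w v) : D = D' :=
  setoid_eq_of_le_ker_iff fun φ => by
    have := h (φ ∘ Sum.inl) (φ ∘ Sum.inr)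
    rwa [Diagram.Colors, Diagram.Colors, Sum.elim_comp_inl_inr] at this

theorem glue_le_ker_iff {k l m : ℕ} {D₁ : Diagram l m} {D₂ : Diagram k l} {w : Fin k → Bool}
    {v : Fin l → Bool} {u : Fin m → Bool} :
    D₁.glue D₂ ≤ Setoid.ker (Sum.elim w (Sum.elim v u)) ↔ D₂.Colors w v ∧ D₁.Colors v u := by
  rw [Diagram.glue, sup_le_iff, setoid_map_le_iff, setoid_map_le_iff]
  have h1 : Setoid.comap (Sum.map (fun i => i) Sum.inl) (Setoid.ker (Sum.elim w (Sum.elim v u)))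
      = Setoid.ker (Sum.elim w v) := by
    ext x y
    rcases x with x | x <;> rcases y with y | y <;> rfl
  have h2 : Setoid.comap Sum.inr (Setoid.ker (Sum.elim w (Sum.elim v u)))
      = Setoid.ker (Sum.elim v u) := by
    ext x y
    rcases x with x | x <;> rcases y with y | y <;> rfl
  rw [h1, h2, Diagram.Colors, Diagram.Colors]

/-- Two-colourings of a finite set with prescribed values on the image of `b`. -/
theorem card_colorings_extending {X Q : Type*} [Finite Q] (b : X → Q) (g : X → Bool)
    (h : ∀ x y, b x = b y → g x = g y) :
    Nat.card {ψ : Q → Bool // ∀ x, ψ (b x) = g x} = 2 ^ Nat.card {c : Q // ∀ x, c ≠ b x} := by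
  classical
  have e : {ψ : Q → Bool // ∀ x, ψ (b x) = g x} ≃ ({c : Q // ∀ x, c ≠ b x} → Bool) :=
    { toFun := fun ψ c => ψ.1 c.1
      invFun := fun χ => ⟨fun c => if hc : ∃ x, c = b x then g hc.choose else
          χ ⟨c, fun x hx => hc ⟨x, hx⟩⟩, fun x => by
          have hx : ∃ y, b x = b y := ⟨x, rfl⟩
          simp only [dif_pos hx]
          exact h _ _ hx.choose_spec.symm⟩
      left_inv := fun ψ => by
        ext c
        by_cases hc : ∃ x, c = b x
        · simp only [dif_pos hc]
          rw [← ψ.2 hc.choose, ← hc.choose_spec]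
        · simp only [dif_neg hc]
      right_inv := fun χ => by
        ext c
        have hc : ¬ ∃ x, c.1 = b x := fun ⟨x, hx⟩ => c.2 x hx
        simp only [dif_neg hc] }
  rw [Nat.card_congr e, Nat.card_fun]
  simp

open Classical in
/-- The matrix whose entries indicate which two-colourings of the boundary are compatible with
`D`. It is the value at `D` of a functor in which a circle has the value `2`. -/
def colMat {k l : ℕ} (D : Diagram k l) : Matrix (Fin k → Bool) (Fin l → Bool) ℕ :=
  Matrix.of fun w v => if D.Colors w v then 1 else 0

theorem colMat_of_colors {k l : ℕ} {D : Diagram k l} {w : Fin k → Bool} {v : Fin l → Bool}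
    (h : D.Colors w v) : colMat D w v = 1 := by simp [colMat, h]

theorem colMat_of_not_colors {k l : ℕ} {D : Diagram k l} {w : Fin k → Bool} {v : Fin l → Bool}
    (h : ¬ D.Colors w v) : colMat D w v = 0 := by simp [colMat, h]

/-- A colouring of the outer boundary that is compatible with the stacked diagram extends to the
glued points, and the extensions correspond to the colourings of the circles. -/
theorem card_colors {k l m : ℕ} (D₁ : Diagram l m) (D₂ : Diagram k l) (w : Fin k → Bool)
    (u : Fin m → Bool) (h : (D₁.stack D₂).Colors w u) :
    Nat.card {v : Fin l → Bool // D₂.Colors w v ∧ D₁.Colors v u} = 2 ^ D₁.circles D₂ := by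
  have hb : ∀ x y : Fin k ⊕ Fin m, (Quotient.mk (D₁.glue D₂) (Diagram.outer x)) =
      Quotient.mk (D₁.glue D₂) (Diagram.outer y) → Sum.elim w u x = Sum.elim w u y :=
    fun x y hxy => h (show (D₁.glue D₂) _ _ from Quotient.exact hxy)
  rw [Diagram.circles, ← card_colorings_extending _ _ hb]
  refine Nat.card_congr
    { toFun := fun v => ⟨Quotient.lift (Sum.elim w (Sum.elim v.1 u)) fun x y hxy =>
          glue_le_ker_iff.2 v.2 hxy, fun x => by rcases x with x | x <;> rfl⟩
      invFun := fun ψ => ⟨fun i => ψ.1 (Quotient.mk _ (Sum.inr (Sum.inl i))), by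
          refine glue_le_ker_iff.1 fun x y hxy => ?_
          have key : ∀ x, Sum.elim w (Sum.elim
              (fun i => ψ.1 (Quotient.mk _ (Sum.inr (Sum.inl i)))) u) x =
              ψ.1 (Quotient.mk (D₁.glue D₂) x) := by
            rintro (x | x | x)
            · exact (ψ.2 (Sum.inl x)).symm
            · rfl
            · exact (ψ.2 (Sum.inr x)).symm
          rw [Setoid.ker_def, key, key, Quotient.sound hxy]⟩
      left_inv := fun v => rfl
      right_inv := fun ψ => by
        ext c
        induction c using Quotient.inductionOn with
        | h x =>
          rcases x with x | x | x
          · exact (ψ.2 (Sum.inl x)).symm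
          · rfl
          · exact (ψ.2 (Sum.inr x)).symm }

theorem stack_colors {k l m : ℕ} {D₁ : Diagram l m} {D₂ : Diagram k l} {w : Fin k → Bool}
    {v : Fin l → Bool} {u : Fin m → Bool} (h₂ : D₂.Colors w v) (h₁ : D₁.Colors v u) :
    (D₁.stack D₂).Colors w u := fun x y hxy => by
  have := glue_le_ker_iff.2 ⟨h₂, h₁⟩ hxy
  rcases x with x | x <;> rcases y with y | y <;> exact this

theorem colMat_mul {k l m : ℕ} (D₁ : Diagram l m) (D₂ : Diagram k l) :
    colMat D₂ * colMat D₁ = 2 ^ D₁.circles D₂ • colMat (D₁.stack D₂) := by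
  classical
  ext w u
  have h1 : (colMat D₂ * colMat D₁) w u =
      Nat.card {v : Fin l → Bool // D₂.Colors w v ∧ D₁.Colors v u} := by
    rw [Nat.card_eq_fintype_card, Fintype.card_subtype, Finset.card_filter, Matrix.mul_apply]
    refine Finset.sum_congr rfl fun v _ => ?_
    by_cases h2 : D₂.Colors w v <;> by_cases h3 : D₁.Colors v u <;> simp [colMat, h2, h3]
  rw [h1, Matrix.smul_apply]
  by_cases h : (D₁.stack D₂).Colors w u
  · rw [card_colors _ _ _ _ h, colMat_of_colors h, smul_eq_mul, mul_one]
  · rw [colMat_of_not_colors h, smul_zero]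
    have : IsEmpty {v : Fin l → Bool // D₂.Colors w v ∧ D₁.Colors v u} :=
      ⟨fun v => h (stack_colors v.2.1 v.2.2)⟩
    exact Nat.card_of_isEmpty

/-- Powers of `2` and diagrams can be read off from the matrix of colourings: evaluate at a constant
colouring, which is compatible with every diagram. -/
theorem eq_of_smul_colMat {k l c c' : ℕ} {D D' : Diagram k l}
    (h : 2 ^ c • colMat D = 2 ^ c' • colMat D') : c = c' ∧ D = D' := by
  have hc : ∀ D : Diagram k l, D.Colors (fun _ => true) (fun _ => true) := fun D x y _ => by
    rcases x with x | x <;> rcases y with y | y <;> rfl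
  have h0 := congr_fun (congr_fun h (fun _ => true)) (fun _ => true)
  rw [Matrix.smul_apply, Matrix.smul_apply, colMat_of_colors (hc D), colMat_of_colors (hc D'),
    smul_eq_mul, smul_eq_mul, mul_one, mul_one] at h0
  refine ⟨Nat.pow_right_injective le_rfl h0, Diagram.ext_colors fun w v => ?_⟩
  have h1 := congr_fun (congr_fun h w) v
  rw [Matrix.smul_apply, Matrix.smul_apply, h0] at h1
  have h4 := Nat.mul_left_cancel (by positivity) h1
  by_cases h2 : D.Colors w v <;> by_cases h3 : D'.Colors w v <;>
    simp [colMat, h2, h3] at h4 ⊢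

theorem stack_eq_of_colMat {k l m c : ℕ} {D₁ : Diagram l m} {D₂ : Diagram k l} {D : Diagram k m}
    (h : colMat D₂ * colMat D₁ = 2 ^ c • colMat D) : D₁.circles D₂ = c ∧ D₁.stack D₂ = D :=
  eq_of_smul_colMat (by rw [← colMat_mul, h])

/-! ### The Temperley-Lieb category -/

/-- The value `-(a² + a⁻²)` of a circle. -/
def loopValue (a : ℂ) : ℂ := -(a ^ 2 + (a ^ 2)⁻¹)

variable {a : ℂ}

theorem comp_mor {k l m : ℕ} (D₁ : Diagram l m) (D₂ : Diagram k l) :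
    comp a D₁.mor D₂.mor = loopValue a ^ D₁.circles D₂ • (D₁.stack D₂).mor := by
  simp [comp, Diagram.mor, loopValue]

theorem tensor_mor {k l k' l' : ℕ} (D : Diagram k l) (D' : Diagram k' l') :
    tensor D.mor D'.mor = (D.juxt D').mor := by
  simp [tensor, Diagram.mor]

theorem comp_mor_of_colMat {k l m c : ℕ} {D₁ : Diagram l m} {D₂ : Diagram k l} {D : Diagram k m}
    (h : colMat D₂ * colMat D₁ = 2 ^ c • colMat D) :
    comp a D₁.mor D₂.mor = loopValue a ^ c • D.mor := by
  obtain ⟨h1, h2⟩ := stack_eq_of_colMat h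
  rw [comp_mor, h1, h2]

/-- An identity between linear expressions in a morphism holds if it holds for diagrams. -/
theorem linDiagram_induction {k l : ℕ} {p : LinDiagram k l → Prop} (x : LinDiagram k l)
    (hm : ∀ D : Diagram k l, p D.mor) (h0 : p 0) (hadd : ∀ x y, p x → p y → p (x + y))
    (hs : ∀ (c : ℂ) x, p x → p (c • x)) : p x := by
  induction x using Finsupp.induction_linear with
  | zero => exact h0
  | add x y hx hy => exact hadd x y hx hy
  | single D c =>
    have := hs c _ (hm D)
    rwa [Diagram.mor, Finsupp.smul_single, smul_eq_mul, mul_one] at this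

theorem comp_assoc {k l m n : ℕ} (x : LinDiagram m n) (y : LinDiagram l m) (z : LinDiagram k l) :
    comp a (comp a x y) z = comp a x (comp a y z) := by
  induction x using linDiagram_induction with
  | h0 => simp
  | hadd x x' hx hx' => simp [hx, hx']
  | hs c x hx => simp [hx]
  | hm D₁ =>
  induction y using linDiagram_induction with
  | h0 => simp
  | hadd x x' hx hx' => simp [hx, hx']
  | hs c x hx => simp [hx]
  | hm D₂ =>
  induction z using linDiagram_induction with
  | h0 => simp
  | hadd x x' hx hx' => simp [hx, hx']
  | hs c x hx => simp [hx]
  | hm D₃ =>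
  have h : 2 ^ (D₁.circles D₂ + (D₁.stack D₂).circles D₃) • colMat ((D₁.stack D₂).stack D₃) =
      2 ^ (D₂.circles D₃ + D₁.circles (D₂.stack D₃)) • colMat (D₁.stack (D₂.stack D₃)) := by
    rw [pow_add, mul_smul, ← colMat_mul, ← Matrix.mul_smul, ← colMat_mul, ← Matrix.mul_assoc,
      colMat_mul, Matrix.smul_mul, colMat_mul, pow_add, mul_smul]
  obtain ⟨h1, h2⟩ := eq_of_smul_colMat h
  rw [comp_mor, comp_mor, map_smul, map_smul, LinearMap.smul_apply, comp_mor, comp_mor, smul_smul,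
    smul_smul, ← pow_add, ← pow_add, h1, h2]

theorem ker_le_ker_iff {α β : Type*} {f : α → β} {φ : α → Bool} :
    Setoid.ker f ≤ Setoid.ker φ ↔ ∀ x y, f x = f y → φ x = φ y :=
  ⟨fun h _ _ hxy => h hxy, fun h _ _ hxy => h _ _ hxy⟩

theorem id_colors {k : ℕ} {w v : Fin k → Bool} : (Diagram.id k).Colors w v ↔ w = v := by
  rw [Diagram.Colors, Diagram.id, ker_le_ker_iff]
  constructor
  · exact fun h => funext fun i => h (Sum.inl i) (Sum.inr i) rfl
  · rintro rfl (x | x) (y | y) h <;> simp_all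

theorem colMat_id (k : ℕ) : colMat (Diagram.id k) = 1 := by
  classical
  ext w v
  simp [colMat, id_colors, Matrix.one_apply]

theorem id_comp {k l : ℕ} (x : LinDiagram k l) : comp a (Diagram.id l).mor x = x := by
  induction x using linDiagram_induction with
  | h0 => simp
  | hadd x x' hx hx' => simp [hx, hx']
  | hs c x hx => simp [hx]
  | hm D =>
    have h : colMat D * colMat (Diagram.id l) = 2 ^ 0 • colMat D := by simp [colMat_id]
    rw [comp_mor_of_colMat h, pow_zero, one_smul]

theorem comp_id {k l : ℕ} (x : LinDiagram k l) : comp a x (Diagram.id k).mor = x := by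
  induction x using linDiagram_induction with
  | h0 => simp
  | hadd x x' hx hx' => simp [hx, hx']
  | hs c x hx => simp [hx]
  | hm D =>
    have h : colMat (Diagram.id k) * colMat D = 2 ^ 0 • colMat D := by simp [colMat_id]
    rw [comp_mor_of_colMat h, pow_zero, one_smul]

theorem juxt_colors {k l k' l' : ℕ} {D : Diagram k l} {D' : Diagram k' l'} {w : Fin k → Bool}
    {w' : Fin k' → Bool} {v : Fin l → Bool} {v' : Fin l' → Bool} :
    (D.juxt D').Colors (Fin.append w w') (Fin.append v v') ↔ D.Colors w v ∧ D'.Colors w' v' := by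
  rw [Diagram.Colors, Diagram.juxt, sup_le_iff, setoid_map_le_iff, setoid_map_le_iff]
  have h1 : Setoid.comap (Sum.map (Fin.castAdd k') (Fin.castAdd l'))
      (Setoid.ker (Sum.elim (Fin.append w w') (Fin.append v v'))) = Setoid.ker (Sum.elim w v) := by
    ext x y
    rcases x with x | x <;> rcases y with y | y <;> simp [Setoid.ker_def]
  have h2 : Setoid.comap (Sum.map (Fin.natAdd k) (Fin.natAdd l))
      (Setoid.ker (Sum.elim (Fin.append w w') (Fin.append v v')))
      = Setoid.ker (Sum.elim w' v') := by
    ext x y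
    rcases x with x | x <;> rcases y with y | y <;> simp [Setoid.ker_def]
  rw [h1, h2, Diagram.Colors, Diagram.Colors]

theorem colMat_juxt {k l k' l' : ℕ} (D : Diagram k l) (D' : Diagram k' l') (w : Fin k → Bool)
    (w' : Fin k' → Bool) (v : Fin l → Bool) (v' : Fin l' → Bool) :
    colMat (D.juxt D') (Fin.append w w') (Fin.append v v') = colMat D w v * colMat D' w' v' := by
  by_cases h : D.Colors w v <;> by_cases h' : D'.Colors w' v' <;> simp [colMat, juxt_colors, h, h']

theorem colMat_juxt_mul {k l m k' l' m' : ℕ} (D₁ : Diagram l m) (D₂ : Diagram k l)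
    (D₁' : Diagram l' m') (D₂' : Diagram k' l') :
    colMat (D₂.juxt D₂') * colMat (D₁.juxt D₁') =
      2 ^ (D₁.circles D₂ + D₁'.circles D₂') • colMat ((D₁.stack D₂).juxt (D₁'.stack D₂')) := by
  ext w u
  obtain ⟨⟨w, w'⟩, rfl⟩ := (Fin.appendEquiv k k').surjective w
  obtain ⟨⟨u, u'⟩, rfl⟩ := (Fin.appendEquiv m m').surjective u
  have h1 := congr_fun (congr_fun (colMat_mul D₁ D₂) w) u
  have h2 := congr_fun (congr_fun (colMat_mul D₁' D₂') w') u'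
  rw [Matrix.smul_apply, Matrix.mul_apply] at h1 h2
  simp only [Fin.appendEquiv, Equiv.coe_fn_mk]
  rw [smul_eq_mul] at h1 h2
  rw [Matrix.smul_apply, colMat_juxt, pow_add, smul_eq_mul, mul_mul_mul_comm, ← h1, ← h2,
    Matrix.mul_apply, ← (Fin.appendEquiv l l').sum_comp, Fintype.sum_prod_type,
    Finset.sum_mul_sum]
  refine Finset.sum_congr rfl fun v _ => Finset.sum_congr rfl fun v' _ => ?_
  simp only [Fin.appendEquiv, Equiv.coe_fn_mk]
  rw [colMat_juxt, colMat_juxt]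
  ring

/-- The interchange law. -/
theorem comp_tensor {k l m k' l' m' : ℕ} (x : LinDiagram l m) (y : LinDiagram k l)
    (x' : LinDiagram l' m') (y' : LinDiagram k' l') :
    comp a (tensor x x') (tensor y y') = tensor (comp a x y) (comp a x' y') := by
  induction x using linDiagram_induction with
  | h0 => simp
  | hadd x x' hx hx' => simp [hx, hx']
  | hs c x hx => simp [hx]
  | hm D₁ =>
  induction y using linDiagram_induction with
  | h0 => simp
  | hadd x x' hx hx' => simp [hx, hx']
  | hs c x hx => simp [hx]
  | hm D₂ =>
  induction x' using linDiagram_induction with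
  | h0 => simp
  | hadd x x' hx hx' => simp [hx, hx']
  | hs c x hx => simp [hx]
  | hm D₁' =>
  induction y' using linDiagram_induction with
  | h0 => simp
  | hadd x x' hx hx' => simp [hx, hx']
  | hs c x hx => simp [hx]
  | hm D₂' =>
  rw [tensor_mor, tensor_mor, comp_mor_of_colMat (colMat_juxt_mul _ _ _ _), comp_mor, comp_mor,
    map_smul, map_smul, LinearMap.smul_apply, tensor_mor, smul_smul, ← pow_add,
    add_comm (D₁.circles D₂)]

/-! ### The Temperley-Lieb relations -/

/-- Compatibility of the two-colourings `w` and `v` with the diagram having a cap and a cup at the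
points `p`, `q` and vertical strands elsewhere. -/
def PairColors {n : ℕ} (p q : Fin n) (w v : Fin n → Bool) : Prop :=
  w p = w q ∧ v p = v q ∧ ∀ r, r ≠ p → r ≠ q → w r = v r

theorem PairColors.swap {n : ℕ} {p q : Fin n} {w v : Fin n → Bool} (h : PairColors p q w v) :
    PairColors q p w v := ⟨h.1.symm, h.2.1.symm, fun r h1 h2 => h.2.2 r h2 h1⟩

theorem PairColors.symm {n : ℕ} {p q : Fin n} {w v : Fin n → Bool} (h : PairColors p q w v) :
    PairColors p q v w := ⟨h.2.1, h.1, fun r h1 h2 => (h.2.2 r h1 h2).symm⟩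

open Classical in
/-- The matrix of indicators of `PairColors`. -/
def pairMat {n : ℕ} (p q : Fin n) : Matrix (Fin n → Bool) (Fin n → Bool) ℕ :=
  Matrix.of fun w v => if PairColors p q w v then 1 else 0

theorem pairMat_comm {n : ℕ} (p q : Fin n) : pairMat p q = pairMat q p := by
  ext w v
  have : PairColors p q w v ↔ PairColors q p w v := ⟨.swap, .swap⟩
  classical exact if_congr this rfl rfl

theorem pairMat_transpose {n : ℕ} (p q : Fin n) : (pairMat p q).transpose = pairMat p q := by
  ext w v
  have : PairColors p q v w ↔ PairColors p q w v := ⟨.symm, .symm⟩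
  classical exact if_congr this rfl rfl

theorem eDiagram_colors {n i : ℕ} (hi : i + 1 < n) {w v : Fin n → Bool} :
    (eDiagram n i).Colors w v ↔ PairColors ⟨i, by omega⟩ ⟨i + 1, hi⟩ w v := by
  rw [Diagram.Colors, eDiagram, ker_le_ker_iff]
  constructor
  · intro h
    refine ⟨h (Sum.inl _) (Sum.inl _) (by simp), h (Sum.inr _) (Sum.inr _) (by simp),
      fun r h1 h2 => h (Sum.inl r) (Sum.inr r) ?_⟩
    simp only [Sum.elim_inl, Sum.elim_inr]
    rw [if_neg, if_neg] <;> (simp only [ne_eq, Fin.ext_iff] at h1 h2; omega)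
  · rintro ⟨h1, h2, h3⟩
    have key : ∀ (u : Fin n → Bool) (_ : u ⟨i, by omega⟩ = u ⟨i + 1, hi⟩) (x y : Fin n),
        ((x : ℕ) = i ∨ (x : ℕ) = i + 1) → ((y : ℕ) = i ∨ (y : ℕ) = i + 1) → u x = u y := by
      rintro u hu ⟨x, hx⟩ ⟨y, hy⟩ (rfl | rfl) (h | h) <;> simp only at h <;> subst h <;>
        first | rfl | exact hu | exact hu.symm
    have key' : ∀ x : Fin n, ¬ ((x : ℕ) = i ∨ (x : ℕ) = i + 1) → w x = v x := fun x hx =>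
      h3 x (fun h => hx (Or.inl (by rw [h]))) (fun h => hx (Or.inr (by rw [h])))
    rintro (x | x) (y | y) h <;> simp only [Sum.elim_inl, Sum.elim_inr] at h ⊢ <;>
      split_ifs at h with hx hy hy
    · exact key w h1 x y hx hy
    · rw [Fin.ext (Sum.inl_injective h)]
    · exact absurd h (by simp)
    · rw [key' x hx, Fin.ext (Sum.inl_injective h)]
    · exact absurd h (by simp)
    · rw [key' y hy, Fin.ext (Sum.inl_injective h)]
    · exact key v h2 x y hx hy
    · rw [Fin.ext (Sum.inl_injective h)]

theorem colMat_eDiagram {n i : ℕ} (hi : i + 1 < n) :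
    colMat (eDiagram n i) = pairMat ⟨i, by omega⟩ ⟨i + 1, hi⟩ := by
  ext w v
  classical exact if_congr (eDiagram_colors hi) rfl rfl

theorem pairMat_mul_comm {n : ℕ} {p q r s : Fin n} (hpr : p ≠ r) (hps : p ≠ s) (hqr : q ≠ r)
    (hqs : q ≠ s) : pairMat p q * pairMat r s = pairMat r s * pairMat p q := by
  classical
  have key : ∀ {p q r s : Fin n} (_ : p ≠ r) (_ : p ≠ s) (_ : q ≠ r) (_ : q ≠ s)
      (w u : Fin n → Bool), (pairMat p q * pairMat r s) w u =
      if w p = w q ∧ w r = w s ∧ u p = u q ∧ u r = u s ∧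
        ∀ t, t ≠ p → t ≠ q → t ≠ r → t ≠ s → w t = u t then 1 else 0 := by
    intro p q r s hpr hps hqr hqs w u
    set v : Fin n → Bool := fun t => if t = p ∨ t = q then u t else w t with hv
    rw [Matrix.mul_apply, Finset.sum_eq_single v]
    · have : (PairColors p q w v ∧ PairColors r s v u) ↔ (w p = w q ∧ w r = w s ∧ u p = u q ∧
          u r = u s ∧ ∀ t, t ≠ p → t ≠ q → t ≠ r → t ≠ s → w t = u t) := by
        simp only [PairColors, hv]
        constructor
        · rintro ⟨⟨h1, h2, h3⟩, h4, h5, h6⟩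
          simp only [hpr.symm, hps.symm, hqr.symm, hqs.symm, or_self, if_false] at h4
          simp only [true_or, or_true, if_true] at h2
          refine ⟨h1, h4, h2, h5, fun t h7 h8 h9 h10 => ?_⟩
          simpa [h7, h8] using h6 t h9 h10
        · rintro ⟨h1, h2, h3, h4, h5⟩
          refine ⟨⟨h1, by simpa using h3, fun t h6 h7 => by simp [h6, h7]⟩,
            by simpa [hpr.symm, hps.symm, hqr.symm, hqs.symm] using h2, h4, fun t h6 h7 => ?_⟩
          by_cases h8 : t = p ∨ t = q
          · simp [h8]
          · rw [if_neg h8]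
            push Not at h8
            exact h5 t h8.1 h8.2 h6 h7
      simp only [pairMat, Matrix.of_apply, ← ite_and, mul_ite, mul_one, mul_zero]
      exact if_congr (and_comm.trans this) rfl rfl
    · intro v' _ hne
      by_contra h
      simp only [pairMat, Matrix.of_apply, mul_ite, mul_one, mul_zero, ite_eq_right_iff, not_forall,
        one_ne_zero, not_false_eq_true] at h
      obtain ⟨h1, h2, -⟩ := h
      refine hne (funext fun t => ?_)
      simp only [hv]
      split_ifs with ht
      · rcases ht with rfl | rfl
        · exact h1.2.2 _ hpr hps
        · exact h1.2.2 _ hqr hqs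
      · push Not at ht
        exact (h2.2.2 t ht.1 ht.2).symm
    · simp
  ext w u
  rw [key hpr hps hqr hqs, key hpr.symm hqr.symm hps.symm hqs.symm]
  refine if_congr ⟨?_, ?_⟩ rfl rfl
  · rintro ⟨h1, h2, h3, h4, h5⟩
    exact ⟨h2, h1, h4, h3, fun t a b c d => h5 t c d a b⟩
  · rintro ⟨h1, h2, h3, h4, h5⟩
    exact ⟨h2, h1, h4, h3, fun t a b c d => h5 t c d a b⟩

theorem pairMat_mul_mul {n : ℕ} {p q t : Fin n} (hpt : p ≠ t) (hqt : q ≠ t) (hpq : p ≠ q) :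
    pairMat p q * pairMat q t * pairMat p q = pairMat p q := by
  classical
  ext w u
  set v : Fin n → Bool := fun r => if r = p ∨ r = q then w t else w r with hv
  have vp : v p = w t := by simp [hv]
  have vq : v q = w t := by simp [hv]
  have vr : ∀ r, r ≠ p → r ≠ q → v r = w r := fun r h1 h2 => by simp [hv, h1, h2]
  have vt : v t = w t := vr t hpt.symm hqt.symm
  -- the first two factors force the intermediate colouring to be `v`
  have h1 : ∀ x, (pairMat p q * pairMat q t) w x =
      if w p = w q then (if PairColors q t v x then 1 else 0) else 0 := by
    intro x
    rw [Matrix.mul_apply, Finset.sum_eq_single v]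
    · have : PairColors p q w v ↔ w p = w q :=
        ⟨fun h => h.1, fun h => ⟨h, vp.trans vq.symm, fun r h1 h2 => (vr r h1 h2).symm⟩⟩
      by_cases h : w p = w q <;> simp [pairMat, this, h]
    · intro v' _ hne
      by_contra h
      simp only [pairMat, Matrix.of_apply, mul_ite, mul_one, mul_zero, ite_eq_right_iff, not_forall,
        one_ne_zero, not_false_eq_true] at h
      obtain ⟨h1, h2, -⟩ := h
      have hq : v' q = w t := h1.1.trans (h2.2.2 t hpt.symm hqt.symm).symm
      refine hne (funext fun r => ?_)
      by_cases hp : r = p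
      · rw [hp, vp, h2.2.1, hq]
      by_cases hr : r = q
      · rw [hr, vq, hq]
      · rw [vr r hp hr, h2.2.2 r hp hr]
    · simp
  rw [Matrix.mul_apply, Finset.sum_eq_single v]
  · have h2 : PairColors q t v v := ⟨vq.trans vt.symm, vq.trans vt.symm, fun _ _ _ => rfl⟩
    have h3 : PairColors p q w u ↔ w p = w q ∧ PairColors p q v u := by
      constructor
      · exact fun h => ⟨h.1, vp.trans vq.symm, h.2.1,
          fun r h1 h2 => (vr r h1 h2).trans (h.2.2 r h1 h2)⟩
      · exact fun h => ⟨h.1, h.2.2.1, fun r h1 h2 => (vr r h1 h2).symm.trans (h.2.2.2 r h1 h2)⟩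
    rw [h1, if_pos h2]
    simp only [pairMat, Matrix.of_apply, h3, ite_and, ite_mul, one_mul, zero_mul]
  · intro x _ hne
    by_contra h
    rw [h1] at h
    simp only [pairMat, Matrix.of_apply, mul_ite, mul_one, mul_zero, ite_eq_right_iff, not_forall,
      one_ne_zero, not_false_eq_true] at h
    obtain ⟨h2, h3, h4, -⟩ := h
    refine hne (funext fun r => ?_)
    have hp : v p = x p := h4.2.2 p hpq hpt
    by_cases hq : r = q
    · rw [hq, ← h2.1, ← hp, vp, vq]
    by_cases ht : r = t
    · rw [ht, ← h4.2.1, ← h2.1, ← hp, vp, vt]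
    · exact (h4.2.2 r hq ht).symm
  · simp

/-- The inputs `i` and `i + 1` form a class of `D`. -/
def Diagram.CapAt {k l : ℕ} (D : Diagram k l) (i : ℕ) : Prop :=
  ∃ h : i + 1 < k, D.r (Sum.inl ⟨i, by omega⟩) (Sum.inl ⟨i + 1, h⟩) ∧
    ∀ y, D.r (Sum.inl ⟨i, by omega⟩) y → y = Sum.inl ⟨i, by omega⟩ ∨ y = Sum.inl ⟨i + 1, h⟩

theorem Diagram.Colors.congr_cap {k l : ℕ} {D : Diagram k l} {i : ℕ} (hi : i + 1 < k)
    (hr : ∀ y, D.r (Sum.inl ⟨i, by omega⟩) y →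
      y = Sum.inl ⟨i, by omega⟩ ∨ y = Sum.inl ⟨i + 1, hi⟩)
    (hr' : D.r (Sum.inl ⟨i, by omega⟩) (Sum.inl ⟨i + 1, hi⟩))
    {w w' : Fin k → Bool} {u : Fin l → Bool} (h : D.Colors w u)
    (h1 : w' ⟨i, by omega⟩ = w' ⟨i + 1, hi⟩)
    (h2 : ∀ r, r ≠ ⟨i, by omega⟩ → r ≠ ⟨i + 1, hi⟩ → w r = w' r) : D.Colors w' u := by
  intro x y hxy
  have key : ∀ x y : Fin k ⊕ Fin l, D.r x y →
      (x = Sum.inl ⟨i, by omega⟩ ∨ x = Sum.inl ⟨i + 1, hi⟩) →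
      Sum.elim w' u x = Sum.elim w' u y := by
    intro x y hxy hx
    have hix : D.r (Sum.inl ⟨i, by omega⟩) x := by
      rcases hx with rfl | rfl
      · exact D.refl' _
      · exact hr'
    have hy := hr y (D.trans' hix hxy)
    rcases hx with rfl | rfl <;> rcases hy with rfl | rfl <;> simp [h1]
  by_cases hx : x = Sum.inl ⟨i, by omega⟩ ∨ x = Sum.inl ⟨i + 1, hi⟩
  · exact key x y hxy hx
  by_cases hy : y = Sum.inl ⟨i, by omega⟩ ∨ y = Sum.inl ⟨i + 1, hi⟩
  · exact (key y x (D.symm' hxy) hy).symm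
  have h3 : ∀ z : Fin k ⊕ Fin l, ¬ (z = Sum.inl ⟨i, by omega⟩ ∨ z = Sum.inl ⟨i + 1, hi⟩) →
      Sum.elim w' u z = Sum.elim w u z := by
    rintro (z | z) hz
    · push Not at hz
      exact (h2 z (fun h => hz.1 (by rw [h])) (fun h => hz.2 (by rw [h]))).symm
    · rfl
  rw [Setoid.ker_def, h3 x hx, h3 y hy]
  exact h hxy

theorem colMat_eDiagram_mul {k l i : ℕ} {D : Diagram k l} (h : D.CapAt i) :
    colMat (eDiagram k i) * colMat D = 2 ^ 1 • colMat D := by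
  classical
  obtain ⟨hi, hr', hr⟩ := h
  ext w u
  rw [colMat_eDiagram hi, Matrix.mul_apply, Matrix.smul_apply]
  by_cases hw : w ⟨i, by omega⟩ = w ⟨i + 1, hi⟩
  · let v : Bool → Fin k → Bool := fun x r =>
      if r = ⟨i, by omega⟩ ∨ r = ⟨i + 1, hi⟩ then x else w r
    have hv : ∀ x r, r ≠ ⟨i, by omega⟩ → r ≠ ⟨i + 1, hi⟩ → v x r = w r :=
      fun x r h1 h2 => by simp [v, h1, h2]
    rw [← Fintype.sum_of_injective v (f := fun _ => colMat D w u)]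
    · simp
    · intro x y hxy
      simpa [v] using congr_fun hxy ⟨i, by omega⟩
    · intro v' hv'
      have : ¬ PairColors ⟨i, by omega⟩ ⟨i + 1, hi⟩ w v' := by
        intro h
        refine hv' ⟨v' ⟨i, by omega⟩, funext fun r => ?_⟩
        simp only [v]
        split_ifs with hr
        · rcases hr with rfl | rfl
          · rfl
          · exact h.2.1
        · push Not at hr
          exact h.2.2 r hr.1 hr.2
      simp [pairMat, this]
    · intro x
      have h1 : PairColors ⟨i, by omega⟩ ⟨i + 1, hi⟩ w (v x) :=
        ⟨hw, by simp [v], fun r h1 h2 => (hv x r h1 h2).symm⟩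
      have h2 : D.Colors w u ↔ D.Colors (v x) u :=
        ⟨fun h => h.congr_cap hi hr hr' (by simp [v]) fun r h1 h2 => (hv x r h1 h2).symm,
          fun h => h.congr_cap hi hr hr' hw fun r h1 h2 => hv x r h1 h2⟩
      simp [pairMat, h1, colMat, h2]
  · have h1 : ¬ D.Colors w u := fun h => hw (h hr')
    rw [colMat_of_not_colors h1, smul_zero]
    refine Finset.sum_eq_zero fun v _ => ?_
    have : ¬ PairColors ⟨i, by omega⟩ ⟨i + 1, hi⟩ w v := fun h => hw h.1
    simp [pairMat, this]

/-- The mirror image of a diagram in a horizontal line. -/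
@[reducible] def Diagram.flip {k l : ℕ} (D : Diagram k l) : Diagram l k := Setoid.comap Sum.swap D

theorem colMat_flip {k l : ℕ} (D : Diagram k l) : colMat D.flip = (colMat D).transpose := by
  ext w v
  have : D.flip.Colors w v ↔ D.Colors v w := by
    constructor
    · intro h x y hxy
      have := @h x.swap y.swap (by simpa [Diagram.flip, Setoid.comap_rel] using hxy)
      rcases x with x | x <;> rcases y with y | y <;> exact this
    · intro h x y hxy
      have := h hxy
      rcases x with x | x <;> rcases y with y | y <;> exact this
  classical exact if_congr this rfl rfl

theorem colMat_mul_eDiagram {k l i : ℕ} {D : Diagram k l} (h : D.flip.CapAt i) :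
    colMat D * colMat (eDiagram l i) = 2 ^ 1 • colMat D := by
  have h1 := congr_arg Matrix.transpose (colMat_eDiagram_mul h)
  rwa [Matrix.transpose_mul, colMat_flip, colMat_eDiagram h.choose, pairMat_transpose,
    Matrix.transpose_transpose, Matrix.transpose_smul, Matrix.transpose_transpose,
    ← colMat_eDiagram h.choose] at h1

theorem comp_eDiagram {k l i : ℕ} {D : Diagram k l} (h : D.CapAt i) :
    comp a D.mor (eDiagram k i).mor = loopValue a • D.mor := by
  simpa using comp_mor_of_colMat (a := a) (colMat_eDiagram_mul h)

theorem eDiagram_comp {k l i : ℕ} {D : Diagram k l} (h : D.flip.CapAt i) :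
    comp a (eDiagram l i).mor D.mor = loopValue a • D.mor := by
  simpa using comp_mor_of_colMat (a := a) (colMat_mul_eDiagram h)

theorem eDiagram_capAt {n i : ℕ} (hi : i + 1 < n) : (eDiagram n i).CapAt i := by
  refine ⟨hi, ?_, ?_⟩
  · change Sum.elim _ _ _ = Sum.elim _ _ _
    simp
  · rintro (y | y) hy
    · change Sum.elim _ _ _ = Sum.elim _ _ _ at hy
      simp only [Sum.elim_inl, true_or, if_true] at hy
      split_ifs at hy with h
      rcases h with h | h
      · exact Or.inl (by congr 1; exact Fin.ext h)
      · exact Or.inr (by congr 1; exact Fin.ext h)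
    · change Sum.elim _ _ _ = Sum.elim _ _ _ at hy
      simp only [Sum.elim_inl, Sum.elim_inr, true_or, if_true] at hy
      split_ifs at hy with h
      simp at hy

theorem comp_eDiagram_self {n i : ℕ} (hi : i + 1 < n) :
    comp a (eDiagram n i).mor (eDiagram n i).mor = loopValue a • (eDiagram n i).mor :=
  comp_eDiagram (eDiagram_capAt hi)

theorem comp_eDiagram_comm {n i j : ℕ} (hij : i + 1 < j) (hj : j + 1 < n) :
    comp a (eDiagram n i).mor (eDiagram n j).mor =
      comp a (eDiagram n j).mor (eDiagram n i).mor := by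
  have h : colMat (eDiagram n i) * colMat (eDiagram n j) =
      colMat (eDiagram n j) * colMat (eDiagram n i) := by
    rw [colMat_eDiagram (by omega), colMat_eDiagram hj]
    apply pairMat_mul_comm <;> simp only [ne_eq, Fin.mk.injEq] <;> omega
  rw [comp_mor_of_colMat (h.symm.trans (colMat_mul _ _)), comp_mor]

theorem comp_eDiagram_triple {n i j : ℕ} (hi : i + 1 < n) (hj : j + 1 < n)
    (hij : i + 1 = j ∨ j + 1 = i) :
    comp a (comp a (eDiagram n i).mor (eDiagram n j).mor) (eDiagram n i).mor =
      (eDiagram n i).mor := by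
  have h : colMat (eDiagram n i) * colMat (eDiagram n j) * colMat (eDiagram n i) =
      2 ^ 0 • colMat (eDiagram n i) := by
    rw [colMat_eDiagram hi, colMat_eDiagram hj, pow_zero, one_smul]
    rcases hij with rfl | rfl
    · apply pairMat_mul_mul <;> simp only [ne_eq, Fin.mk.injEq] <;> omega
    · rw [pairMat_comm ⟨j + 1, by omega⟩, pairMat_comm ⟨j, by omega⟩]
      apply pairMat_mul_mul <;> simp only [ne_eq, Fin.mk.injEq] <;> omega
  rw [Matrix.mul_assoc, colMat_mul, Matrix.mul_smul, colMat_mul, smul_smul, ← pow_add] at h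
  obtain ⟨h1, h2⟩ := eq_of_smul_colMat h
  rw [comp_mor, map_smul, LinearMap.smul_apply, comp_mor, smul_smul, ← pow_add, h1, h2, pow_zero,
    one_smul]

/-! ### Existence of the Jones-Wenzl idempotents -/

/-- Wenzl's recursion `f_{m+1} = f_m - (Δ_{m-1} / Δ_m) f_m e_m f_m` in an algebra with elements
`e i`, for `i + 1 < n`, that satisfy the Temperley-Lieb relations. The generators are numbered from
`0`, and `f` and `g` are the idempotents on `m + 1` and on `m` strands. -/
theorem exists_wenzl {A : Type*} [Ring A] [Algebra ℂ A] (n : ℕ) (e : ℕ → A) (W : Submodule ℂ A)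
    (hW : ∀ i, i + 1 < n → e i ∈ W) (hmul : ∀ x ∈ W, ∀ y ∈ W, x * y ∈ W) (δ : ℂ)
    (hee : ∀ i, i + 1 < n → e i * e i = δ • e i)
    (hcomm : ∀ i j, i + 1 < j → j + 1 < n → e i * e j = e j * e i)
    (htriple : ∀ i, i + 1 + 1 < n → e (i + 1) * e i * e (i + 1) = e (i + 1))
    (Δ : ℕ → ℂ) (hΔ : ∀ m, Δ m ≠ 0) (hΔ0 : Δ 0 = 1) (hΔ1 : Δ 1 = δ)
    (hΔ2 : ∀ m, Δ (m + 2) = δ * Δ (m + 1) - Δ m) (m : ℕ) (hm : m + 1 ≤ n) :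
    ∃ f g : A, f - 1 ∈ W ∧ f * f = f ∧ f * g = f ∧ g * f = f ∧
      (∀ i, i < m → f * e i = 0 ∧ e i * f = 0) ∧
      (∀ j, m < j → j + 1 < n → f * e j = e j * f) ∧
      (∀ j, m ≤ j → j + 1 < n → g * e j = e j * g) ∧
      (m + 1 < n → e m * f * e m = (Δ (m + 1) / Δ m) • (g * e m)) := by
  induction m with
  | zero =>
    refine ⟨1, 1, by simp, by simp, by simp, by simp, by simp, by simp, by simp, fun h => ?_⟩
    simp [hΔ0, hΔ1, hee 0 h]
  | succ m ih =>
    obtain ⟨f, g, h1, hff, hfg, hgf, hkill, hfe, hge, hefe⟩ := ih (by omega)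
    have hmn : m + 1 < n := by omega
    have hefe := hefe hmn
    set E := e m with hE
    set c := Δ m / Δ (m + 1) with hc
    have hcc : c * (Δ (m + 1) / Δ m) = 1 := by
      rw [hc]; field_simp [hΔ m, hΔ (m + 1)]
    have hgE : g * E = E * g := hge m le_rfl hmn
    have hfE0 : (f - c • (f * E * f)) * E = 0 := by
      have : f * E * f * E = f * (E * f * E) := by noncomm_ring
      rw [sub_mul, smul_mul_assoc, this, hefe, mul_smul_comm, smul_smul, hcc, one_smul, ← mul_assoc,
        hfg, sub_self]
    have hEf0 : E * (f - c • (f * E * f)) = 0 := by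
      have : E * (f * E * f) = (E * f * E) * f := by noncomm_ring
      rw [mul_sub, mul_smul_comm, this, hefe, smul_mul_assoc, smul_smul, hcc, one_smul, hgE,
        mul_assoc, hgf, sub_self]
    have hf'f : (f - c • (f * E * f)) * f = f - c • (f * E * f) := by
      rw [sub_mul, hff, smul_mul_assoc, mul_assoc (f * E), hff]
    have hff' : f * (f - c • (f * E * f)) = f - c • (f * E * f) := by
      rw [mul_sub, hff, mul_smul_comm, ← mul_assoc, ← mul_assoc, hff]
    have hWf : ∀ x ∈ W, f * x ∈ W ∧ x * f ∈ W := by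
      intro x hx
      have h2 : f * x = (f - 1) * x + x := by noncomm_ring
      have h3 : x * f = x * (f - 1) + x := by noncomm_ring
      exact ⟨h2 ▸ W.add_mem (hmul _ h1 _ hx) hx, h3 ▸ W.add_mem (hmul _ hx _ h1) hx⟩
    refine ⟨f - c • (f * E * f), f, ?_, ?_, hf'f, hff', ?_, ?_, hfe, ?_⟩
    · rw [sub_right_comm]
      exact W.sub_mem h1 (W.smul_mem _ (hWf _ (hWf _ (hW m hmn)).1).2)
    · rw [mul_sub, hf'f, mul_smul_comm, ← mul_assoc, ← mul_assoc, hf'f, hfE0, zero_mul, smul_zero,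
        sub_zero]
    · intro i hi
      rcases Nat.lt_succ_iff_lt_or_eq.1 hi with hi | rfl
      · obtain ⟨h2, h3⟩ := hkill i hi
        constructor
        · rw [sub_mul, h2, smul_mul_assoc, mul_assoc, h2, mul_zero, smul_zero, sub_zero]
        · rw [mul_sub, h3, mul_smul_comm, ← mul_assoc, ← mul_assoc, h3, zero_mul, zero_mul,
            smul_zero, sub_zero]
      · exact ⟨hfE0, hEf0⟩
    · intro j hj hjn
      have h2 : f * e j = e j * f := hfe j (by omega) hjn
      have h3 : E * e j = e j * E := hcomm m j hj hjn
      rw [sub_mul, mul_sub, smul_mul_assoc, mul_smul_comm, h2, mul_assoc, h2, ← mul_assoc,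
        mul_assoc f, h3, ← mul_assoc, h2, mul_assoc, mul_assoc, mul_assoc]
    · intro hn
      have h2 : f * e (m + 1) = e (m + 1) * f := hfe (m + 1) (by omega) hn
      have h3 : e (m + 1) * (f * E * f) * e (m + 1) = f * e (m + 1) := by
        calc e (m + 1) * (f * E * f) * e (m + 1) = (e (m + 1) * f) * E * (f * e (m + 1)) := by
              noncomm_ring
          _ = f * (e (m + 1) * E * e (m + 1)) * f := by rw [h2, ← h2]; nth_rw 2 [h2]; noncomm_ring
          _ = f * e (m + 1) := by rw [htriple m hn, mul_assoc, ← h2, ← mul_assoc, hff]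
      have h4 : e (m + 1) * f * e (m + 1) = δ • (f * e (m + 1)) := by
        rw [← h2, mul_assoc, hee (m + 1) hn, mul_smul_comm]
      rw [mul_sub, sub_mul, mul_smul_comm, smul_mul_assoc, h3, h4, ← sub_smul]
      congr 1
      rw [hΔ2, hc]
      field_simp [hΔ m, hΔ (m + 1)]

/-- The algebra of endomorphisms of `n` in the Temperley-Lieb category. -/
def EndAlgebra (_a : ℂ) (n : ℕ) : Type := LinDiagram n n

instance (a : ℂ) (n : ℕ) : AddCommGroup (EndAlgebra a n) :=
  inferInstanceAs (AddCommGroup (LinDiagram n n))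

instance (a : ℂ) (n : ℕ) : Module ℂ (EndAlgebra a n) :=
  inferInstanceAs (Module ℂ (LinDiagram n n))

instance (a : ℂ) (n : ℕ) : Ring (EndAlgebra a n) :=
  { (inferInstance : AddCommGroup (EndAlgebra a n)) with
    mul := fun x y => comp a (k := n) (l := n) (m := n) x y
    one := (Diagram.id n).mor
    left_distrib := fun x y z => map_add (comp a (k := n) (l := n) (m := n) x) y z
    right_distrib := fun x y z => LinearMap.map_add₂ (comp a (k := n) (l := n) (m := n)) x y z
    zero_mul := fun x => LinearMap.map_zero₂ (comp a (k := n) (l := n) (m := n)) x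
    mul_zero := fun x => map_zero (comp a (k := n) (l := n) (m := n) x)
    mul_assoc := fun x y z => comp_assoc (a := a) (k := n) (l := n) (m := n) (n := n) x y z
    one_mul := fun x => id_comp (a := a) (k := n) (l := n) x
    mul_one := fun x => comp_id (a := a) (k := n) (l := n) x }

instance (a : ℂ) (n : ℕ) : Algebra ℂ (EndAlgebra a n) :=
  Algebra.ofModule
    (fun r x y => LinearMap.map_smul₂ (comp a (k := n) (l := n) (m := n)) r x y)
    (fun r x y => map_smul (comp a (k := n) (l := n) (m := n) x) r y)

theorem pow_sub_inv_pow_ne_zero (ha : a ≠ 0) (hgen : ∀ n : ℕ, 0 < n → a ^ n ≠ 1) (m : ℕ) :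
    (a ^ 2) ^ (m + 1) - ((a ^ 2)⁻¹) ^ (m + 1) ≠ 0 := by
  intro h
  refine hgen (4 * (m + 1)) (by omega) ?_
  have h1 : (a ^ 2) ^ (m + 1) ≠ 0 := pow_ne_zero _ (pow_ne_zero _ ha)
  have h2 : (a ^ 2) ^ (m + 1) * (a ^ 2) ^ (m + 1) = 1 := by
    rw [sub_eq_zero, inv_pow] at h
    nth_rw 2 [h]
    exact mul_inv_cancel₀ h1
  rw [← h2]
  ring

theorem loopValue_ne_zero (ha : a ≠ 0) (hgen : ∀ n : ℕ, 0 < n → a ^ n ≠ 1) : loopValue a ≠ 0 := by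
  intro h
  have h2 := pow_sub_inv_pow_ne_zero ha hgen 1
  have h3 : (a ^ 2) ^ (1 + 1) - ((a ^ 2)⁻¹) ^ (1 + 1) =
    -loopValue a * (a ^ 2 - (a ^ 2)⁻¹) := by rw [loopValue]; ring
  exact h2 (by rw [h3, h]; ring)

theorem isJonesWenzl_jonesWenzl (ha : a ≠ 0) (hgen : ∀ n : ℕ, 0 < n → a ^ n ≠ 1) (n : ℕ) :
    IsJonesWenzl a n (jonesWenzl a n) := by
  refine Classical.epsilon_spec (p := IsJonesWenzl a n) ?_
  rcases Nat.eq_zero_or_pos n with rfl | hn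
  · exact ⟨(Diagram.id 0).mor, by simp, fun i hi => by omega⟩
  set q := a ^ 2 with hq
  have hq0 : q ≠ 0 := pow_ne_zero _ ha
  have hd : q - q⁻¹ ≠ 0 := by simpa using pow_sub_inv_pow_ne_zero ha hgen 0
  let W : Submodule ℂ (EndAlgebra a n) := Submodule.span ℂ {x : LinDiagram n n | IsEWord a n x}
  obtain ⟨f, g, h1, -, -, -, h2, -⟩ := exists_wenzl (A := EndAlgebra a n) n
    (fun i => (eDiagram n i).mor) W (fun i hi => Submodule.subset_span (IsEWord.gen i hi))
    (fun x hx y hy => by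
      refine Submodule.span_induction₂ (p := fun x y _ _ => x * y ∈ W) ?_ ?_ ?_ ?_ ?_ ?_ ?_ hx hy
      · exact fun x y hx hy => Submodule.subset_span (IsEWord.mul x y hx hy)
      · exact fun y _ => by simp
      · exact fun x _ => by simp
      · exact fun x y z _ _ _ h1 h2 => by rw [add_mul]; exact W.add_mem h1 h2
      · exact fun x y z _ _ _ h1 h2 => by rw [mul_add]; exact W.add_mem h1 h2
      · exact fun r x y _ _ h => by rw [smul_mul_assoc]; exact W.smul_mem _ h
      · exact fun r x y _ _ h => by rw [mul_smul_comm]; exact W.smul_mem _ h)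
    (loopValue a) (fun i hi => comp_eDiagram_self hi)
    (fun i j hij hj => comp_eDiagram_comm hij hj)
    (fun i hi => comp_eDiagram_triple hi (by omega) (Or.inr rfl))
    (fun m => (-1) ^ m * (q ^ (m + 1) - (q⁻¹) ^ (m + 1)) / (q - q⁻¹))
    (fun m => div_ne_zero (mul_ne_zero (by simp) (pow_sub_inv_pow_ne_zero ha hgen m)) hd)
    (by rw [zero_add, pow_one, pow_one, pow_zero, one_mul, div_self hd])
    (by rw [loopValue, ← hq, div_eq_iff hd]; ring)
    (fun m => by
      rw [loopValue, ← hq, ← mul_div_assoc, ← sub_div]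
      congr 1
      linear_combination (-((-1) ^ m * (q ^ (m + 1) - q⁻¹ ^ (m + 1)))) * mul_inv_cancel₀ hq0)
    (n - 1) (by omega)
  exact ⟨f, h1, fun i hi => h2 i (by omega)⟩

/-! ### Caps and cups in compositions and juxtapositions -/

/-- Two neighbouring outputs of `D` are joined. -/
def Diagram.HasCup {k l : ℕ} (D : Diagram k l) : Prop :=
  ∃ (j : ℕ) (h : j + 1 < l), D.r (Sum.inr ⟨j, by omega⟩) (Sum.inr ⟨j + 1, h⟩)

theorem Diagram.glue_of_bottom {k l m : ℕ} (D₁ : Diagram l m) (D₂ : Diagram k l)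
    {x y : Fin k ⊕ Fin l}
    (h : D₂.r x y) :
    (D₁.glue D₂).r (Sum.map (fun i => i) Sum.inl x) (Sum.map (fun i => i) Sum.inl y) :=
  setoid_map_le_iff.1 (le_sup_left (a := Setoid.map D₂ (Sum.map (fun i => i) Sum.inl))
    (b := Setoid.map D₁ Sum.inr)) h

theorem Diagram.glue_of_top {k l m : ℕ} (D₁ : Diagram l m) (D₂ : Diagram k l) {x y : Fin l ⊕ Fin m}
    (h : D₁.r x y) : (D₁.glue D₂).r (Sum.inr x) (Sum.inr y) :=
  setoid_map_le_iff.1 (le_sup_right (a := Setoid.map D₂ (Sum.map (fun i => i) Sum.inl))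
    (b := Setoid.map D₁ Sum.inr)) h

theorem Diagram.CapAt.stack {k l m i : ℕ} {D₂ : Diagram k l} (h : D₂.CapAt i) (D₁ : Diagram l m) :
    (D₁.stack D₂).CapAt i := by
  obtain ⟨hi, h1, h2⟩ := h
  refine ⟨hi, D₁.glue_of_bottom D₂ h1, ?_⟩
  have key : D₁.glue D₂ ≤ Setoid.ker
      (fun z => z = Sum.inl (⟨i, by omega⟩ : Fin k) ∨ z = Sum.inl ⟨i + 1, hi⟩) := by
    refine sup_le (setoid_map_le_iff.2 fun x y hxy => ?_) (setoid_map_le_iff.2 fun x y _ => ?_)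
    · have h3 : ∀ x y, D₂.r x y → (x = Sum.inl ⟨i, by omega⟩ ∨ x = Sum.inl ⟨i + 1, hi⟩) →
          (y = Sum.inl ⟨i, by omega⟩ ∨ y = Sum.inl ⟨i + 1, hi⟩) := by
        rintro x y hxy (rfl | rfl)
        · exact h2 y hxy
        · exact h2 y (D₂.trans' h1 hxy)
      have h4 := propext (Iff.intro (h3 x y hxy) (h3 y x (D₂.symm' hxy)))
      rcases x with x | x <;> rcases y with y | y <;>
        first | (simp [Setoid.ker_def]; done) | simpa [Setoid.ker_def] using h4
    · simp [Setoid.ker_def]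
  intro y hy
  have h3 := key hy
  rcases y with y | y
  · simpa [Setoid.ker_def, Diagram.outer] using h3
  · simp [Setoid.ker_def, Diagram.outer] at h3

theorem Diagram.CapAt.juxt_left {k l k' l' i : ℕ} {D : Diagram k l} (h : D.CapAt i)
    (D' : Diagram k' l') : (D.juxt D').CapAt i := by
  obtain ⟨hi, h1, h2⟩ := h
  refine ⟨by omega, setoid_map_le_iff.1 (le_sup_left
    (a := Setoid.map D (Sum.map (Fin.castAdd k') (Fin.castAdd l')))
    (b := Setoid.map D' (Sum.map (Fin.natAdd k) (Fin.natAdd l)))) h1, ?_⟩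
  have key : D.juxt D' ≤ Setoid.ker (fun z => z = Sum.inl (⟨i, by omega⟩ : Fin (k + k')) ∨
      z = Sum.inl ⟨i + 1, by omega⟩) := by
    refine sup_le (setoid_map_le_iff.2 fun x y hxy => ?_) (setoid_map_le_iff.2 fun x y _ => ?_)
    · have h3 : ∀ x y, D.r x y → (x = Sum.inl ⟨i, by omega⟩ ∨ x = Sum.inl ⟨i + 1, hi⟩) →
          (y = Sum.inl ⟨i, by omega⟩ ∨ y = Sum.inl ⟨i + 1, hi⟩) := by
        rintro x y hxy (rfl | rfl)
        · exact h2 y hxy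
        · exact h2 y (D.trans' h1 hxy)
      have h4 := propext (Iff.intro (h3 x y hxy) (h3 y x (D.symm' hxy)))
      rcases x with x | x <;> rcases y with y | y <;>
        first
        | (simp [Setoid.ker_def, Fin.ext_iff]; done)
        | simpa [Setoid.ker_def, Fin.ext_iff] using h4
    · have h5 : ∀ x : Fin k', ¬ (k + (x : ℕ) = i ∨ k + (x : ℕ) = i + 1) := fun x => by omega
      rcases x with x | x <;> rcases y with y | y <;>
        simp [Setoid.ker_def, Fin.ext_iff, h5]
  intro y hy
  have h3 := key hy
  rw [Setoid.ker_def, eq_iff_iff] at h3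
  exact h3.1 (Or.inl rfl)

theorem Diagram.CapAt.juxt_right {k l k' l' i : ℕ} {D' : Diagram k' l'} (h : D'.CapAt i)
    (D : Diagram k l) : (D.juxt D').CapAt (k + i) := by
  obtain ⟨hi, h1, h2⟩ := h
  refine ⟨by omega, setoid_map_le_iff.1 (le_sup_right
    (a := Setoid.map D (Sum.map (Fin.castAdd k') (Fin.castAdd l')))
    (b := Setoid.map D' (Sum.map (Fin.natAdd k) (Fin.natAdd l)))) h1, ?_⟩
  have key : D.juxt D' ≤ Setoid.ker (fun z => z = Sum.inl (⟨k + i, by omega⟩ : Fin (k + k')) ∨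
      z = Sum.inl ⟨k + i + 1, by omega⟩) := by
    refine sup_le (setoid_map_le_iff.2 fun x y _ => ?_) (setoid_map_le_iff.2 fun x y hxy => ?_)
    · have h5 : ∀ x : Fin k, ¬ ((x : ℕ) = k + i ∨ (x : ℕ) = k + i + 1) := fun x => by omega
      rcases x with x | x <;> rcases y with y | y <;>
        simp [Setoid.ker_def, Fin.ext_iff, h5]
    · have h3 : ∀ x y, D'.r x y → (x = Sum.inl ⟨i, by omega⟩ ∨ x = Sum.inl ⟨i + 1, hi⟩) →
          (y = Sum.inl ⟨i, by omega⟩ ∨ y = Sum.inl ⟨i + 1, hi⟩) := by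
        rintro x y hxy (rfl | rfl)
        · exact h2 y hxy
        · exact h2 y (D'.trans' h1 hxy)
      have h4 := propext (Iff.intro (h3 x y hxy) (h3 y x (D'.symm' hxy)))
      rcases x with x | x <;> rcases y with y | y <;>
        first
        | (simp [Setoid.ker_def, Fin.ext_iff, add_assoc]; done)
        | simpa [Setoid.ker_def, Fin.ext_iff, add_assoc] using h4
  intro y hy
  have h3 := key hy
  rw [Setoid.ker_def, eq_iff_iff] at h3
  exact h3.1 (Or.inl rfl)

theorem Diagram.HasCup.stack {k l m : ℕ} {D₁ : Diagram l m} (h : D₁.HasCup) (D₂ : Diagram k l) :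
    (D₁.stack D₂).HasCup := by
  obtain ⟨j, hj, h⟩ := h
  exact ⟨j, hj, D₁.glue_of_top D₂ h⟩

theorem IsEWord.exists_diagram {n : ℕ} {x : LinDiagram n n} (hx : IsEWord a n x) :
    ∃ (c : ℂ) (D : Diagram n n), x = c • D.mor ∧ (∃ i, D.CapAt i) ∧ D.HasCup := by
  induction hx with
  | gen i hi =>
    refine ⟨1, _, (one_smul _ _).symm, ⟨i, eDiagram_capAt hi⟩, i, hi, ?_⟩
    change Sum.elim _ _ _ = Sum.elim _ _ _
    simp
  | mul x y _ _ hx hy =>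
    obtain ⟨c, D, rfl, -, h1⟩ := hx
    obtain ⟨c', D', rfl, ⟨i, h2⟩, -⟩ := hy
    exact ⟨c' * (c * loopValue a ^ D.circles D'), D.stack D',
      by simp [comp_mor, smul_smul], ⟨i, h2.stack D⟩, h1.stack D'⟩

theorem jonesWenzl_sub_id_mem_cap (ha : a ≠ 0) (hgen : ∀ n : ℕ, 0 < n → a ^ n ≠ 1) (n : ℕ) :
    jonesWenzl a n - (Diagram.id n).mor ∈
      Submodule.span ℂ {x | ∃ D : Diagram n n, (∃ i, D.CapAt i) ∧ x = D.mor} := by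
  refine Submodule.span_le.2 (fun x hx => ?_) (isJonesWenzl_jonesWenzl ha hgen n).1
  obtain ⟨c, D, rfl, h, -⟩ := IsEWord.exists_diagram hx
  exact Submodule.smul_mem _ _ (Submodule.subset_span ⟨D, h, rfl⟩)

theorem jonesWenzl_sub_id_mem_cup (ha : a ≠ 0) (hgen : ∀ n : ℕ, 0 < n → a ^ n ≠ 1) (n : ℕ) :
    jonesWenzl a n - (Diagram.id n).mor ∈
      Submodule.span ℂ {x | ∃ D : Diagram n n, D.HasCup ∧ x = D.mor} := by
  refine Submodule.span_le.2 (fun x hx => ?_) (isJonesWenzl_jonesWenzl ha hgen n).1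
  obtain ⟨c, D, rfl, -, h⟩ := IsEWord.exists_diagram hx
  exact Submodule.smul_mem _ _ (Submodule.subset_span ⟨D, h, rfl⟩)

/-! ### Blocks of strands -/

/-- The strands `i` and `i + 1` (counting from `0`) belong to the same block of the sequence `s`. -/
def InBlock : {m : ℕ} → (Fin m → ℕ) → ℕ → Prop
  | 0, _, _ => False
  | _ + 1, s, i => InBlock (trunc s) i ∨ (size (trunc s) ≤ i ∧ i + 1 < size s)

theorem size_succ {m : ℕ} (s : Fin (m + 1) → ℕ) : size s = size (trunc s) + s (Fin.last m) := rfl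

theorem InBlock.lt_size : ∀ {m : ℕ} {s : Fin m → ℕ} {i : ℕ}, InBlock s i → i + 1 < size s
  | 0, _, _, h => h.elim
  | _ + 1, s, _, h => h.elim (fun h => by have := h.lt_size; rw [size_succ]; omega) fun h => h.2

theorem juxt_id_id (k n : ℕ) : (Diagram.id k).juxt (Diagram.id n) = Diagram.id (k + n) := by
  refine Diagram.ext_colors fun w v => ?_
  obtain ⟨⟨w, w'⟩, rfl⟩ := (Fin.appendEquiv k n).surjective w
  obtain ⟨⟨v, v'⟩, rfl⟩ := (Fin.appendEquiv k n).surjective v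
  rw [id_colors, EmbeddingLike.apply_eq_iff_eq, Prod.mk.injEq]
  simp only [Fin.appendEquiv, Equiv.coe_fn_mk]
  rw [juxt_colors, id_colors, id_colors]

theorem juxt_eDiagram_id {k n i : ℕ} (hi : i + 1 < k) :
    (eDiagram k i).juxt (Diagram.id n) = eDiagram (k + n) i := by
  refine Diagram.ext_colors fun w v => ?_
  obtain ⟨⟨w, w'⟩, rfl⟩ := (Fin.appendEquiv k n).surjective w
  obtain ⟨⟨v, v'⟩, rfl⟩ := (Fin.appendEquiv k n).surjective v
  simp only [Fin.appendEquiv, Equiv.coe_fn_mk]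
  rw [juxt_colors, id_colors, eDiagram_colors hi, eDiagram_colors (by omega)]
  have h : ∀ (j : ℕ) (hj : j < k), (⟨j, by omega⟩ : Fin (k + n)) = Fin.castAdd n ⟨j, hj⟩ :=
    fun j hj => rfl
  simp only [PairColors, h i (by omega), h (i + 1) hi, Fin.append_left, Fin.forall_fin_add,
    Fin.append_right, ne_eq, Fin.ext_iff, Fin.val_castAdd, Fin.val_natAdd, funext_iff]
  constructor
  · rintro ⟨⟨h1, h2, h3⟩, h4⟩
    exact ⟨h1, h2, h3, fun r _ _ => h4 r⟩
  · rintro ⟨h1, h2, h3, h4⟩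
    exact ⟨⟨h1, h2, h3⟩, fun r => h4 r (by omega) (by omega)⟩

theorem juxt_id_eDiagram {k n i : ℕ} (hi : i + 1 < n) :
    (Diagram.id k).juxt (eDiagram n i) = eDiagram (k + n) (k + i) := by
  refine Diagram.ext_colors fun w v => ?_
  obtain ⟨⟨w, w'⟩, rfl⟩ := (Fin.appendEquiv k n).surjective w
  obtain ⟨⟨v, v'⟩, rfl⟩ := (Fin.appendEquiv k n).surjective v
  simp only [Fin.appendEquiv, Equiv.coe_fn_mk]
  rw [juxt_colors, id_colors, eDiagram_colors hi, eDiagram_colors (by omega)]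
  have h : ∀ (j : ℕ) (hj : j < n), (⟨k + j, by omega⟩ : Fin (k + n)) = Fin.natAdd k ⟨j, hj⟩ :=
    fun j hj => rfl
  simp only [PairColors, add_assoc, h i (by omega), h (i + 1) hi, Fin.append_left,
    Fin.forall_fin_add, Fin.append_right, ne_eq, Fin.ext_iff, Fin.val_castAdd, Fin.val_natAdd,
    funext_iff, Nat.add_left_cancel_iff]
  constructor
  · rintro ⟨h4, ⟨h1, h2, h3⟩⟩
    exact ⟨h1, h2, fun r _ _ => h4 r, h3⟩
  · rintro ⟨h1, h2, h4, h3⟩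
    exact ⟨fun r => h4 r (by omega) (by omega), ⟨h1, h2, h3⟩⟩

theorem tensor_mem_span_left {k l k' l' : ℕ} {p : Diagram k l → Prop}
    {r : Diagram (k + k') (l + l') → Prop} (h : ∀ D (D' : Diagram k' l'), p D → r (D.juxt D'))
    {x : LinDiagram k l}
    (hx : x ∈ Submodule.span ℂ {x | ∃ D, p D ∧ x = D.mor}) (y : LinDiagram k' l') :
    tensor x y ∈ Submodule.span ℂ {x | ∃ D, r D ∧ x = D.mor} := by
  induction y using linDiagram_induction with
  | h0 => simp
  | hadd y z hy hz => rw [map_add]; exact Submodule.add_mem _ hy hz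
  | hs c y hy => rw [map_smul]; exact Submodule.smul_mem _ _ hy
  | hm D' =>
    suffices Submodule.span ℂ {x | ∃ D, p D ∧ x = D.mor} ≤
      (Submodule.span ℂ {x | ∃ D, r D ∧ x = D.mor}).comap (tensor.flip D'.mor) from this hx
    rw [Submodule.span_le]
    rintro _ ⟨D, hD, rfl⟩
    exact Submodule.subset_span ⟨_, h D D' hD, tensor_mor D D'⟩

theorem tensor_mem_span_right {k l k' l' : ℕ} {p : Diagram k' l' → Prop}
    {r : Diagram (k + k') (l + l') → Prop} (h : ∀ (D : Diagram k l) D', p D' → r (D.juxt D'))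
    {y : LinDiagram k' l'}
    (hy : y ∈ Submodule.span ℂ {x | ∃ D, p D ∧ x = D.mor}) (x : LinDiagram k l) :
    tensor x y ∈ Submodule.span ℂ {x | ∃ D, r D ∧ x = D.mor} := by
  induction x using linDiagram_induction with
  | h0 => simp
  | hadd y z hy hz => rw [map_add]; exact Submodule.add_mem _ hy hz
  | hs c y hy => rw [map_smul]; exact Submodule.smul_mem _ _ hy
  | hm D =>
    suffices Submodule.span ℂ {x | ∃ D, p D ∧ x = D.mor} ≤
      (Submodule.span ℂ {x | ∃ D, r D ∧ x = D.mor}).comap (tensor D.mor) from this hy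
    rw [Submodule.span_le]
    rintro _ ⟨D', hD, rfl⟩
    exact Submodule.subset_span ⟨_, h D D' hD, tensor_mor D D'⟩

/-- The difference `f_s - 1` is a combination of diagrams with a cap inside a block. -/
theorem jwSeq_sub_id_mem (ha : a ≠ 0) (hgen : ∀ n : ℕ, 0 < n → a ^ n ≠ 1) :
    ∀ {m : ℕ} (s : Fin m → ℕ), jwSeq a s - (Diagram.id (size s)).mor ∈
      Submodule.span ℂ {x | ∃ D : Diagram (size s) (size s), (∃ i, InBlock s i ∧ D.CapAt i) ∧
        x = D.mor}
  | 0, s => by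
    rw [show jwSeq a s - (Diagram.id (size s)).mor = 0 from sub_self _]
    exact Submodule.zero_mem _
  | m + 1, s => by
    have h : jwSeq a s - (Diagram.id (size s)).mor =
        tensor (jwSeq a (trunc s) - (Diagram.id (size (trunc s))).mor)
          (jonesWenzl a (s (Fin.last m))) +
        tensor (Diagram.id (size (trunc s))).mor
          (jonesWenzl a (s (Fin.last m)) - (Diagram.id (s (Fin.last m))).mor) := by
      rw [map_sub, map_sub, LinearMap.sub_apply, tensor_mor, juxt_id_id, sub_add_sub_cancel]
      rfl
    rw [h]
    refine Submodule.add_mem _ (tensor_mem_span_left ?_ (jwSeq_sub_id_mem ha hgen (trunc s)) _)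
      (tensor_mem_span_right ?_ (jonesWenzl_sub_id_mem_cap ha hgen _) _)
    · rintro D D' ⟨i, hi, hD⟩
      exact ⟨i, Or.inl hi, hD.juxt_left D'⟩
    · rintro D D' ⟨i, hD⟩
      refine ⟨size (trunc s) + i, Or.inr ⟨by omega, ?_⟩, hD.juxt_right D⟩
      have := hD.choose
      rw [size_succ]
      omega

theorem eDiagram_comp_jwSeq (ha : a ≠ 0) (hgen : ∀ n : ℕ, 0 < n → a ^ n ≠ 1) :
    ∀ {m : ℕ} {s : Fin m → ℕ} {i : ℕ}, InBlock s i →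
      comp a (eDiagram (size s) i).mor (jwSeq a s) = 0
  | 0, _, _, h => h.elim
  | m + 1, s, i, h => by
    change comp a (eDiagram (size (trunc s) + s (Fin.last m)) i).mor
      (tensor (jwSeq a (trunc s)) (jonesWenzl a (s (Fin.last m)))) = 0
    rcases h with h | ⟨h1, h2⟩
    · rw [← juxt_eDiagram_id h.lt_size, ← tensor_mor, comp_tensor, eDiagram_comp_jwSeq ha hgen h,
        map_zero, LinearMap.zero_apply]
    · obtain ⟨i, rfl⟩ := Nat.exists_eq_add_of_le h1
      rw [size_succ] at h2
      rw [← juxt_id_eDiagram (by omega), ← tensor_mor, comp_tensor,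
        ((isJonesWenzl_jonesWenzl ha hgen _).2 i (by omega)).2, map_zero]

/-! ### Good diagrams -/

/-- `D` joins no neighbouring inputs in the same block of `s`, and no neighbouring outputs. -/
def Diagram.IsClean {m : ℕ} (s : Fin m → ℕ) {k : ℕ} (D : Diagram (size s) k) : Prop :=
  (∀ (i : ℕ) (hi : InBlock s i),
    ¬ D.r (Sum.inl ⟨i, by have := hi.lt_size; omega⟩) (Sum.inl ⟨i + 1, hi.lt_size⟩)) ∧
  ¬ D.HasCup

theorem Diagram.IsSimple.eq_or_eq {k l : ℕ} {D : Diagram k l} (hD : D.IsSimple)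
    {x y z : Fin k ⊕ Fin l} (hxy : D.r x y) (hne : y ≠ x) (hxz : D.r x z) : z = x ∨ z = y := by
  by_contra! h
  exact h.2 ((hD.1 x).unique ⟨h.1, hxz⟩ ⟨hne, hxy⟩)

theorem hat_eq_zero_of_not_isClean (ha : a ≠ 0) (hgen : ∀ n : ℕ, 0 < n → a ^ n ≠ 1) {m : ℕ}
    {s : Fin m → ℕ} {k : ℕ} {D : Diagram (size s) k} (hD : D.IsSimple) (h : ¬ D.IsClean s) :
    hat a s k D.mor = 0 := by
  have h0 := loopValue_ne_zero ha hgen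
  change comp a (jonesWenzl a k) (comp a D.mor (jwSeq a s)) = 0
  rw [Diagram.IsClean, not_and_or] at h
  push Not at h
  rcases h with ⟨i, hi, h⟩ | ⟨j, hj, h⟩
  · have hc : D.CapAt i := ⟨hi.lt_size, h, fun y hy => hD.eq_or_eq h (by simp) hy⟩
    have h1 : comp a D.mor (jwSeq a s) = 0 := by
      have h2 := congr_arg (fun x => comp a x (jwSeq a s)) (comp_eDiagram (a := a) hc)
      simp only [comp_assoc, eDiagram_comp_jwSeq ha hgen hi, map_zero, map_smul,
        LinearMap.smul_apply] at h2
      exact (smul_eq_zero.1 h2.symm).resolve_left h0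
    rw [h1, map_zero]
  · have hc : D.flip.CapAt j := by
      refine ⟨hj, h, fun y hy => ?_⟩
      have := hD.eq_or_eq h (by simp) (z := y.swap) hy
      rcases y with y | y
      · simpa using this
      · simpa using this
    rw [← comp_assoc]
    have h1 : comp a (jonesWenzl a k) D.mor = 0 := by
      have h2 := congr_arg (comp a (jonesWenzl a k)) (eDiagram_comp (a := a) hc)
      rw [← comp_assoc, ((isJonesWenzl_jonesWenzl ha hgen k).2 j hj).1, map_smul, map_zero,
        LinearMap.zero_apply] at h2
      exact (smul_eq_zero.1 h2.symm).resolve_left h0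
    rw [h1, map_zero, LinearMap.zero_apply]

theorem comp_apply_eq_zero_of_mem_span {k l m : ℕ} {p : Diagram l m → Prop} {E : Diagram k m}
    (h : ∀ D (D' : Diagram k l), p D → D.stack D' ≠ E) {x : LinDiagram l m}
    (hx : x ∈ Submodule.span ℂ {x | ∃ D, p D ∧ x = D.mor}) (y : LinDiagram k l) :
    comp a x y E = 0 := by
  induction y using linDiagram_induction with
  | h0 => simp
  | hadd y z hy hz => simp [hy, hz]
  | hs c y hy => simp [hy]
  | hm D' =>
    suffices Submodule.span ℂ {x | ∃ D, p D ∧ x = D.mor} ≤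
      LinearMap.ker (Finsupp.lapply E ∘ₗ (comp a).flip D'.mor) from this hx
    rw [Submodule.span_le]
    rintro _ ⟨D, hD, rfl⟩
    change comp a D.mor D'.mor E = 0
    rw [comp_mor, Finsupp.smul_apply, Diagram.mor, Finsupp.single_eq_of_ne (h D D' hD).symm,
      smul_zero]

theorem comp_apply_eq_zero_of_mem_span' {k l m : ℕ} {p : Diagram k l → Prop} {E : Diagram k m}
    (h : ∀ (D : Diagram l m) D', p D' → D.stack D' ≠ E) {y : LinDiagram k l}
    (hy : y ∈ Submodule.span ℂ {x | ∃ D, p D ∧ x = D.mor}) (x : LinDiagram l m) :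
    comp a x y E = 0 := by
  induction x using linDiagram_induction with
  | h0 => simp
  | hadd y z hy hz => simp [hy, hz]
  | hs c y hy => simp [hy]
  | hm D =>
    suffices Submodule.span ℂ {x | ∃ D, p D ∧ x = D.mor} ≤
      LinearMap.ker (Finsupp.lapply E ∘ₗ comp a D.mor) from this hy
    rw [Submodule.span_le]
    rintro _ ⟨D', hD, rfl⟩
    change comp a D.mor D'.mor E = 0
    rw [comp_mor, Finsupp.smul_apply, Diagram.mor, Finsupp.single_eq_of_ne (h D D' hD).symm,
      smul_zero]

/-- Triangularity: passing from `g` to `ĝ` adds only diagrams that are not clean. -/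
theorem hat_apply_of_isClean (ha : a ≠ 0) (hgen : ∀ n : ℕ, 0 < n → a ^ n ≠ 1) {m : ℕ}
    {s : Fin m → ℕ} {k : ℕ} {D : Diagram (size s) k} (h : D.IsClean s)
    (g : LinDiagram (size s) k) : hat a s k g D = g D := by
  change comp a (jonesWenzl a k) (comp a g (jwSeq a s)) D = g D
  have h1 := comp_apply_eq_zero_of_mem_span (a := a) (E := D)
    (fun D₁ D₂ h1 h2 => h.2 (h2 ▸ h1.stack D₂)) (jonesWenzl_sub_id_mem_cup ha hgen k)
    (comp a g (jwSeq a s))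
  have h2 := comp_apply_eq_zero_of_mem_span' (a := a) (E := D)
    (fun D₁ D₂ ⟨i, hi, h1⟩ h2 => h.1 i hi (by
      obtain ⟨h3, h4, -⟩ := h1.stack D₁
      rwa [h2] at h4)) (jwSeq_sub_id_mem ha hgen s) g
  rw [map_sub, LinearMap.sub_apply, id_comp, Finsupp.sub_apply, sub_eq_zero] at h1
  rw [map_sub, comp_id, Finsupp.sub_apply, sub_eq_zero] at h2
  rw [h1, h2]

theorem isGoodType_iff (ha : a ≠ 0) (hgen : ∀ n : ℕ, 0 < n → a ^ n ≠ 1) {m : ℕ}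
    {s : Fin m → ℕ} {k : ℕ} {D : Diagram (size s) k} :
    IsGoodType a s k D ↔ D.IsSimple ∧ D.IsClean s := by
  refine ⟨fun h => ⟨h.1, ?_⟩, fun h => ⟨h.1, fun h0 => ?_⟩⟩
  · by_contra hc
    exact h.2 (hat_eq_zero_of_not_isClean ha hgen h.1 hc)
  · have := hat_apply_of_isClean ha hgen h.2 D.mor
    rw [h0, Diagram.mor, Finsupp.single_eq_same] at this
    exact zero_ne_one this

theorem linearIndependent_hat_good (ha : a ≠ 0) (hgen : ∀ n : ℕ, 0 < n → a ^ n ≠ 1) {m : ℕ}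
    (s : Fin m → ℕ) (k : ℕ) :
    LinearIndependent ℂ fun D : {D // IsGoodType a s k D} => hat a s k D.1.mor := by
  classical
  rw [linearIndependent_iff']
  intro t g hg D hD
  have h1 := congr_arg (fun x : LinDiagram (size s) k => x D.1) hg
  simp only [Finsupp.coe_finsetSum, Finset.sum_apply, Finsupp.smul_apply,
    hat_apply_of_isClean ha hgen ((isGoodType_iff ha hgen).1 D.2).2, Diagram.mor,
    Finsupp.single_apply, Finsupp.coe_zero, Pi.zero_apply, smul_eq_mul, mul_ite, mul_one, mul_zero,
    ← Subtype.ext_iff, Finset.sum_ite_eq', hD, if_true] at h1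
  exact h1

theorem span_hat_good {m : ℕ}
    (s : Fin m → ℕ) (k : ℕ) :
    Submodule.span ℂ (Set.range fun D : {D // IsGoodType a s k D} => hat a s k D.1.mor) =
      HomV a s k := by
  rw [HomV, E, Submodule.map_span]
  refine le_antisymm (Submodule.span_mono ?_) (Submodule.span_le.2 ?_)
  · rintro _ ⟨D, rfl⟩
    exact ⟨_, ⟨D.1, D.2.1, rfl⟩, rfl⟩
  · rintro _ ⟨_, ⟨D, hD, rfl⟩, rfl⟩
    by_cases h : hat a s k D.mor = 0
    · rw [h]
      exact Submodule.zero_mem _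
    · exact Submodule.subset_span ⟨⟨D, hD, h⟩, rfl⟩

/-! ### Simple diagrams in terms of positions on the boundary -/

theorem boundaryPos_inl {k l : ℕ} (i : Fin k) : boundaryPos (Sum.inl i : Fin k ⊕ Fin l) = i := rfl

theorem boundaryPos_inr {k l : ℕ} (j : Fin l) :
    boundaryPos (Sum.inr j : Fin k ⊕ Fin l) = k + (l - 1 - j) := by
  change k + (Fin.rev j : ℕ) = _
  rw [Fin.val_rev]
  omega

theorem boundaryPos_lt {k l : ℕ} (x : Fin k ⊕ Fin l) : boundaryPos x < k + l := by
  rcases x with i | j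
  · rw [boundaryPos_inl]; omega
  · rw [boundaryPos_inr]; omega

theorem boundaryPos_injective {k l : ℕ} :
    Function.Injective (boundaryPos : Fin k ⊕ Fin l → ℕ) := by
  rintro (i | i) (j | j) h <;> simp only [boundaryPos_inl, boundaryPos_inr] at h
  · rw [Fin.ext h]
  · omega
  · omega
  · congr 1; ext; omega

theorem exists_boundaryPos_eq {k l p : ℕ} (hp : p < k + l) :
    ∃ x : Fin k ⊕ Fin l, boundaryPos x = p := by
  by_cases h : p < k
  · exact ⟨Sum.inl ⟨p, h⟩, rfl⟩
  · exact ⟨Sum.inr ⟨k + l - 1 - p, by omega⟩, by rw [boundaryPos_inr]; simp only; omega⟩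

/-- The points at the positions `p` and `q` of the boundary are connected in `D`. -/
def Diagram.Joins {k l : ℕ} (D : Diagram k l) (p q : ℕ) : Prop :=
  ∃ x y, boundaryPos x = p ∧ boundaryPos y = q ∧ D.r x y

namespace Diagram.Joins

variable {k l : ℕ} {D : Diagram k l} {p q t : ℕ}

theorem iff_r {x y : Fin k ⊕ Fin l} : D.Joins (boundaryPos x) (boundaryPos y) ↔ D.r x y := by
  refine ⟨?_, fun h => ⟨x, y, rfl, rfl, h⟩⟩
  rintro ⟨x', y', hx, hy, h⟩
  rwa [← boundaryPos_injective hx, ← boundaryPos_injective hy]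

theorem lt_left (h : D.Joins p q) : p < k + l := by
  obtain ⟨x, y, rfl, rfl, -⟩ := h
  exact boundaryPos_lt x

theorem lt_right (h : D.Joins p q) : q < k + l := by
  obtain ⟨x, y, rfl, rfl, -⟩ := h
  exact boundaryPos_lt y

theorem refl (hp : p < k + l) : D.Joins p p := by
  obtain ⟨x, rfl⟩ := exists_boundaryPos_eq hp
  exact iff_r.2 (D.refl' x)

theorem symm (h : D.Joins p q) : D.Joins q p := by
  obtain ⟨x, y, rfl, rfl, h⟩ := h
  exact iff_r.2 (D.symm' h)

theorem trans (h : D.Joins p q) (h' : D.Joins q t) : D.Joins p t := by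
  obtain ⟨x, y, rfl, rfl, h⟩ := h
  obtain ⟨y', z, hy, rfl, h'⟩ := h'
  rw [boundaryPos_injective hy] at h'
  exact iff_r.2 (D.trans' h h')

end Diagram.Joins

theorem Diagram.ext_joins {k l : ℕ} {D D' : Diagram k l} (h : ∀ p q, D.Joins p q ↔ D'.Joins p q) :
    D = D' := by
  ext x y
  exact Diagram.Joins.iff_r.symm.trans ((h _ _).trans Diagram.Joins.iff_r)

/-- A diagram is simple if and only if its boundary positions form a crossingless matching. -/
theorem Diagram.isSimple_iff {k l : ℕ} {D : Diagram k l} :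
    D.IsSimple ↔ (∀ p < k + l, ∃ q, q ≠ p ∧ D.Joins p q) ∧
      (∀ p q t, D.Joins p q → D.Joins p t → q ≠ p → t ≠ p → q = t) ∧
      ∀ p q t u, p < q → q < t → t < u → D.Joins p t → D.Joins q u → False := by
  constructor
  · rintro ⟨h1, h2⟩
    refine ⟨fun p hp => ?_, ?_, ?_⟩
    · obtain ⟨x, rfl⟩ := exists_boundaryPos_eq hp
      obtain ⟨y, ⟨hne, hy⟩, -⟩ := h1 x
      exact ⟨boundaryPos y, fun h => hne (boundaryPos_injective h), Joins.iff_r.2 hy⟩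
    · rintro p q t ⟨x, y, rfl, rfl, hxy⟩ ⟨x', z, hx, rfl, hxz⟩ hne hne'
      obtain rfl := boundaryPos_injective hx
      exact congr_arg _ ((h1 x').unique ⟨fun h => hne (by rw [h]), hxy⟩
        ⟨fun h => hne' (by rw [h]), hxz⟩)
    · rintro p q t u hpq hqt htu ⟨x, z, rfl, rfl, hxz⟩ ⟨y, v, rfl, rfl, hyv⟩
      exact h2 x y z v hpq hqt htu ⟨hxz, hyv⟩
  · rintro ⟨h1, h2, h3⟩
    refine ⟨fun x => ?_, fun x y z t hxy hyz hzt h =>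
      h3 _ _ _ _ hxy hyz hzt (Joins.iff_r.2 h.1) (Joins.iff_r.2 h.2)⟩
    obtain ⟨q, hne, hq⟩ := h1 _ (boundaryPos_lt x)
    obtain ⟨y, rfl⟩ := exists_boundaryPos_eq hq.lt_right
    refine ⟨y, ⟨fun h => hne (by rw [h]), Joins.iff_r.1 hq⟩, fun z hz => boundaryPos_injective
      (h2 _ _ _ (Joins.iff_r.2 hz.2) hq (fun h => hz.1 (boundaryPos_injective h)) hne)⟩

/-- In a simple diagram without arcs between neighbouring points of an interval, no arc has both
ends in this interval. -/
theorem Diagram.IsSimple.not_joins {k l : ℕ} {D : Diagram k l} (hD : D.IsSimple) {A B : ℕ}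
    (h : ∀ p, A ≤ p → p + 1 < B → ¬ D.Joins p (p + 1)) :
    ∀ p q, A ≤ p → p < q → q < B → ¬ D.Joins p q := by
  obtain ⟨h1, h2, h3⟩ := Diagram.isSimple_iff.1 hD
  have key : ∀ d p q, A ≤ p → p < q → q < B → q - p = d → ¬ D.Joins p q := by
    intro d
    induction d using Nat.strong_induction_on with
    | _ d ih =>
    intro p q hA hpq hB hd hj
    by_cases hq : q = p + 1
    · subst hq
      exact h p hA hB hj
    obtain ⟨t, hne, ht⟩ := h1 (p + 1) (by have := hj.lt_right; omega)
    -- the partner of `p + 1` lies strictly between `p` and `q`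
    have htp : t ≠ p := by
      rintro rfl
      exact hq (h2 _ _ _ hj ht.symm (by omega) (by omega))
    have htq : t ≠ q := by
      rintro rfl
      have := h2 _ _ _ hj.symm ht.symm (by omega) (by omega)
      omega
    have h4 : ¬ t < p := fun hlt => h3 t p (p + 1) q hlt (by omega) (by omega) ht.symm hj
    have h5 : ¬ q < t := fun hlt => h3 p (p + 1) q t (by omega) (by omega) hlt hj ht
    exact ih (t - (p + 1)) (by omega) (p + 1) t (by omega) (by omega) (by omega) rfl ht
  exact fun p q h4 h5 h6 => key _ p q h4 h5 h6 rfl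

/-- If no arc of a simple diagram has both ends in `[A, C)` or both ends in `[C, B)`, then the arcs
between these two intervals are nested around `C`. -/
theorem Diagram.IsSimple.joins_nested {k l : ℕ} {D : Diagram k l} (hD : D.IsSimple) {A B C : ℕ}
    (hAC : ∀ p q, A ≤ p → p < q → q < C → ¬ D.Joins p q)
    (hCB : ∀ p q, C ≤ p → p < q → q < B → ¬ D.Joins p q) {p q : ℕ} (hA : A ≤ p) (hp : p < C)
    (hq : C ≤ q) (hB : q < B) (hj : D.Joins p q) :
    q = 2 * C - 1 - p ∧ ∀ i, p ≤ i → i < C → D.Joins i (2 * C - 1 - i) := by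
  obtain ⟨h1, h2, h3⟩ := Diagram.isSimple_iff.1 hD
  -- arcs starting strictly below an arc between the two intervals stay below it
  have below : ∀ p q i, A ≤ p → p < C → C ≤ q → q < B → D.Joins p q → p < i → i < q →
      ∃ t, p < t ∧ t < q ∧ t ≠ i ∧ D.Joins i t := by
    intro p q i hA hp hq hB hj hpi hiq
    obtain ⟨t, hne, ht⟩ := h1 i (by have := hj.lt_right; omega)
    have htp : t ≠ p := by
      rintro rfl
      have := h2 _ _ _ hj ht.symm (by omega) (by omega)
      omega
    have htq : t ≠ q := by
      rintro rfl
      have := h2 _ _ _ hj.symm ht.symm (by omega) (by omega)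
      omega
    have h4 : ¬ t < p := fun hlt => h3 t p i q hlt hpi hiq ht.symm hj
    have h5 : ¬ q < t := fun hlt => h3 p i q t hpi hiq hlt hj ht
    exact ⟨t, by omega, by omega, hne, ht⟩
  have right : ∀ p q i, A ≤ p → p < C → C ≤ q → q < B → D.Joins p q → p < i → i < C →
      ∃ t, C ≤ t ∧ t < q ∧ D.Joins i t := by
    intro p q i hA hp hq hB hj hpi hiC
    obtain ⟨t, ht1, ht2, hne, ht⟩ := below p q i hA hp hq hB hj hpi (by omega)
    refine ⟨t, ?_, ht2, ht⟩
    by_contra hlt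
    rcases lt_or_gt_of_ne hne with h | h
    · exact hAC t i (by omega) h hiC ht.symm
    · exact hAC i t (by omega) h (by omega) ht
  have left : ∀ p q j, A ≤ p → p < C → C ≤ q → q < B → D.Joins p q → C ≤ j → j < q →
      ∃ t, p < t ∧ t < C ∧ D.Joins t j := by
    intro p q i hA hp hq hB hj hpi hiC
    obtain ⟨t, ht1, ht2, hne, ht⟩ := below p q i hA hp hq hB hj (by omega) hiC
    refine ⟨t, ht1, ?_, ht.symm⟩
    by_contra hlt
    rcases lt_or_gt_of_ne hne with h | h
    · exact hCB t i (by omega) h (by omega) ht.symm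
    · exact hCB i t (by omega) h (by omega) ht
  have key : ∀ d p q, C - p = d → A ≤ p → p < C → C ≤ q → q < B → D.Joins p q →
      q = 2 * C - 1 - p := by
    intro d
    induction d using Nat.strong_induction_on with
    | _ d ih =>
    intro p q hd hA hp hq hB hj
    rcases lt_trichotomy q (2 * C - 1 - p) with h | h | h
    · exfalso
      obtain ⟨t, ht1, ht2, ht⟩ := right p q (2 * C - 1 - q) hA hp hq hB hj (by omega) (by omega)
      have := ih (C - (2 * C - 1 - q)) (by omega) _ t rfl (by omega) (by omega) ht1 (by omega) ht
      omega
    · exact h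
    · exfalso
      obtain ⟨t, ht1, ht2, ht⟩ := left p q (2 * C - 1 - p) hA hp hq hB hj (by omega) (by omega)
      have := ih (C - t) (by omega) t _ rfl (by omega) ht2 (by omega) (by omega) ht
      omega
  refine ⟨key _ p q rfl hA hp hq hB hj, fun i hpi hiC => ?_⟩
  rcases Nat.eq_or_lt_of_le hpi with rfl | hpi
  · rwa [← key _ p q rfl hA hp hq hB hj]
  · obtain ⟨t, ht1, ht2, ht⟩ := right p q i hA hp hq hB hj hpi hiC
    rwa [← key _ i t rfl (by omega) hiC ht1 (by omega) ht]

/-! ### Inserting nested arcs -/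

/-- The relation on positions that arises from `R` when `r` nested arcs are inserted at the position
`S`. The new arcs occupy the positions from `S` to `S + 2 r - 1`. -/
def NestRel (R : ℕ → ℕ → Prop) (S r p q : ℕ) : Prop :=
  (S ≤ p ∧ p < S + 2 * r ∧ S ≤ q ∧ q < S + 2 * r ∧ (p = q ∨ p + q + 1 = 2 * (S + r))) ∨
  ((p < S ∨ S + 2 * r ≤ p) ∧ (q < S ∨ S + 2 * r ≤ q) ∧
    R (if p < S then p else p - 2 * r) (if q < S then q else q - 2 * r))

/-- The diagram that arises from `D` when `r` nested arcs are inserted at the position `S` of the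
boundary, and the boundary is divided anew into inputs and outputs. -/
@[reducible] def Diagram.nest {N b : ℕ} (D : Diagram N b) (S r : ℕ) {k l : ℕ}
    (hS : S ≤ N + b) (h : k + l = N + b + 2 * r) : Diagram k l where
  r x y := NestRel D.Joins S r (boundaryPos x) (boundaryPos y)
  iseqv := by
    refine ⟨fun x => ?_, fun {x y} hxy => ?_, fun {x y z} hxy hyz => ?_⟩
    · have := boundaryPos_lt x
      by_cases h1 : S ≤ boundaryPos x ∧ boundaryPos x < S + 2 * r
      · exact Or.inl ⟨h1.1, h1.2, h1.1, h1.2, Or.inl rfl⟩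
      · exact Or.inr ⟨by omega, by omega, Joins.refl (by split_ifs <;> omega)⟩
    · rcases hxy with h1 | ⟨h1, h2, h3⟩
      · exact Or.inl (by omega)
      · exact Or.inr ⟨h2, h1, h3.symm⟩
    · rcases hxy with h1 | ⟨h1, h2, h3⟩ <;> rcases hyz with h4 | ⟨h4, h5, h6⟩
      · exact Or.inl (by omega)
      · omega
      · omega
      · exact Or.inr ⟨h1, h5, h3.trans h6⟩

/-- The diagram that arises from `D` when the positions from `S` to `S + 2 r - 1` are forgotten, and
the boundary is divided anew into inputs and outputs. -/
@[reducible] def Diagram.unnest {k l : ℕ} (D : Diagram k l) (S r : ℕ) {N b : ℕ}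
    (h : k + l = N + b + 2 * r) : Diagram N b where
  r x y := D.Joins (if boundaryPos x < S then boundaryPos x else boundaryPos x + 2 * r)
    (if boundaryPos y < S then boundaryPos y else boundaryPos y + 2 * r)
  iseqv := by
    refine ⟨fun x => Joins.refl ?_, Joins.symm, Joins.trans⟩
    have := boundaryPos_lt x
    split_ifs <;> omega

theorem Diagram.nest_joins {N b : ℕ} {D : Diagram N b} {S r k l : ℕ}
    {hS : S ≤ N + b} {h : k + l = N + b + 2 * r} {p q : ℕ} :
    (D.nest S r hS h : Diagram k l).Joins p q ↔ p < k + l ∧ q < k + l ∧ NestRel D.Joins S r p q := by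
  constructor
  · rintro ⟨x, y, rfl, rfl, hxy⟩
    exact ⟨boundaryPos_lt x, boundaryPos_lt y, hxy⟩
  · rintro ⟨hp, hq, hpq⟩
    obtain ⟨x, rfl⟩ := exists_boundaryPos_eq hp
    obtain ⟨y, rfl⟩ := exists_boundaryPos_eq hq
    exact ⟨x, y, rfl, rfl, hpq⟩

theorem Diagram.unnest_joins {k l : ℕ} {D : Diagram k l} {S r N b : ℕ}
    {h : k + l = N + b + 2 * r} {p q : ℕ} :
    (D.unnest S r h : Diagram N b).Joins p q ↔ p < N + b ∧ q < N + b ∧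
      D.Joins (if p < S then p else p + 2 * r) (if q < S then q else q + 2 * r) := by
  constructor
  · rintro ⟨x, y, rfl, rfl, hxy⟩
    exact ⟨boundaryPos_lt x, boundaryPos_lt y, hxy⟩
  · rintro ⟨hp, hq, hpq⟩
    obtain ⟨x, rfl⟩ := exists_boundaryPos_eq hp
    obtain ⟨y, rfl⟩ := exists_boundaryPos_eq hq
    exact ⟨x, y, rfl, rfl, hpq⟩

theorem Diagram.unnest_nest {N b : ℕ} (D : Diagram N b) {S r k l : ℕ}
    (hS : S ≤ N + b) (h : k + l = N + b + 2 * r) : (D.nest S r hS h : Diagram k l).unnest S r h = D := by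
  refine Diagram.ext_joins fun p q => ?_
  rw [Diagram.unnest_joins, Diagram.nest_joins]
  have key : ∀ p, (if (if p < S then p else p + 2 * r) < S then (if p < S then p else p + 2 * r)
      else (if p < S then p else p + 2 * r) - 2 * r) = p := by
    intro p
    split_ifs <;> omega
  constructor
  · rintro ⟨h1, h2, h3, h4, (h5 | ⟨h5, h6, h7⟩)⟩
    · split_ifs at h5 <;> omega
    · rwa [key, key] at h7
  · intro h1
    have := h1.lt_left
    have := h1.lt_right
    refine ⟨by omega, by omega, by split_ifs <;> omega, by split_ifs <;> omega, Or.inr ⟨?_, ?_, ?_⟩⟩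
    · split_ifs <;> omega
    · split_ifs <;> omega
    · rwa [key, key]

theorem Diagram.IsSimple.nest {N b : ℕ} {D : Diagram N b} (hD : D.IsSimple) {S r k l : ℕ}
    (hS : S ≤ N + b) (h : k + l = N + b + 2 * r) :
    (D.nest S r hS h : Diagram k l).IsSimple := by
  obtain ⟨h1, h2, h3⟩ := Diagram.isSimple_iff.1 hD
  have mono : ∀ p q, (p < S ∨ S + 2 * r ≤ p) → (q < S ∨ S + 2 * r ≤ q) → p < q →
      (if p < S then p else p - 2 * r) < (if q < S then q else q - 2 * r) := by
    intro p q hp hq hpq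
    split_ifs <;> omega
  have inj : ∀ p q, (p < S ∨ S + 2 * r ≤ p) → (q < S ∨ S + 2 * r ≤ q) →
      (if p < S then p else p - 2 * r) = (if q < S then q else q - 2 * r) → p = q := by
    intro p q hp hq hpq
    split_ifs at hpq <;> omega
  rw [Diagram.isSimple_iff]
  refine ⟨fun p hp => ?_, fun p q t hpq hpt hne hne' => ?_, fun p q t u hpq hqt htu hpt hqu => ?_⟩
  · by_cases hpI : S ≤ p ∧ p < S + 2 * r
    · exact ⟨2 * (S + r) - 1 - p, by omega,
        Diagram.nest_joins.2 ⟨hp, by omega, Or.inl (by omega)⟩⟩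
    · obtain ⟨q, hne, hq⟩ := h1 (if p < S then p else p - 2 * r) (by split_ifs <;> omega)
      have hlt := hq.lt_right
      by_cases hqS : q < S
      · refine ⟨q, fun h => hne ?_, Diagram.nest_joins.2 ⟨hp, by omega, Or.inr
          ⟨by omega, by omega, by rwa [if_pos hqS]⟩⟩⟩
        rw [h, if_pos (by omega)]
      · refine ⟨q + 2 * r, fun h => hne ?_, Diagram.nest_joins.2 ⟨hp, by omega, Or.inr
          ⟨by omega, by omega, ?_⟩⟩⟩
        · rw [← h, if_neg (by omega)]
          omega
        · rwa [if_neg (show ¬ q + 2 * r < S by omega), Nat.add_sub_cancel]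
  · rw [Diagram.nest_joins] at hpq hpt
    obtain ⟨-, -, (h4 | ⟨h4, h5, h6⟩)⟩ := hpq <;> obtain ⟨-, -, (h7 | ⟨h7, h8, h9⟩)⟩ := hpt
    · omega
    · omega
    · omega
    · exact inj q t h5 h8 (h2 _ _ _ h6 h9 (fun h => hne (inj _ _ h5 h4 h))
        (fun h => hne' (inj _ _ h8 h4 h)))
  · rw [Diagram.nest_joins] at hpt hqu
    obtain ⟨-, -, (h4 | ⟨h4, h5, h6⟩)⟩ := hpt <;> obtain ⟨-, -, (h7 | ⟨h7, h8, h9⟩)⟩ := hqu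
    · omega
    · omega
    · omega
    · exact h3 _ _ _ _ (mono p q h4 h7 hpq) (mono q t h7 h5 hqt) (mono t u h5 h8 htu) h6 h9

theorem Diagram.nest_unnest {k l : ℕ} {D : Diagram k l} (hD : D.IsSimple) {S r N b : ℕ}
    (hS : S ≤ N + b) (h : k + l = N + b + 2 * r)
    (hj : ∀ i, S ≤ i → i < S + r → D.Joins i (2 * (S + r) - 1 - i)) :
    (D.unnest S r h : Diagram N b).nest S r hS h = D := by
  obtain ⟨h1, h2, h3⟩ := Diagram.isSimple_iff.1 hD
  have hj' : ∀ i, S ≤ i → i < S + 2 * r → D.Joins i (2 * (S + r) - 1 - i) := by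
    intro i h4 h5
    by_cases h6 : i < S + r
    · exact hj i h4 h6
    · have := (hj (2 * (S + r) - 1 - i) (by omega) (by omega)).symm
      rwa [show 2 * (S + r) - 1 - (2 * (S + r) - 1 - i) = i by omega] at this
  have key : ∀ p, (p < S ∨ S + 2 * r ≤ p) →
      (if (if p < S then p else p - 2 * r) < S then (if p < S then p else p - 2 * r)
      else (if p < S then p else p - 2 * r) + 2 * r) = p := by
    intro p hp
    split_ifs <;> omega
  refine Diagram.ext_joins fun p q => ?_
  rw [Diagram.nest_joins]
  constructor
  · rintro ⟨hp, hq, (h4 | ⟨h4, h5, h6⟩)⟩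
    · obtain ⟨h5, h6, h7, h8, (rfl | h9)⟩ := h4
      · exact Joins.refl hp
      · have := hj' p h5 h6
        rwa [show 2 * (S + r) - 1 - p = q by omega] at this
    · rw [Diagram.unnest_joins] at h6
      have := h6.2.2
      rwa [key p h4, key q h5] at this
  · intro hpq
    have hp := hpq.lt_left
    have hq := hpq.lt_right
    refine ⟨hp, hq, ?_⟩
    -- a point of the interval is joined only to its mirror image
    have hI : ∀ p q, D.Joins p q → S ≤ p → p < S + 2 * r → q = p ∨ q = 2 * (S + r) - 1 - p := by
      intro p q hpq h4 h5
      by_cases hne : q = p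
      · exact Or.inl hne
      · exact Or.inr (h2 _ _ _ hpq (hj' p h4 h5) hne (by omega))
    by_cases hpI : S ≤ p ∧ p < S + 2 * r
    · have := hI p q hpq hpI.1 hpI.2
      exact Or.inl (by omega)
    by_cases hqI : S ≤ q ∧ q < S + 2 * r
    · have := hI q p hpq.symm hqI.1 hqI.2
      exact Or.inl (by omega)
    · refine Or.inr ⟨by omega, by omega, Diagram.unnest_joins.2 ⟨?_, ?_, ?_⟩⟩
      · split_ifs <;> omega
      · split_ifs <;> omega
      · rwa [key p (by omega), key q (by omega)]

theorem Diagram.IsSimple.unnest {k l : ℕ} {D : Diagram k l} (hD : D.IsSimple) {S r N b : ℕ}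
    (hS : S ≤ N + b) (h : k + l = N + b + 2 * r)
    (hj : ∀ i, S ≤ i → i < S + r → D.Joins i (2 * (S + r) - 1 - i)) :
    (D.unnest S r h : Diagram N b).IsSimple := by
  obtain ⟨h1, h2, h3⟩ := Diagram.isSimple_iff.1 hD
  have mono : ∀ p q, p < q →
      (if p < S then p else p + 2 * r) < (if q < S then q else q + 2 * r) := by
    intro p q hpq
    split_ifs <;> omega
  have inj : ∀ p q, (if p < S then p else p + 2 * r) = (if q < S then q else q + 2 * r) →
      p = q := by
    intro p q hpq
    split_ifs at hpq <;> omega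
  rw [Diagram.isSimple_iff]
  refine ⟨fun p hp => ?_, fun p q t hpq hpt hne hne' => ?_, fun p q t u hpq hqt htu hpt hqu => ?_⟩
  · obtain ⟨q, hne, hq⟩ := h1 (if p < S then p else p + 2 * r) (by split_ifs <;> omega)
    rw [← Diagram.nest_unnest hD hS h hj, Diagram.nest_joins] at hq
    obtain ⟨-, hlt, (h4 | ⟨h4, h5, h6⟩)⟩ := hq
    · split_ifs at h4 <;> omega
    · refine ⟨if q < S then q else q - 2 * r, ?_, ?_⟩
      · rintro h7
        apply hne
        rw [← h7]
        split_ifs <;> omega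
      · rwa [show (if (if p < S then p else p + 2 * r) < S then (if p < S then p else p + 2 * r)
          else (if p < S then p else p + 2 * r) - 2 * r) = p by split_ifs <;> omega] at h6
  · exact inj _ _ (h2 _ _ _ (Diagram.unnest_joins.1 hpq).2.2 (Diagram.unnest_joins.1 hpt).2.2
      (fun h => hne (inj _ _ h)) (fun h => hne' (inj _ _ h)))
  · exact h3 _ _ _ _ (mono p q hpq) (mono q t hqt) (mono t u htu)
      (Diagram.unnest_joins.1 hpt).2.2 (Diagram.unnest_joins.1 hqu).2.2

/-! ### The recursive description of clean diagrams -/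

theorem Diagram.isClean_iff {m : ℕ} {s : Fin m → ℕ} {k : ℕ} {D : Diagram (size s) k} :
    D.IsClean s ↔ (∀ i, InBlock s i → ¬ D.Joins i (i + 1)) ∧
      ∀ p, size s ≤ p → p + 1 < size s + k → ¬ D.Joins p (p + 1) := by
  refine and_congr (forall_congr' fun i => forall_congr' fun hi =>
    not_congr (Joins.iff_r (x := Sum.inl _) (y := Sum.inl _)).symm) ?_
  have hinr : ∀ {j : ℕ} (hj : j < k), boundaryPos (Sum.inr ⟨j, hj⟩ : Fin (size s) ⊕ Fin k) =
    size s + (k - 1 - j) := fun hj => boundaryPos_inr _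
  constructor
  · intro h p hp hpk hj
    refine h ⟨size s + k - 2 - p, by omega, Joins.iff_r.1 ?_⟩
    rw [hinr, hinr]
    convert hj.symm using 1 <;> omega
  · rintro h ⟨j, hj, h1⟩
    have h2 := (Joins.iff_r.2 h1).symm
    rw [hinr, hinr] at h2
    refine h (size s + (k - 1 - (j + 1))) (by omega) (by omega) ?_
    convert h2 using 1
    omega

theorem Diagram.IsClean.not_joins_output {m : ℕ} {s : Fin m → ℕ} {k : ℕ}
    {D : Diagram (size s) k} (h : D.IsClean s) (hD : D.IsSimple) {p q : ℕ} (hp : size s ≤ p)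
    (hq : size s ≤ q) (hne : p ≠ q) : ¬ D.Joins p q := by
  intro hj
  have key := hD.not_joins (Diagram.isClean_iff.1 h).2
  rcases lt_or_gt_of_ne hne with hlt | hlt
  · exact key p q hp hlt hj.lt_right hj
  · exact key q p hq hlt hj.lt_left hj.symm

theorem Diagram.IsClean.nest {m : ℕ} {s : Fin (m + 1) → ℕ} {b k ℓ : ℕ}
    {D : Diagram (size (trunc s)) b} (hc : D.IsClean (trunc s)) (hℓ : ℓ ≤ s (Fin.last m))
    (hS : size (trunc s) + ℓ ≤ size (trunc s) + b)
    (h : size s + k = size (trunc s) + b + 2 * (s (Fin.last m) - ℓ)) :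
    (D.nest (size (trunc s) + ℓ) (s (Fin.last m) - ℓ) hS h : Diagram (size s) k).IsClean s := by
  obtain ⟨h1, h2⟩ := Diagram.isClean_iff.1 hc
  have hs := size_succ s
  rw [Diagram.isClean_iff]
  refine ⟨fun i hi hj => ?_, fun p hp hpk hj => ?_⟩
  · rw [Diagram.nest_joins] at hj
    obtain ⟨-, -, (h3 | ⟨h3, h4, h5⟩)⟩ := hj
    · rcases hi with hi | hi
      · have := hi.lt_size
        omega
      · omega
    · have hlt : i + 1 < size s := hi.lt_size
      rw [if_pos (by omega), if_pos (by omega)] at h5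
      rcases hi with hi | hi
      · exact h1 i hi h5
      · exact h2 i hi.1 h5.lt_right h5
  · rw [Diagram.nest_joins] at hj
    obtain ⟨-, -, (h3 | ⟨h3, h4, h5⟩)⟩ := hj
    · omega
    · rw [if_neg (by omega), if_neg (by omega),
        show p + 1 - 2 * (s (Fin.last m) - ℓ) = p - 2 * (s (Fin.last m) - ℓ) + 1 by omega] at h5
      exact h2 _ (by omega) h5.lt_right h5

/-- A clean simple diagram arises from a clean simple diagram for the truncated sequence by inserting
the nested arcs that join the last block of inputs to the outputs. -/
theorem Diagram.IsClean.exists_eq_nest {m : ℕ} {s : Fin (m + 1) → ℕ} {k : ℕ}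
    {D : Diagram (size s) k} (hD : D.IsSimple) (hc : D.IsClean s) :
    ∃ (b ℓ : ℕ) (_ : ℓ ≤ min b (s (Fin.last m))) (_ : b + s (Fin.last m) = k + 2 * ℓ)
      (hS : size (trunc s) + ℓ ≤ size (trunc s) + b)
      (h : size s + k = size (trunc s) + b + 2 * (s (Fin.last m) - ℓ))
      (D' : Diagram (size (trunc s)) b), D'.IsSimple ∧ D'.IsClean (trunc s) ∧
      D'.nest (size (trunc s) + ℓ) (s (Fin.last m) - ℓ) hS h = D := by
  classical
  obtain ⟨h1, h2⟩ := Diagram.isClean_iff.1 hc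
  have hs := size_succ s
  set N := size (trunc s) with hN
  set n := s (Fin.last m) with hn
  have hin := hD.not_joins (A := N) (B := size s) fun p hp hps => h1 p (Or.inr ⟨hp, hps⟩)
  have hout := hD.not_joins h2
  -- `S` is the first position from which on the last block is joined to the outputs
  have hex : ∃ S, N ≤ S ∧ ∀ i, S ≤ i → i < size s → D.Joins i (2 * size s - 1 - i) :=
    ⟨size s, by omega, fun i hi hi' => by omega⟩
  obtain ⟨hNS, hS⟩ := Nat.find_spec hex
  have hSC : Nat.find hex ≤ size s := Nat.find_min' hex ⟨by omega, fun i hi hi' => by omega⟩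
  have hmin : ∀ i q, N ≤ i → i < Nat.find hex → size s ≤ q → ¬ D.Joins i q := by
    intro i q hi hlt hq hj
    have := (hD.joins_nested hin hout hi (by omega) hq hj.lt_right hj).2
    exact absurd (Nat.find_min' hex ⟨hi, this⟩) (by omega)
  generalize Nat.find hex = S at *
  have hk : size s - S ≤ k := by
    by_contra hlt
    have := (hS S le_rfl (by omega)).lt_right
    omega
  obtain ⟨ℓ, rfl⟩ := Nat.exists_eq_add_of_le hNS
  have hj : ∀ i, N + ℓ ≤ i → i < N + ℓ + (n - ℓ) →
      D.Joins i (2 * (N + ℓ + (n - ℓ)) - 1 - i) := by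
    intro i hi hi'
    rw [show N + ℓ + (n - ℓ) = size s by omega] at hi' ⊢
    exact hS i hi hi'
  have hb1 : N + ℓ ≤ N + (k + 2 * ℓ - n) := by omega
  have hb2 : size s + k = N + (k + 2 * ℓ - n) + 2 * (n - ℓ) := by omega
  refine ⟨k + 2 * ℓ - n, ℓ, by omega, by omega, hb1, hb2, D.unnest (N + ℓ) (n - ℓ) hb2,
    hD.unnest hb1 hb2 hj, ?_, Diagram.nest_unnest hD hb1 hb2 hj⟩
  rw [Diagram.isClean_iff]
  refine ⟨fun i hi hj => ?_, fun p hp hpk hj => ?_⟩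
  · have hlt := hi.lt_size
    have h3 := (Diagram.unnest_joins.1 hj).2.2
    rw [if_pos (by omega), if_pos (by omega)] at h3
    exact h1 i (Or.inl hi) h3
  · have h3 := (Diagram.unnest_joins.1 hj).2.2
    have h4 := h3.lt_right
    split_ifs at h3 h4 with h5 h6 h6
    · exact hin p (p + 1) hp (by omega) (by omega) h3
    · exact hmin p _ hp h5 (by omega) h3
    · omega
    · exact hout _ _ (by omega) (by omega) h4 h3

/-- A colouring compatible with `D_{b,n,ℓ}` is determined by its values on the last `n` inputs and on
the outputs. -/
theorem cgDiagram_colors {b n ℓ k : ℕ} (hℓ : ℓ ≤ min b n) (hb : b + n = k + 2 * ℓ)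
    {v : Fin b → Bool} {v' : Fin n → Bool} {u : Fin k → Bool} :
    (cgDiagram b n ℓ k).Colors (Fin.append v v') u ↔
      (∀ o : Fin b, v o = if h : (o : ℕ) < b - ℓ then u ⟨o, by omega⟩
        else v' ⟨b - 1 - o, by omega⟩) ∧
      ∀ (t : ℕ) (ht : t < n) (_ : ℓ ≤ t), v' ⟨t, ht⟩ = u ⟨t + b - 2 * ℓ, by omega⟩ := by
  rw [Diagram.Colors, cgDiagram, ker_le_ker_iff]
  constructor
  · intro h
    refine ⟨fun o => ?_, fun t ht hℓt => ?_⟩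
    · split_ifs with ho
      · have := h (Sum.inl (Fin.castAdd n o)) (Sum.inr ⟨o, by omega⟩) (by simp [ho])
        simpa using this
      · have := h (Sum.inl (Fin.castAdd n o)) (Sum.inl (Fin.natAdd b ⟨b - 1 - o, by omega⟩)) (by
          simp only [Sum.elim_inl, Fin.val_castAdd, Fin.val_natAdd]
          rw [if_neg ho, if_pos o.2, if_neg (by omega), if_neg (by omega), if_pos (by omega)]
          congr 1
          omega)
        simpa only [Sum.elim_inl, Fin.append_left, Fin.append_right] using this
    · have := h (Sum.inl (Fin.natAdd b ⟨t, ht⟩)) (Sum.inr ⟨t + b - 2 * ℓ, by omega⟩) (by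
        simp only [Sum.elim_inl, Sum.elim_inr, Fin.val_natAdd]
        rw [if_neg (by omega), if_neg (by omega), if_neg (by omega)]
        congr 1
        omega)
      simpa only [Sum.elim_inl, Sum.elim_inr, Fin.append_right] using this
  · rintro ⟨h1, h2⟩
    -- the colouring factors through the labels of the strands
    let G : ℕ ⊕ ℕ → Bool := Sum.elim (fun i => if h : i < k then u ⟨i, h⟩ else false)
      (fun i => if h : i < n then v' ⟨i, h⟩ else false)
    have hinl : ∀ i (h : i < k), G (Sum.inl i) = u ⟨i, h⟩ := fun i h => by simp [G, h]
    have hinr : ∀ i (h : i < n), G (Sum.inr i) = v' ⟨i, h⟩ := fun i h => by simp [G, h]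
    suffices ∀ x, Sum.elim (Fin.append v v') u x = G (Sum.elim
        (fun p : Fin (b + n) => if (p : ℕ) < b - ℓ then Sum.inl (p : ℕ)
          else if (p : ℕ) < b then Sum.inr (b - 1 - (p : ℕ))
          else if (p : ℕ) < b + ℓ then Sum.inr ((p : ℕ) - b) else Sum.inl ((p : ℕ) - 2 * ℓ))
        (fun p : Fin k => Sum.inl (p : ℕ)) x) from
      fun x y hxy => by rw [this x, this y, hxy]
    rintro (p | p)
    · refine Fin.addCases (fun o => ?_) (fun t => ?_) p
      · simp only [Sum.elim_inl, Fin.append_left, Fin.val_castAdd]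
        rw [h1 o]
        split_ifs with ho ho'
        · rw [hinl]
        · rw [hinr]
        · omega
        · omega
      · simp only [Sum.elim_inl, Fin.append_right, Fin.val_natAdd]
        rw [if_neg (by omega), if_neg (by omega)]
        split_ifs with ht
        · rw [hinr _ (by omega)]
          congr 1
          ext
          simp
        · rw [hinl _ (by omega), h2 t t.2 (by omega)]
          congr 1
          ext
          simp only
          omega
    · simp only [Sum.elim_inr]
      rw [hinl _ p.2]

theorem nest_colors {N b n ℓ k : ℕ} (hb : b + n = k + 2 * ℓ)
    (hS : N + ℓ ≤ N + b) (h : N + n + k = N + b + 2 * (n - ℓ)) {D : Diagram N b}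
    {w : Fin N → Bool} {w' : Fin n → Bool} {u : Fin k → Bool} :
    (D.nest (N + ℓ) (n - ℓ) hS h : Diagram (N + n) k).Colors (Fin.append w w') u ↔
      D.Colors w (fun o : Fin b => if h : (o : ℕ) < b - ℓ then u ⟨o, by omega⟩
        else w' ⟨b - 1 - o, by omega⟩) ∧
      ∀ (t : ℕ) (ht : t < n) (_ : ℓ ≤ t), w' ⟨t, ht⟩ = u ⟨t + b - 2 * ℓ, by omega⟩ := by
  set φ : Fin b → Bool := fun o => if h : (o : ℕ) < b - ℓ then u ⟨o, by omega⟩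
        else w' ⟨b - 1 - o, by omega⟩ with hφ
  -- the points of `D` among the points of the diagram with the nested arcs
  let τ : Fin N ⊕ Fin b → Fin (N + n) ⊕ Fin k := Sum.elim (fun i => Sum.inl (Fin.castAdd n i))
    (fun o => if h : (o : ℕ) < b - ℓ then Sum.inr ⟨o, by omega⟩
      else Sum.inl (Fin.natAdd N ⟨b - 1 - o, by omega⟩))
  have hτ : ∀ x, Sum.elim (Fin.append w w') u (τ x) = Sum.elim w φ x := by
    rintro (i | o)
    · simp [τ]
    · simp only [τ, hφ, Sum.elim_inr]
      split_ifs <;> simp only [Sum.elim_inl, Sum.elim_inr, Fin.append_right]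
  have hpos : ∀ x, boundaryPos (τ x) =
      if boundaryPos x < N + ℓ then boundaryPos x else boundaryPos x + 2 * (n - ℓ) := by
    rintro (i | o)
    · rw [if_pos (by rw [boundaryPos_inl]; omega)]
      rfl
    · simp only [τ, Sum.elim_inr, boundaryPos_inr]
      split_ifs with h1 h2 h2
      · omega
      · simp only [boundaryPos_inr]
        omega
      · simp only [boundaryPos_inl, Fin.val_natAdd]
      · omega
  have hback : ∀ z : Fin (N + n) ⊕ Fin k,
      (boundaryPos z < N + ℓ ∨ N + ℓ + 2 * (n - ℓ) ≤ boundaryPos z) → ∃ x, τ x = z := by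
    intro z hz
    have := boundaryPos_lt z
    obtain ⟨x, hx⟩ := exists_boundaryPos_eq (k := N) (l := b)
      (p := if boundaryPos z < N + ℓ then boundaryPos z else boundaryPos z - 2 * (n - ℓ))
      (by split_ifs <;> omega)
    refine ⟨x, boundaryPos_injective ?_⟩
    rw [hpos, hx]
    split_ifs <;> omega
  have hrel : ∀ x y, (D.nest (N + ℓ) (n - ℓ) hS h : Diagram (N + n) k).r (τ x) (τ y) ↔ D.r x y := by
    intro x y
    rw [← Diagram.Joins.iff_r (D := D)]
    change NestRel _ _ _ _ _ ↔ _
    rw [hpos, hpos, NestRel]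
    have key : ∀ p, (if (if p < N + ℓ then p else p + 2 * (n - ℓ)) < N + ℓ
        then (if p < N + ℓ then p else p + 2 * (n - ℓ))
        else (if p < N + ℓ then p else p + 2 * (n - ℓ)) - 2 * (n - ℓ)) = p := by
      intro p
      split_ifs <;> omega
    rw [key, key]
    constructor
    · rintro (h1 | h1)
      · split_ifs at h1 <;> omega
      · exact h1.2.2
    · intro h1
      exact Or.inr ⟨by split_ifs <;> omega, by split_ifs <;> omega, h1⟩
  constructor
  · intro hc
    refine ⟨fun x y hxy => ?_, fun t ht hℓt => ?_⟩
    · have := hc ((hrel x y).2 hxy)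
      rwa [Setoid.ker_def, hτ, hτ] at this
    · have := @hc (Sum.inl (Fin.natAdd N ⟨t, ht⟩)) (Sum.inr ⟨t + b - 2 * ℓ, by omega⟩) (Or.inl (by
        rw [boundaryPos_inl, boundaryPos_inr, Fin.val_natAdd]
        simp only
        omega))
      simpa only [Setoid.ker_def, Sum.elim_inl, Sum.elim_inr, Fin.append_right] using this
  · rintro ⟨h1, h2⟩ x y hxy
    rcases hxy with h3 | ⟨h3, h4, h5⟩
    · have hpt : ∀ x : Fin (N + n) ⊕ Fin k, N + ℓ ≤ boundaryPos x →
          boundaryPos x < N + ℓ + 2 * (n - ℓ) → (∃ (t : ℕ) (ht : t < n), ℓ ≤ t ∧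
          x = Sum.inl (Fin.natAdd N ⟨t, ht⟩)) ∨ ∃ (t : ℕ) (_ : t < n), ℓ ≤ t ∧
          ∃ h, x = Sum.inr ⟨t + b - 2 * ℓ, h⟩ := by
        rintro (i | o) h6 h7
        · rw [boundaryPos_inl] at h6
          refine Or.inl ⟨i - N, by omega, by omega, ?_⟩
          congr 1
          ext
          simp only [Fin.val_natAdd]
          omega
        · rw [boundaryPos_inr] at h7
          refine Or.inr ⟨o + 2 * ℓ - b, by omega, by omega, by omega, ?_⟩
          congr 1
          ext
          simp only
          omega
      obtain ⟨h6, h7, h8, h9, h10⟩ := h3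
      rcases h10 with h10 | h10
      · rw [boundaryPos_injective h10]
      rw [Setoid.ker_def]
      rcases hpt x h6 h7 with ⟨t, ht, hℓt, rfl⟩ | ⟨t, ht, hℓt, hx, rfl⟩ <;>
        rcases hpt y h8 h9 with ⟨t', ht', hℓt', rfl⟩ | ⟨t', ht', hℓt', hy, rfl⟩ <;>
        simp only [boundaryPos_inl, boundaryPos_inr, Fin.val_natAdd, Sum.elim_inl, Sum.elim_inr,
          Fin.append_right] at h10 ⊢
      · omega
      · rw [h2 t ht hℓt]
        congr 2
        omega
      · rw [h2 t' ht' hℓt']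
        congr 2
        omega
      · omega
    · obtain ⟨x, rfl⟩ := hback x h3
      obtain ⟨y, rfl⟩ := hback y h4
      rw [Setoid.ker_def, hτ, hτ]
      exact h1 ((hrel x y).1 (Or.inr ⟨h3, h4, h5⟩))

/-- Stacking `D_{b,n,ℓ}` on top of `D ⊗ 1_n` creates no circle and inserts `n - ℓ` nested arcs. -/
theorem comp_cgDiagram_tensor {N b n ℓ k : ℕ} (hℓ : ℓ ≤ min b n) (hb : b + n = k + 2 * ℓ)
    (hS : N + ℓ ≤ N + b) (h : N + n + k = N + b + 2 * (n - ℓ)) (D : Diagram N b) :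
    comp a (cgDiagram b n ℓ k).mor (tensor D.mor (Diagram.id n).mor) =
      (D.nest (N + ℓ) (n - ℓ) hS h : Diagram (N + n) k).mor := by
  classical
  rw [tensor_mor]
  suffices colMat (D.juxt (Diagram.id n)) * colMat (cgDiagram b n ℓ k) =
      2 ^ 0 • colMat (D.nest (N + ℓ) (n - ℓ) hS h : Diagram (N + n) k) by
    rw [comp_mor_of_colMat this, pow_zero, one_smul]
  ext w u
  obtain ⟨⟨w, w'⟩, rfl⟩ := (Fin.appendEquiv N n).surjective w
  simp only [Fin.appendEquiv, Equiv.coe_fn_mk]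
  set φ : Fin b → Bool := fun o => if h : (o : ℕ) < b - ℓ then u ⟨o, by omega⟩
        else w' ⟨b - 1 - o, by omega⟩ with hφ
  rw [Matrix.mul_apply, ← (Fin.appendEquiv b n).sum_comp, Fintype.sum_prod_type, pow_zero, one_smul]
  simp only [Fin.appendEquiv, Equiv.coe_fn_mk, colMat_juxt, colMat_id, Matrix.one_apply]
  have h1 : ∀ v, ∑ v', colMat D w v * (if w' = v' then 1 else 0) *
      colMat (cgDiagram b n ℓ k) (Fin.append v v') u =
      colMat D w v * colMat (cgDiagram b n ℓ k) (Fin.append v w') u := by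
    intro v
    simp
  simp only [h1]
  rw [Finset.sum_eq_single φ]
  · have h2 := nest_colors hb hS h (D := D) (w := w) (w' := w') (u := u)
    have h3 := cgDiagram_colors hℓ hb (v := φ) (v' := w') (u := u)
    by_cases h4 : D.Colors w φ
    · rw [colMat_of_colors h4, one_mul]
      refine if_congr (h3.trans (Iff.trans ?_ h2.symm)) rfl rfl
      exact ⟨fun h => ⟨h4, h.2⟩, fun h => ⟨fun _ => rfl, h.2⟩⟩
    · rw [colMat_of_not_colors h4, zero_mul, colMat_of_not_colors fun h => h4 (h2.1 h).1]
  · intro v _ hne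
    rw [colMat_of_not_colors (D := cgDiagram b n ℓ k), mul_zero]
    rw [cgDiagram_colors hℓ hb]
    exact fun h => hne (funext h.1)
  · simp

namespace RecIndex

variable {M : ℕ} {s : Fin (M + 1) → ℕ} {k : ℕ}

theorem le_add (x : RecIndex a s k) : size (trunc s) + x.ℓ ≤ size (trunc s) + x.b := by
  have := x.ℓ_le
  omega

theorem size_add (x : RecIndex a s k) :
    size s + k = size (trunc s) + x.b + 2 * (s (Fin.last M) - x.ℓ) := by
  have := x.ℓ_le
  have := x.weight_eq
  have := size_succ s
  omega

/-- The diagram `D_{b,n_m,ℓ} ∘ (D ⊗ 1_{n_m})`. -/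
@[reducible] def diagram (x : RecIndex a s k) : Diagram (size s) k :=
  x.D.nest (size (trunc s) + x.ℓ) (s (Fin.last M) - x.ℓ) x.le_add x.size_add

theorem bar_eq (x : RecIndex a s k) : x.bar = x.diagram.mor :=
  comp_cgDiagram_tensor x.ℓ_le x.weight_eq x.le_add x.size_add x.D

theorem isGoodType_diagram (ha : a ≠ 0) (hgen : ∀ n : ℕ, 0 < n → a ^ n ≠ 1)
    (x : RecIndex a s k) : IsGoodType a s k x.diagram := by
  obtain ⟨h1, h2⟩ := (isGoodType_iff ha hgen).1 x.good
  have := x.ℓ_le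
  exact (isGoodType_iff ha hgen).2 ⟨h1.nest _ _, h2.nest (by omega) _ _⟩

/-- The number of inserted arcs is determined by the resulting diagram. -/
theorem ℓ_le_of_diagram_eq (ha : a ≠ 0) (hgen : ∀ n : ℕ, 0 < n → a ^ n ≠ 1)
    {x y : RecIndex a s k} (h : x.diagram = y.diagram) : y.ℓ ≤ x.ℓ := by
  by_contra! hlt
  obtain ⟨h1, h2⟩ := (isGoodType_iff ha hgen).1 y.good
  have hx := x.ℓ_le
  have hy := y.ℓ_le
  have hxs := x.size_add
  have hys := y.size_add
  have hxw := x.weight_eq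
  have hyw := y.weight_eq
  have hs := size_succ s
  -- this arc is one of the nested arcs of `x`, but would join two outputs of `y.D`
  have hj : x.diagram.Joins (size (trunc s) + x.ℓ) (2 * size s - 1 - (size (trunc s) + x.ℓ)) :=
    Diagram.nest_joins.2 ⟨by omega, by omega, Or.inl (by omega)⟩
  rw [h, Diagram.nest_joins] at hj
  obtain ⟨-, -, (h3 | ⟨h3, h4, h5⟩)⟩ := hj
  · omega
  · refine h2.not_joins_output h1 ?_ ?_ ?_ h5 <;> split_ifs <;> omega

theorem diagram_injective (ha : a ≠ 0) (hgen : ∀ n : ℕ, 0 < n → a ^ n ≠ 1) :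
    Function.Injective (diagram : RecIndex a s k → Diagram (size s) k) := by
  intro x y h
  have hℓ : x.ℓ = y.ℓ :=
    le_antisymm (ℓ_le_of_diagram_eq ha hgen h.symm) (ℓ_le_of_diagram_eq ha hgen h)
  have hb : x.b = y.b := by
    have hxw := x.weight_eq
    have hyw := y.weight_eq
    omega
  obtain ⟨b, h1, ℓ, h2, h3, D, h4⟩ := x
  obtain ⟨b', h1', ℓ', h2', h3', D', h4'⟩ := y
  simp only at hℓ hb
  subst hℓ hb
  have hD := congr_arg (fun E : Diagram (size s) k => (E.unnest (size (trunc s) + ℓ)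
    (s (Fin.last M) - ℓ) (size_add ⟨b, h1, ℓ, h2, h3, D, h4⟩) : Diagram (size (trunc s)) b)) h
  simp only [diagram, Diagram.unnest_nest] at hD
  subst hD
  rfl

theorem bar_injective (ha : a ≠ 0) (hgen : ∀ n : ℕ, 0 < n → a ^ n ≠ 1) :
    Function.Injective (bar : RecIndex a s k → LinDiagram (size s) k) := by
  intro x y h
  rw [bar_eq, bar_eq] at h
  exact diagram_injective ha hgen (Finsupp.single_left_injective one_ne_zero h)

end RecIndex

/-! ### Counting weights -/

/-- The number of tuples `(c_1, …, c_m)` with `0 ≤ c_i ≤ n_i` and sum `t`, that is, the dimension of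
the space of weight `|s| - 2 t` of the module attached to `s = (n_1, …, n_m)`. -/
def weightCount : {m : ℕ} → (Fin m → ℕ) → ℤ → ℕ
  | 0, _, t => if t = 0 then 1 else 0
  | m + 1, s, t => ∑ c ∈ Finset.range (s (Fin.last m) + 1), weightCount (trunc s) (t - c)

theorem weightCount_symm : ∀ {m : ℕ} (s : Fin m → ℕ) (t : ℤ),
    weightCount s (size s - t) = weightCount s t
  | 0, s, t => by simp [weightCount, size]
  | m + 1, s, t => by
    rw [weightCount, weightCount, ← Finset.sum_range_reflect]
    refine Finset.sum_congr rfl fun c hc => ?_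
    rw [Finset.mem_range] at hc
    rw [← weightCount_symm (trunc s) (t - c)]
    congr 1
    rw [size_succ]
    push_cast [show s (Fin.last m) + 1 - 1 - c = s (Fin.last m) - c by omega,
      Nat.cast_sub (show c ≤ s (Fin.last m) by omega)]
    ring

/-- The sums defining two consecutive values differ in one term at either end. -/
theorem weightCount_succ_sub {m : ℕ} (s : Fin (m + 1) → ℕ) (t : ℤ) :
    weightCount s t + weightCount (trunc s) (t - s (Fin.last m) - 1) =
      weightCount s (t - 1) + weightCount (trunc s) t := by
  rw [weightCount, weightCount, Finset.sum_range_succ', Finset.sum_range_succ]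
  have h : ∀ c : ℕ, t - ((c + 1 : ℕ) : ℤ) = t - 1 - c := fun c => by push_cast; ring
  simp only [h]
  rw [show t - 1 - (s (Fin.last m) : ℤ) = t - s (Fin.last m) - 1 by ring]
  simp
  ring

/-- The weight multiplicities are unimodal. -/
theorem weightCount_mono : ∀ {m : ℕ} (s : Fin m → ℕ) (t u : ℤ), t ≤ u → u ≤ size s - t →
    weightCount s t ≤ weightCount s u
  | 0, s, t, u, h1, h2 => by
    simp only [weightCount, size] at *
    split_ifs <;> omega
  | m + 1, s, t, u, h1, h2 => by
    have hs := size_succ s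
    have step : ∀ t : ℤ, 2 * t ≤ size s + 1 → weightCount s (t - 1) ≤ weightCount s t := by
      intro t ht
      have h3 := weightCount_succ_sub s t
      have h4 := weightCount_mono (trunc s) (t - s (Fin.last m) - 1) t (by omega) (by omega)
      omega
    have chain : ∀ (d : ℕ) (t : ℤ), 2 * (t + d) ≤ size s + 1 →
        weightCount s t ≤ weightCount s (t + d) := by
      intro d
      induction d with
      | zero => simp
      | succ d ih =>
        intro t ht
        push_cast at ht ⊢
        refine (ih t (by omega)).trans ?_
        have := step (t + d + 1) (by omega)
        rwa [add_sub_cancel_right, add_assoc] at this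
    by_cases hu : 2 * u ≤ size s
    · have := chain (u - t).toNat t (by omega)
      rwa [show t + ((u - t).toNat : ℤ) = u by omega] at this
    · rw [← weightCount_symm s u]
      have := chain (size s - u - t).toNat t (by omega)
      rwa [show t + ((size s - u - t).toNat : ℤ) = size s - u by omega] at this

/-- A clean simple diagram of type `(s, (b))` forces the multiplicity of the weight `b` to exceed
that of the weight `b + 2`: by unimodality, the increase for the truncated sequence persists. -/
theorem exists_weightCount_lt : ∀ {m : ℕ} {s : Fin m → ℕ} {b : ℕ} {D : Diagram (size s) b},
    D.IsSimple → D.IsClean s → ∃ t : ℤ, size s = b + 2 * t ∧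
      weightCount s (t - 1) < weightCount s t
  | 0, s, b, D, hD, hc => by
    have hb : b = 0 := by
      by_contra hb
      obtain ⟨q, hne, hq⟩ := (Diagram.isSimple_iff.1 hD).1 0 (by omega)
      exact hc.not_joins_output hD (Nat.zero_le _) (Nat.zero_le _) hne.symm hq
    exact ⟨0, by simp [hb, size], by simp [weightCount]⟩
  | m + 1, s, k, D, hD, hc => by
    obtain ⟨b, ℓ, hℓ, hb, -, -, D', hD', hc', -⟩ := hc.exists_eq_nest hD
    obtain ⟨t, ht, hlt⟩ := exists_weightCount_lt hD' hc'
    have hs := size_succ s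
    refine ⟨t + ℓ, by omega, ?_⟩
    have h1 := weightCount_succ_sub s (t + ℓ)
    have h2 := weightCount_mono (trunc s) t (t + ℓ) (by omega) (by omega)
    have h3 := weightCount_mono (trunc s) (t + ℓ - s (Fin.last m) - 1) (t - 1) (by omega) (by omega)
    omega

/-! ### Block-symmetric vectors in tensor powers of the fundamental module -/

theorem actX_mulVec_apply (q : ℂ) {n : ℕ} (f : (Fin n → Fin 2) → ℂ) (w : Fin n → Fin 2) :
    (actX q n).mulVec f w = ∑ i, if w i = 0 then
      (∏ j ∈ Finset.Ioi i, kEigen q (w j)) * f (Function.update w i 1) else 0 := by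
  simp only [Matrix.mulVec, dotProduct, actX, Matrix.of_apply, Finset.sum_mul]
  rw [Finset.sum_comm]
  refine Finset.sum_congr rfl fun i _ => ?_
  have hprod : ∀ (v : Fin n → Fin 2) (ε : Fin 2), ∏ j ∈ Finset.Ioi i,
      kEigen q (Function.update v i ε j) = ∏ j ∈ Finset.Ioi i, kEigen q (v j) := fun v ε =>
    Finset.prod_congr rfl fun j hj => by
      rw [Function.update_of_ne (Finset.mem_Ioi.1 hj).ne']
  rw [Finset.sum_eq_single (Function.update w i 1)]
  · by_cases hw : w i = 0
    · rw [if_pos hw, if_pos, hprod]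
      refine ⟨Function.update_self _ _ _, ?_⟩
      rw [Function.update_idem, ← hw, Function.update_eq_self]
    · rw [if_neg hw, if_neg, zero_mul]
      rintro ⟨-, h⟩
      rw [Function.update_idem] at h
      exact hw (by rw [h, Function.update_self])
  · intro v _ hne
    rw [if_neg, zero_mul]
    rintro ⟨h1, rfl⟩
    rw [Function.update_idem, ← h1, Function.update_eq_self] at hne
    exact hne rfl
  · simp

/-- The vector `f` of `V^{⊗n}` is annihilated by the cap at the factors `i` and `j`: as
`d (v_0 ⊗ v_1) = 1` and `d (v_1 ⊗ v_0) = -q⁻¹`, this relates the coefficients of words that differ by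
exchanging the letters at `i` and `j`. -/
def KilledByCap (q : ℂ) {n : ℕ} (i j : Fin n) (f : (Fin n → Fin 2) → ℂ) : Prop :=
  ∀ w : Fin n → Fin 2, w i = 1 → w j = 0 → f w = q * f (w ∘ Equiv.swap i j)

theorem KilledByCap.actX_mulVec {q : ℂ} (hq : q ≠ 0) {n i : ℕ} (hi : i + 1 < n)
    {f : (Fin n → Fin 2) → ℂ} (hf : KilledByCap q ⟨i, by omega⟩ ⟨i + 1, hi⟩ f) :
    KilledByCap q ⟨i, by omega⟩ ⟨i + 1, hi⟩ ((actX q n).mulVec f) := by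
  intro w hw hw'
  set x : Fin n := ⟨i, by omega⟩ with hx
  set y : Fin n := ⟨i + 1, hi⟩ with hy
  have hxy : x ≠ y := by simp [hx, hy]
  set σ := Equiv.swap x y with hσ
  have hσx : σ x = y := Equiv.swap_apply_left _ _
  have hσy : σ y = x := Equiv.swap_apply_right _ _
  have hσj : ∀ j, j ≠ x → j ≠ y → σ j = j := fun j h1 h2 => Equiv.swap_apply_of_ne_of_ne h1 h2
  set G : (Fin n → Fin 2) → Fin n → ℂ := fun v j => if v j = 0 then
      (∏ l ∈ Finset.Ioi j, kEigen q (v l)) * f (Function.update v j 1) else 0 with hG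
  have key : ∀ j, G w (σ j) = q * G (w ∘ σ) j := by
    intro j
    by_cases hjx : j = x
    · have hprod : ∏ l ∈ Finset.Ioi x, kEigen q ((w ∘ σ) l) =
          q⁻¹ * ∏ l ∈ Finset.Ioi y, kEigen q (w l) := by
        have : Finset.Ioi x = insert y (Finset.Ioi y) := by
          ext l
          simp only [Finset.mem_Ioi, Finset.mem_insert, Fin.lt_def, Fin.ext_iff, hx, hy]
          omega
        rw [this, Finset.prod_insert (by simp)]
        congr 1
        · simp [hσy, hw, kEigen]
        · refine Finset.prod_congr rfl fun l hl => ?_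
          rw [Finset.mem_Ioi] at hl
          have hl' : i + 1 < (l : ℕ) := hl
          rw [Function.comp_apply, hσj l]
          · simp only [ne_eq, Fin.ext_iff, hx]
            omega
          · exact hl.ne'
      have hupd : Function.update (w ∘ σ) x 1 = Function.update w y 1 := by
        ext l
        by_cases hlx : l = x
        · simp [hlx, hxy, hw]
        by_cases hly : l = y
        · simp [hly, hxy.symm, hσy, hw]
        · simp [hlx, hly, hσj l hlx hly]
      simp only [hG]
      rw [hjx, hσx, if_pos hw', if_pos (by rw [Function.comp_apply, hσx, hw']), hprod, hupd]
      field_simp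
    by_cases hjy : j = y
    · simp only [hG]
      rw [hjy, hσy, if_neg (by rw [hw]; decide),
        if_neg (by rw [Function.comp_apply, hσy, hw]; decide), mul_zero]
    · rw [hσj j hjx hjy]
      simp only [hG]
      rw [Function.comp_apply, hσj j hjx hjy]
      by_cases hj : w j = 0
      · have hprod : ∏ l ∈ Finset.Ioi j, kEigen q ((w ∘ σ) l) =
            ∏ l ∈ Finset.Ioi j, kEigen q (w l) := by
          refine Finset.prod_equiv σ (fun l => ?_) fun l _ => rfl
          simp only [Finset.mem_Ioi]
          by_cases hlx : l = x
          · rw [hlx, hσx]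
            simp only [Fin.lt_def, hx, hy, Fin.ext_iff] at hjx hjy ⊢
            omega
          by_cases hly : l = y
          · rw [hly, hσy]
            simp only [Fin.lt_def, hx, hy, Fin.ext_iff] at hjx hjy ⊢
            omega
          · rw [hσj l hlx hly]
        have hupd : Function.update w j 1 ∘ σ = Function.update (w ∘ σ) j 1 := by
          ext l
          by_cases hl : l = j
          · simp [hl, hσj j hjx hjy]
          · have : σ l ≠ j := fun h => hl (by rw [← σ.injective.eq_iff, h, hσj j hjx hjy])
            simp [hl, this]
        rw [if_pos hj, if_pos hj, hf _ (by rwa [Function.update_of_ne (Ne.symm hjx)])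
          (by rwa [Function.update_of_ne (Ne.symm hjy)]), ← hσ, hupd, hprod]
        ring
      · rw [if_neg hj, if_neg hj, mul_zero]
  calc (actX q n).mulVec f w = ∑ j, G w j := actX_mulVec_apply q f w
    _ = ∑ j, G w (σ j) := (Equiv.sum_comp σ _).symm
    _ = ∑ j, q * G (w ∘ σ) j := Finset.sum_congr rfl fun j _ => key j
    _ = _ := by rw [← Finset.mul_sum, actX_mulVec_apply]

/-- The vectors of weight `n - 2 t` in `V^{⊗n}`, `n = |s|`, annihilated by all caps inside the blocks
of `s`; the words in their support have `t` letters `1`. They form the corresponding weight space of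
the module attached to `s`. -/
def blockSymmetric (q : ℂ) {m : ℕ} (s : Fin m → ℕ) (t : ℤ) :
    Submodule ℂ ((Fin (size s) → Fin 2) → ℂ) where
  carrier := {f | (∀ w, f w ≠ 0 → ∑ i, ((w i : ℕ) : ℤ) = t) ∧ ∀ (i : ℕ) (hi : InBlock s i),
    KilledByCap q ⟨i, by have := hi.lt_size; omega⟩ ⟨i + 1, hi.lt_size⟩ f}
  zero_mem' := ⟨fun w h => (h rfl).elim, fun i hi w _ _ => by simp⟩
  add_mem' := by
    rintro f g ⟨h1, h2⟩ ⟨h3, h4⟩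
    refine ⟨fun w h => ?_, fun i hi w hw hw' => ?_⟩
    · by_cases hf : f w = 0
      · exact h3 w fun hg => h (by simp [hf, hg])
      · exact h1 w hf
    · simp only [Pi.add_apply]
      rw [h2 i hi w hw hw', h4 i hi w hw hw', mul_add]
  smul_mem' := by
    rintro c f ⟨h1, h2⟩
    refine ⟨fun w h => h1 w fun hf => h (by simp [hf]), fun i hi w hw hw' => ?_⟩
    simp only [Pi.smul_apply, smul_eq_mul]
    rw [h2 i hi w hw hw']
    ring

theorem sum_update_one {n : ℕ} {w : Fin n → Fin 2} {i : Fin n} (hi : w i = 0) :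
    ∑ j, ((Function.update w i 1 j : ℕ) : ℤ) = ∑ j, ((w j : ℕ) : ℤ) + 1 := by
  rw [← Finset.add_sum_erase _ _ (Finset.mem_univ i), 
    ← Finset.add_sum_erase _ (fun j => ((w j : ℕ) : ℤ)) (Finset.mem_univ i),
    Finset.sum_congr rfl (g := fun j => ((w j : ℕ) : ℤ)) fun j hj => by
      rw [Function.update_of_ne (Finset.ne_of_mem_erase hj)]]
  simp [hi]
  ring

theorem actX_mem_blockSymmetric {q : ℂ} (hq : q ≠ 0) {m : ℕ} {s : Fin m → ℕ} {t : ℤ}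
    {f : (Fin (size s) → Fin 2) → ℂ} (hf : f ∈ blockSymmetric q s t) :
    (actX q (size s)).mulVec f ∈ blockSymmetric q s (t - 1) := by
  refine ⟨fun w hw => ?_, fun i hi => (hf.2 i hi).actX_mulVec hq hi.lt_size⟩
  rw [actX_mulVec_apply] at hw
  obtain ⟨i, -, hi⟩ := Finset.exists_ne_zero_of_sum_ne_zero hw
  split_ifs at hi with hwi
  · have := hf.1 _ (right_ne_zero_of_mul hi)
    rw [sum_update_one hwi] at this
    omega
  · exact (hi rfl).elim

theorem fin_two_val_sum_le {n : ℕ} (v : Fin n → Fin 2) : ∑ i, (v i : ℕ) ≤ n := by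
  calc ∑ i, (v i : ℕ) ≤ ∑ _i : Fin n, 1 := Finset.sum_le_sum fun i _ => by omega
    _ = n := by simp

/-- The word `0 ⋯ 0 1 ⋯ 1` of length `n` with `c` letters `1`. -/
def sortedWord (n c : ℕ) : Fin n → Fin 2 := fun i => if n ≤ i + c then 1 else 0

theorem sum_sortedWord {n c : ℕ} (hc : c ≤ n) : ∑ i, (sortedWord n c i : ℕ) = c := by
  obtain ⟨d, rfl⟩ := Nat.exists_eq_add_of_le' hc
  rw [Fin.sum_univ_add]
  have h1 : ∀ i : Fin d, sortedWord (d + c) c (Fin.castAdd c i) = 0 := fun i => by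
    simp only [sortedWord, Fin.val_castAdd]
    rw [if_neg (by omega)]
  have h2 : ∀ i : Fin c, sortedWord (d + c) c (Fin.natAdd d i) = 1 := fun i => by
    simp only [sortedWord, Fin.val_natAdd]
    rw [if_pos (by omega)]
  simp [h1, h2]

theorem exists_eq_sortedWord {n : ℕ} (w : Fin n → Fin 2)
    (h : ∀ (i : ℕ) (hi : i + 1 < n), w ⟨i, by omega⟩ = 1 → w ⟨i + 1, hi⟩ ≠ 0) :
    ∃ c ≤ n, w = sortedWord n c := by
  classical
  have h2 : ∀ ε : Fin 2, ε ≠ 0 ↔ ε = 1 := by decide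
  have hup : ∀ i j (hi : i < n) (hj : j < n), i ≤ j → w ⟨i, hi⟩ = 1 → w ⟨j, hj⟩ = 1 := by
    intro i j hi hj hij
    induction j, hij using Nat.le_induction with
    | base => exact id
    | succ j hij ih => exact fun h1 => (h2 _).1 (h j hj (ih (by omega) h1))
  have hex : ∃ p, p ≤ n ∧ ∀ i : Fin n, p ≤ i → w i = 1 := ⟨n, le_rfl, fun i hi => by omega⟩
  obtain ⟨hp, hp'⟩ := Nat.find_spec hex
  refine ⟨n - Nat.find hex, by omega, funext fun i => ?_⟩
  simp only [sortedWord]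
  split_ifs with hi
  · exact hp' i (by omega)
  · by_contra hne
    exact hi (by
      have := Nat.find_min' hex ⟨i.2.le, fun j hj => hup i j i.2 j.2 hj ((h2 _).1 hne)⟩
      omega)

/-- A vector annihilated by all caps is determined by its coefficients at sorted words. -/
theorem eq_zero_of_killedByCap {q : ℂ} {n : ℕ} {g : (Fin n → Fin 2) → ℂ}
    (hg : ∀ (i : ℕ) (hi : i + 1 < n), KilledByCap q ⟨i, by omega⟩ ⟨i + 1, hi⟩ g)
    (h0 : ∀ c ≤ n, g (sortedWord n c) = 0) : g = 0 := by
  -- exchanging neighbouring letters `1`, `0` lowers this weighted sum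
  have key : ∀ (d : ℕ) (w : Fin n → Fin 2), ∑ i, (w i : ℕ) * (n - i) = d → g w = 0 := by
    intro d
    induction d using Nat.strong_induction_on with
    | _ d ih =>
    intro w hd
    by_cases h : ∃ (i : ℕ) (hi : i + 1 < n), w ⟨i, by omega⟩ = 1 ∧ w ⟨i + 1, hi⟩ = 0
    · obtain ⟨i, hi, h1, h2⟩ := h
      rw [hg i hi w h1 h2]
      set x : Fin n := ⟨i, by omega⟩ with hx
      set y : Fin n := ⟨i + 1, hi⟩ with hy
      have hxy : y ≠ x := by simp [hx, hy]
      have hlt : ∑ j, ((w ∘ Equiv.swap x y) j : ℕ) * (n - j) < d := by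
        rw [← hd, ← Finset.add_sum_erase _ _ (Finset.mem_univ x),
          ← Finset.add_sum_erase _ _ (Finset.mem_erase.2 ⟨hxy, Finset.mem_univ y⟩),
          ← Finset.add_sum_erase _ (fun j => (w j : ℕ) * (n - j)) (Finset.mem_univ x),
          ← Finset.add_sum_erase _ (fun j => (w j : ℕ) * (n - j))
            (Finset.mem_erase.2 ⟨hxy, Finset.mem_univ y⟩),
          Finset.sum_congr rfl (g := fun j => (w j : ℕ) * (n - j)) fun j hj => by
            rw [Function.comp_apply, Equiv.swap_apply_of_ne_of_ne (Finset.ne_of_mem_erase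
              (Finset.mem_of_mem_erase hj)) (Finset.ne_of_mem_erase hj)]]
        simp only [Function.comp_apply, Equiv.swap_apply_left, Equiv.swap_apply_right, h1, h2]
        have hxv : (x : ℕ) = i := rfl
        have hyv : (y : ℕ) = i + 1 := rfl
        rw [hxv, hyv]
        simp only [Fin.val_zero, Fin.val_one]
        omega
      rw [ih _ hlt _ rfl, mul_zero]
    · push Not at h
      obtain ⟨c, hc, rfl⟩ := exists_eq_sortedWord w h
      exact h0 c hc
  exact funext fun w => key _ w rfl

/-- The vector `∑_w q^{-(sum of the positions of the letters 1 in w)} v_w`, whose components of fixed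
weight span the vectors of this weight annihilated by all caps. -/
def symmetricVector (q : ℂ) {n : ℕ} (w : Fin n → Fin 2) : ℂ :=
  ∏ i, if w i = 1 then (q⁻¹) ^ (i : ℕ) else 1

theorem symmetricVector_ne_zero {q : ℂ} (hq : q ≠ 0) {n : ℕ} (w : Fin n → Fin 2) :
    symmetricVector q w ≠ 0 :=
  Finset.prod_ne_zero_iff.2 fun i _ => by
    split_ifs
    · exact pow_ne_zero _ (inv_ne_zero hq)
    · exact one_ne_zero

theorem killedByCap_symmetricVector {q : ℂ} (hq : q ≠ 0) {n i : ℕ} (hi : i + 1 < n) :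
    KilledByCap q ⟨i, by omega⟩ ⟨i + 1, hi⟩ (symmetricVector q) := by
  intro w hw hw'
  set x : Fin n := ⟨i, by omega⟩ with hx
  set y : Fin n := ⟨i + 1, hi⟩ with hy
  have hxy : y ≠ x := by simp [hx, hy]
  rw [symmetricVector, symmetricVector, ← Finset.mul_prod_erase _ _ (Finset.mem_univ x),
    ← Finset.mul_prod_erase _ _ (Finset.mem_erase.2 ⟨hxy, Finset.mem_univ y⟩),
    ← Finset.mul_prod_erase _ (fun j : Fin n => if (w ∘ Equiv.swap x y) j = 1 then (q⁻¹) ^ (j : ℕ)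
      else 1) (Finset.mem_univ x),
    ← Finset.mul_prod_erase _ (fun j : Fin n => if (w ∘ Equiv.swap x y) j = 1 then (q⁻¹) ^ (j : ℕ)
      else 1) (Finset.mem_erase.2 ⟨hxy, Finset.mem_univ y⟩),
    Finset.prod_congr rfl (g := fun j : Fin n => if w j = 1 then (q⁻¹) ^ (j : ℕ) else 1)
      (f := fun j : Fin n => if (w ∘ Equiv.swap x y) j = 1 then (q⁻¹) ^ (j : ℕ) else 1)
      fun j hj => by
      rw [Function.comp_apply, Equiv.swap_apply_of_ne_of_ne (Finset.ne_of_mem_erase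
        (Finset.mem_of_mem_erase hj)) (Finset.ne_of_mem_erase hj)]]
  simp only [Function.comp_apply, Equiv.swap_apply_left, Equiv.swap_apply_right, hw, hw']
  have hxv : (x : ℕ) = i := rfl
  have hyv : (y : ℕ) = i + 1 := rfl
  simp only [if_true, hxv, hyv, zero_ne_one, if_false, one_mul, pow_succ]
  field_simp

theorem append_comp_swap_left {N n : ℕ} (w : Fin N → Fin 2) (v : Fin n → Fin 2) (x y : Fin N) :
    Fin.append w v ∘ Equiv.swap (Fin.castAdd n x) (Fin.castAdd n y) =
      Fin.append (w ∘ Equiv.swap x y) v := by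
  ext j
  refine Fin.addCases (fun j => ?_) (fun j => ?_) j
  · rw [Function.comp_apply, ← (Fin.castAdd_injective N n).map_swap, Fin.append_left,
      Fin.append_left, Function.comp_apply]
  · rw [Function.comp_apply, Equiv.swap_apply_of_ne_of_ne, Fin.append_right, Fin.append_right] <;>
      simp only [ne_eq, Fin.ext_iff, Fin.val_natAdd, Fin.val_castAdd] <;> omega

theorem append_comp_swap_right {N n : ℕ} (w : Fin N → Fin 2) (v : Fin n → Fin 2) (x y : Fin n) :
    Fin.append w v ∘ Equiv.swap (Fin.natAdd N x) (Fin.natAdd N y) =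
      Fin.append w (v ∘ Equiv.swap x y) := by
  ext j
  refine Fin.addCases (fun j => ?_) (fun j => ?_) j
  · rw [Function.comp_apply, Equiv.swap_apply_of_ne_of_ne, Fin.append_left, Fin.append_left] <;>
      simp only [ne_eq, Fin.ext_iff, Fin.val_natAdd, Fin.val_castAdd] <;> omega
  · rw [Function.comp_apply, ← (Fin.natAdd_injective n N).map_swap, Fin.append_right,
      Fin.append_right, Function.comp_apply]

theorem sum_append {N n : ℕ} (w : Fin N → Fin 2) (v : Fin n → Fin 2) :
    ∑ i, (((Fin.append w v i : Fin 2) : ℕ) : ℤ) = ∑ i, ((w i : ℕ) : ℤ) + ∑ i, ((v i : ℕ) : ℤ) := by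
  rw [Fin.sum_univ_add]
  simp

/-- Restriction of block-symmetric vectors to the words whose last block is sorted. -/
def restrictSorted (q : ℂ) {m : ℕ} (s : Fin (m + 1) → ℕ) (t : ℤ) :
    blockSymmetric q s t →ₗ[ℂ]
      ((c : Fin (s (Fin.last m) + 1)) → blockSymmetric q (trunc s) (t - (c : ℕ))) where
  toFun f c := ⟨fun w => f.1 (Fin.append w (sortedWord (s (Fin.last m)) c)), by
    refine ⟨fun w hw => ?_, fun i hi w hw hw' => ?_⟩
    · have := (sum_append w _).symm.trans (f.2.1 _ hw)
      have h := sum_sortedWord (show (c : ℕ) ≤ s (Fin.last m) by omega)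
      zify at h
      rw [h] at this
      omega
    · have hlt := hi.lt_size
      have h1 := f.2.2 i (Or.inl hi) (Fin.append w (sortedWord (s (Fin.last m)) c))
        ((Fin.append_left w _ ⟨i, by omega⟩).trans hw)
        ((Fin.append_left w _ ⟨i + 1, hlt⟩).trans hw')
      exact h1.trans <| congr_arg (fun z => q * f.1 z)
        (append_comp_swap_left w _ ⟨i, by omega⟩ ⟨i + 1, hlt⟩)⟩
  map_add' _ _ := rfl
  map_smul' _ _ := rfl

theorem restrictSorted_injective (q : ℂ) {m : ℕ} (s : Fin (m + 1) → ℕ) (t : ℤ) :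
    Function.Injective (restrictSorted q s t) := by
  rw [injective_iff_map_eq_zero]
  intro f hf
  ext w
  obtain ⟨⟨w, v⟩, rfl⟩ := (Fin.appendEquiv (size (trunc s)) (s (Fin.last m))).surjective w
  have key : (fun v => f.1 (Fin.append w v)) = 0 := by
    refine eq_zero_of_killedByCap (q := q) (fun i hi v hv hv' => ?_) fun c hc => ?_
    · have hs := size_succ s
      have h1 := f.2.2 (size (trunc s) + i) (Or.inr ⟨by omega, by omega⟩) (Fin.append w v)
        ((Fin.append_right w v ⟨i, by omega⟩).trans hv)
        ((Fin.append_right w v ⟨i + 1, hi⟩).trans hv')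
      rw [h1]
      exact congr_arg (fun z => q * f.1 z) (append_comp_swap_right w v ⟨i, by omega⟩ ⟨i + 1, hi⟩)
    · have h1 := congr_fun hf ⟨c, by omega⟩
      have h2 := congr_fun (congr_arg Subtype.val h1) w
      exact h2
  exact congr_fun key v

/-- The number of letters `1` of a word. -/
def countOnes {n : ℕ} (v : Fin n → Fin 2) : Fin (n + 1) :=
  ⟨∑ i, (v i : ℕ), Nat.lt_succ_of_le (fin_two_val_sum_le v)⟩

theorem countOnes_comp_swap {n : ℕ} (v : Fin n → Fin 2) (x y : Fin n) :
    countOnes (v ∘ Equiv.swap x y) = countOnes v :=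
  Fin.ext (Equiv.sum_comp (Equiv.swap x y) fun i => (v i : ℕ))

theorem countOnes_sortedWord {n : ℕ} (c : Fin (n + 1)) : countOnes (sortedWord n c) = c :=
  Fin.ext (sum_sortedWord (by omega))

/-- An element of the product is extended to all words by means of the symmetric vector of the last
block. -/
theorem restrictSorted_surjective {q : ℂ} (hq : q ≠ 0) {m : ℕ} (s : Fin (m + 1) → ℕ) (t : ℤ) :
    Function.Surjective (restrictSorted q s t) := by
  set N := size (trunc s) with hN
  set n := s (Fin.last m) with hn
  intro G
  let F : (Fin N → Fin 2) → (Fin n → Fin 2) → ℂ := fun w v => (G (countOnes v)).1 w *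
    (symmetricVector q v / symmetricVector q (sortedWord n (countOnes v)))
  let f : (Fin (N + n) → Fin 2) → ℂ := fun z =>
    F (fun i => z (Fin.castAdd n i)) (fun i => z (Fin.natAdd N i))
  have hf : ∀ w v, f (Fin.append w v) = F w v := fun w v => by simp [f]
  have hmem : f ∈ blockSymmetric q s t := by
    refine ⟨fun z hz => ?_, fun i hi z hz hz' => ?_⟩
    · obtain ⟨⟨w, v⟩, rfl⟩ := (Fin.appendEquiv N n).surjective z
      have h1 : f (Fin.append w v) ≠ 0 := hz
      rw [hf] at h1
      have h2 := (G (countOnes v)).2.1 w (left_ne_zero_of_mul h1)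
      have h3 : (((countOnes v : Fin (n + 1)) : ℕ) : ℤ) = ∑ i, ((v i : ℕ) : ℤ) := by
        simp [countOnes]
      refine (sum_append w v).trans ?_
      rw [h2, h3]
      ring
    · obtain ⟨⟨w, v⟩, rfl⟩ := (Fin.appendEquiv N n).surjective z
      change f (Fin.append w v) = q * f (Fin.append w v ∘ _)
      rcases hi with hi | ⟨hi, hi'⟩
      · have hlt := hi.lt_size
        have hz : Fin.append w v (Fin.castAdd n ⟨i, by omega⟩) = 1 := hz
        have hz' : Fin.append w v (Fin.castAdd n ⟨i + 1, hlt⟩) = 0 := hz'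
        rw [Fin.append_left] at hz hz'
        have h1 := (G (countOnes v)).2.2 i hi w hz hz'
        have h2 := append_comp_swap_left w v ⟨i, by omega⟩ ⟨i + 1, hlt⟩
        refine Eq.trans ?_ (congr_arg (fun z => q * f z) h2.symm)
        simp only [hf, F]
        rw [h1]
        ring
      · obtain ⟨i, rfl⟩ := Nat.exists_eq_add_of_le hi
        have hs := size_succ s
        have hlt : i + 1 < n := by omega
        have hz : Fin.append w v (Fin.natAdd N ⟨i, by omega⟩) = 1 := hz
        have hz' : Fin.append w v (Fin.natAdd N ⟨i + 1, hlt⟩) = 0 := hz'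
        rw [Fin.append_right] at hz hz'
        have h1 := killedByCap_symmetricVector hq hlt v hz hz'
        have h2 := append_comp_swap_right w v ⟨i, by omega⟩ ⟨i + 1, hlt⟩
        refine Eq.trans ?_ (congr_arg (fun z => q * f z) h2.symm)
        simp only [hf, F]
        rw [countOnes_comp_swap, h1]
        ring
  refine ⟨⟨f, hmem⟩, funext fun c => Subtype.ext (funext fun w => ?_)⟩
  change f (Fin.append w (sortedWord n c)) = _
  rw [hf]
  simp only [F]
  rw [countOnes_sortedWord, div_self (symmetricVector_ne_zero hq _), mul_one]

theorem finrank_blockSymmetric {q : ℂ} (hq : q ≠ 0) : ∀ {m : ℕ} (s : Fin m → ℕ) (t : ℤ),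
    Module.finrank ℂ (blockSymmetric q s t) = weightCount s t
  | 0, s, t => by
    have hsum : ∀ w : Fin (size s) → Fin 2, ∑ i, ((w i : ℕ) : ℤ) = 0 := fun w =>
      Finset.sum_eq_zero fun i _ => i.elim0
    rw [weightCount]
    split_ifs with ht
    · have : blockSymmetric q s t = ⊤ := by
        refine Submodule.eq_top_iff'.2 fun f => ⟨fun w _ => by rw [hsum, ht], fun i hi => hi.elim⟩
      rw [this, finrank_top, Module.finrank_fintype_fun_eq_card]
      exact Fintype.card_eq_one_iff.2 ⟨fun i => i.elim0, fun w => funext fun i => i.elim0⟩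
    · have : blockSymmetric q s t = ⊥ := by
        refine (Submodule.eq_bot_iff _).2 fun f hf => funext fun w => ?_
        by_contra hw
        exact ht ((hf.1 w hw).symm.trans (hsum w))
      rw [this, finrank_bot]
  | m + 1, s, t => by
    rw [(LinearEquiv.ofBijective (restrictSorted q s t) ⟨restrictSorted_injective q s t,
      restrictSorted_surjective hq s t⟩).finrank_eq, Module.finrank_pi_fintype, weightCount,
      ← Fin.sum_univ_eq_sum_range (fun c => weightCount (trunc s) (t - c))]
    exact Finset.sum_congr rfl fun c _ => finrank_blockSymmetric hq (trunc s) _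

/-! ### Highest weight vectors -/

theorem functor_mor (q : ℂ) {k l : ℕ} (D : Diagram k l) :
    functor q D.mor = functorDiagram q D := by
  simp [functor, Diagram.mor]

theorem functorDiagram_id (q : ℂ) (n : ℕ) : functorDiagram q (Diagram.id n) = 1 := by
  classical
  ext w' w
  have h1 : ∀ i j : Fin n, (Diagram.id n).r (Sum.inl i) (Sum.inl j) ↔ i = j := fun i j => Iff.rfl
  have h2 : ∀ i j : Fin n, (Diagram.id n).r (Sum.inr i) (Sum.inr j) ↔ i = j := fun i j => Iff.rfl
  have h3 : ∀ i j : Fin n, (Diagram.id n).r (Sum.inl i) (Sum.inr j) ↔ i = j := fun i j => Iff.rfl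
  have h4 : ∀ i j : Fin n, ¬ (i < j ∧ i = j) := fun i j h => h.1.ne h.2
  simp only [functorDiagram, Matrix.of_apply, h1, h2, h3, h4, if_false, Finset.prod_const_one,
    one_mul]
  rw [Matrix.one_apply]
  split_ifs with h
  · subst h
    refine Finset.prod_eq_one fun i _ => Finset.prod_eq_one fun j _ => if_neg ?_
    rintro ⟨rfl, h⟩
    exact h rfl
  · obtain ⟨i, hi⟩ := Function.ne_iff.1 h
    exact Finset.prod_eq_zero (Finset.mem_univ i) (Finset.prod_eq_zero (Finset.mem_univ i)
      (if_pos ⟨rfl, fun h => hi h.symm⟩))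

/-- The value of the functor at a diagram with a cap factors through the cap. -/
theorem exists_functorDiagram_eq (q : ℂ) {k l i : ℕ} {D : Diagram k l} (h : D.CapAt i) :
    ∃ R : (Fin l → Fin 2) → (Fin k → Fin 2) → ℂ,
      (∀ w' w, functorDiagram q D w' w =
        capValue q (w ⟨i, by have := h.choose; omega⟩) (w ⟨i + 1, h.choose⟩) * R w' w) ∧
      ∀ w' w, R w' (w ∘ Equiv.swap ⟨i, by have := h.choose; omega⟩ ⟨i + 1, h.choose⟩) = R w' w := by
  classical
  obtain ⟨hi, hr', hr⟩ := h
  set x : Fin k := ⟨i, by omega⟩ with hx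
  set y : Fin k := ⟨i + 1, hi⟩ with hy
  have hxy : x ≠ y := by simp [hx, hy]
  have hlt : x < y := by simp [hx, hy]
  have hcl : ∀ z, (D.r (Sum.inl x) z ∨ D.r (Sum.inl y) z) → z = Sum.inl x ∨ z = Sum.inl y := by
    rintro z (hz | hz)
    · exact hr z hz
    · exact hr z (D.trans' hr' hz)
  let A : (Fin k → Fin 2) → Fin k × Fin k → ℂ := fun w p =>
    if p.1 < p.2 ∧ D.r (Sum.inl p.1) (Sum.inl p.2) then capValue q (w p.1) (w p.2) else 1
  let B : (Fin l → Fin 2) → ℂ := fun w' => ∏ i, ∏ j,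
    if i < j ∧ D.r (Sum.inr i) (Sum.inr j) then cupValue q (w' i) (w' j) else 1
  let C : (Fin l → Fin 2) → (Fin k → Fin 2) → ℂ := fun w' w => ∏ i, ∏ j,
    if D.r (Sum.inl i) (Sum.inr j) ∧ w i ≠ w' j then 0 else 1
  refine ⟨fun w' w => (∏ p ∈ Finset.univ.erase (x, y), A w p) * B w' * C w' w,
    fun w' w => ?_, fun w' w => ?_⟩
  · have h1 : functorDiagram q D w' w = (∏ p, A w p) * B w' * C w' w := by
      rw [Fintype.prod_prod_type (A w)]
      rfl
    have h2 : A w (x, y) = capValue q (w x) (w y) := if_pos ⟨hlt, hr'⟩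
    rw [h1, ← Finset.mul_prod_erase _ _ (Finset.mem_univ (x, y)), h2]
    ring
  · have hσ : ∀ j, j ≠ x → j ≠ y → (w ∘ Equiv.swap x y) j = w j := fun j h1 h2 => by
      rw [Function.comp_apply, Equiv.swap_apply_of_ne_of_ne h1 h2]
    refine congr_arg₂ (· * ·) (congr_arg (· * B w') (Finset.prod_congr rfl fun p hp => ?_))
      (?_ : C w' _ = C w' w)
    · obtain ⟨u, v⟩ := p
      simp only [A]
      by_cases h1 : u < v ∧ D.r (Sum.inl u) (Sum.inl v)
      · rw [if_pos h1, if_pos h1]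
        have hne : ¬ (u = x ∧ v = y) := fun h => Finset.ne_of_mem_erase hp (by rw [h.1, h.2])
        have hu : ¬ (u = x ∨ u = y) := by
          rintro (rfl | rfl)
          · rcases hcl _ (Or.inl h1.2) with h | h
            · exact h1.1.ne' (Sum.inl_injective h)
            · exact hne ⟨rfl, Sum.inl_injective h⟩
          · rcases hcl _ (Or.inr h1.2) with h | h
            · exact absurd (h1.1.trans_eq (Sum.inl_injective h)) hlt.asymm
            · exact h1.1.ne' (Sum.inl_injective h)
        have hv : ¬ (v = x ∨ v = y) := by
          intro h
          have h3 : D.r (Sum.inl x) (Sum.inl u) ∨ D.r (Sum.inl y) (Sum.inl u) := by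
            rcases h with rfl | rfl
            · exact Or.inl (D.symm' h1.2)
            · exact Or.inr (D.symm' h1.2)
          exact hu ((hcl _ h3).imp (fun h => Sum.inl_injective h) (fun h => Sum.inl_injective h))
        push Not at hu hv
        rw [hσ u hu.1 hu.2, hσ v hv.1 hv.2]
      · rw [if_neg h1, if_neg h1]
    · refine Finset.prod_congr rfl fun u _ => Finset.prod_congr rfl fun v _ => ?_
      by_cases h1 : D.r (Sum.inl u) (Sum.inr v)
      · rw [hσ u]
        · rintro rfl
          rcases hcl _ (Or.inl h1) with h | h <;> exact Sum.inr_ne_inl h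
        · rintro rfl
          rcases hcl _ (Or.inr h1) with h | h <;> exact Sum.inr_ne_inl h
      · rw [if_neg fun h => h1 h.1, if_neg fun h => h1 h.1]

theorem functorDiagram_mulVec_eq_zero {q : ℂ} (hq : q ≠ 0) {k l i : ℕ} {D : Diagram k l}
    (h : D.CapAt i) {f : (Fin k → Fin 2) → ℂ}
    (hf : KilledByCap q ⟨i, by have := h.choose; omega⟩ ⟨i + 1, h.choose⟩ f) :
    (functorDiagram q D).mulVec f = 0 := by
  obtain ⟨R, h1, h2⟩ := exists_functorDiagram_eq q h
  generalize (⟨i, by have := h.choose; omega⟩ : Fin k) = x at *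
  generalize (⟨i + 1, h.choose⟩ : Fin k) = y at *
  ext w'
  -- the terms of the sum cancel in pairs
  have key : ∀ w : Fin k → Fin 2, w x = 1 → w y = 0 → functorDiagram q D w' w * f w =
      -(functorDiagram q D w' (w ∘ Equiv.swap x y) * f (w ∘ Equiv.swap x y)) := by
    intro w hw hw'
    rw [h1, h1, h2, hf w hw hw', Function.comp_apply, Function.comp_apply, Equiv.swap_apply_left,
      Equiv.swap_apply_right, hw, hw']
    simp only [capValue, Matrix.of_apply, Matrix.cons_val', Matrix.cons_val_zero,
      Matrix.cons_val_one, Matrix.cons_val_fin_one]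
    field_simp
  have hinv : ∀ w : Fin k → Fin 2, (w ∘ Equiv.swap x y) ∘ Equiv.swap x y = w := fun w => by
    ext j
    simp
  have key' : ∀ w : Fin k → Fin 2, functorDiagram q D w' w * f w =
      -(functorDiagram q D w' (w ∘ Equiv.swap x y) * f (w ∘ Equiv.swap x y)) := by
    intro w
    have hcases : ∀ ε : Fin 2, ε = 0 ∨ ε = 1 := by decide
    rcases hcases (w x) with hw | hw <;> rcases hcases (w y) with hw' | hw'
    · rw [h1, h1, Function.comp_apply, Function.comp_apply, Equiv.swap_apply_left,
        Equiv.swap_apply_right, hw, hw']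
      simp [capValue]
    · have := key (w ∘ Equiv.swap x y) (by simpa using hw') (by simpa using hw)
      rw [hinv] at this
      rw [this, neg_neg]
    · exact key w hw hw'
    · rw [h1, h1, Function.comp_apply, Function.comp_apply, Equiv.swap_apply_left,
        Equiv.swap_apply_right, hw, hw']
      simp [capValue]
  have hinvol : Function.Involutive fun w : Fin k → Fin 2 => w ∘ Equiv.swap x y := hinv
  have hsum : ∑ w, functorDiagram q D w' w * f w = -∑ w, functorDiagram q D w' w * f w := by
    rw [← Finset.sum_neg_distrib, ← Equiv.sum_comp hinvol.toPerm]
    refine Finset.sum_congr rfl fun w _ => (key' _).trans ?_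
    simp only [Function.Involutive.coe_toPerm, hinv]
  exact self_eq_neg.1 hsum

theorem functor_jwSeq_mulVec (ha : a ≠ 0) (hgen : ∀ n : ℕ, 0 < n → a ^ n ≠ 1) {m : ℕ}
    {s : Fin m → ℕ} {t : ℤ} {f : (Fin (size s) → Fin 2) → ℂ}
    (hf : f ∈ blockSymmetric (a ^ 2) s t) : (functor (a ^ 2) (jwSeq a s)).mulVec f = f := by
  have key : ∀ x ∈ Submodule.span ℂ {x | ∃ D : Diagram (size s) (size s),
      (∃ i, InBlock s i ∧ D.CapAt i) ∧ x = D.mor}, (functor (a ^ 2) x).mulVec f = 0 := by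
    intro x hx
    induction hx using Submodule.span_induction with
    | mem x hx =>
      obtain ⟨D, ⟨i, hi, hD⟩, rfl⟩ := hx
      rw [functor_mor]
      exact functorDiagram_mulVec_eq_zero (pow_ne_zero _ ha) hD (hf.2 i hi)
    | zero => simp
    | add x y _ _ hx hy => rw [map_add, Matrix.add_mulVec, hx, hy, add_zero]
    | smul c x _ hx => rw [map_smul, Matrix.smul_mulVec, hx, smul_zero]
  have h := key _ (jwSeq_sub_id_mem ha hgen s)
  rw [map_sub, Matrix.sub_mulVec, functor_mor, functorDiagram_id, Matrix.one_mulVec,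
    sub_eq_zero] at h
  exact h

theorem prod_kEigen {q : ℂ} (hq : q ≠ 0) {n b t : ℕ} {w : Fin n → Fin 2}
    (hw : ∑ i, (w i : ℕ) = t) (hn : n = b + 2 * t) : ∏ i, kEigen q (w i) = q ^ b := by
  have h1 : (∏ i, kEigen q (w i)) * q ^ (2 * t) = q ^ n := by
    have h2 : ∀ ε : Fin 2, kEigen q ε * q ^ (2 * (ε : ℕ)) = q := by
      intro ε
      fin_cases ε
      · simp [kEigen]
      · simp only [kEigen, Fin.mk_one, one_ne_zero, if_false, mul_one]
        field_simp
    rw [← hw, Finset.mul_sum, ← Finset.prod_pow_eq_pow_sum, ← Finset.prod_mul_distrib,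
      Finset.prod_congr rfl fun i _ => h2 (w i)]
    simp
  refine mul_right_cancel₀ (pow_ne_zero (2 * t) hq) ?_
  rw [h1, hn, pow_add]

/-- If the weight `b` has a larger multiplicity than the weight `b + 2`, then there is a highest
weight vector of weight `b`: the operator `X` has a kernel on the vectors of weight `b`. -/
theorem finrank_highestWeightSpace_pos (ha : a ≠ 0) (hgen : ∀ n : ℕ, 0 < n → a ^ n ≠ 1) {m : ℕ}
    {s : Fin m → ℕ} {b : ℕ} {t : ℤ} (ht : size s = b + 2 * t)
    (hlt : weightCount s (t - 1) < weightCount s t) :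
    0 < Module.finrank ℂ (highestWeightSpace a s b) := by
  have hq : a ^ 2 ≠ 0 := pow_ne_zero _ ha
  let X : blockSymmetric (a ^ 2) s t →ₗ[ℂ] blockSymmetric (a ^ 2) s (t - 1) :=
    (actX (a ^ 2) (size s)).mulVecLin.restrict fun f hf => actX_mem_blockSymmetric hq hf
  have hker : LinearMap.ker X ≠ ⊥ := LinearMap.ker_ne_bot_of_finrank_lt (by
    rwa [finrank_blockSymmetric hq, finrank_blockSymmetric hq])
  obtain ⟨⟨f, hf⟩, hXf, hne⟩ := Submodule.exists_mem_ne_zero_of_ne_bot hker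
  have hf0 : f ≠ 0 := fun h => hne (Subtype.ext h)
  have hmem : f ∈ highestWeightSpace a s b := by
    refine ⟨⟨⟨f, functor_jwSeq_mulVec ha hgen hf⟩, ?_⟩, ?_⟩
    · exact congr_arg Subtype.val (LinearMap.mem_ker.1 hXf)
    · rw [SetLike.mem_coe, LinearMap.mem_ker, Matrix.mulVecLin_apply, Matrix.sub_mulVec, sub_eq_zero,
        Matrix.smul_mulVec, Matrix.one_mulVec]
      ext w
      rw [actK, Matrix.mulVec_diagonal, Pi.smul_apply, smul_eq_mul]
      by_cases hw : f w = 0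
      · rw [hw, mul_zero, mul_zero]
      · have h1 := hf.1 w hw
        obtain ⟨t, rfl⟩ : ∃ t' : ℕ, t = t' :=
          Int.eq_ofNat_of_zero_le (h1 ▸ Finset.sum_nonneg fun i _ => by positivity)
        rw [prod_kEigen hq (t := t) (by exact_mod_cast h1) (by exact_mod_cast ht)]
  have : Nontrivial (highestWeightSpace a s b) :=
    ⟨⟨⟨f, hmem⟩, 0, fun h => hf0 (congr_arg Subtype.val h)⟩⟩
  exact Module.finrank_pos

/-- Every good diagram for `s` is one of the recursively constructed ones. -/
theorem exists_diagram_eq (ha : a ≠ 0) (hgen : ∀ n : ℕ, 0 < n → a ^ n ≠ 1) {M : ℕ}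
    {s : Fin (M + 1) → ℕ} {k : ℕ} {D : Diagram (size s) k} (hD : IsGoodType a s k D) :
    ∃ x : RecIndex a s k, x.diagram = D := by
  obtain ⟨h1, h2⟩ := (isGoodType_iff ha hgen).1 hD
  obtain ⟨b, ℓ, hℓ, hb, hS, h, D', h3, h4, rfl⟩ := h2.exists_eq_nest h1
  obtain ⟨t, ht, hlt⟩ := exists_weightCount_lt h3 h4
  exact ⟨⟨b, finrank_highestWeightSpace_pos ha hgen ht hlt, ℓ, hℓ, hb, D',
    (isGoodType_iff ha hgen).2 ⟨h3, h4⟩⟩, rfl⟩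

end TemperleyLieb

end

theorem mainTheorem8 (a : ℂ) (ha : a ≠ 0) (hgen : ∀ n : ℕ, 0 < n → a ^ n ≠ 1)
    (M : ℕ) (hM : 3 ≤ M + 1) (s : Fin (M + 1) → ℕ) (hs : ∀ i, 0 < s i) (k : ℕ) :
    (Function.Injective (TemperleyLieb.RecIndex.bar (a := a) (s := s) (k := k)) ∧
      Set.range (TemperleyLieb.RecIndex.bar (a := a) (s := s) (k := k)) =
        {x | ∃ D, TemperleyLieb.IsGoodType a s k D ∧ x = D.mor}) ∧
    LinearIndependent ℂ
      (fun x : TemperleyLieb.RecIndex a s k => TemperleyLieb.hat a s k x.bar) ∧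
    Submodule.span ℂ
      (Set.range fun x : TemperleyLieb.RecIndex a s k => TemperleyLieb.hat a s k x.bar) =
        TemperleyLieb.HomV a s k := by
  let e : TemperleyLieb.RecIndex a s k → {D // TemperleyLieb.IsGoodType a s k D} := fun x =>
    ⟨x.diagram, x.isGoodType_diagram ha hgen⟩
  have he : Function.Injective e := fun x y h =>
    TemperleyLieb.RecIndex.diagram_injective ha hgen (congr_arg Subtype.val h)
  have he' : Function.Surjective e := fun D => by
    obtain ⟨x, hx⟩ := TemperleyLieb.exists_diagram_eq ha hgen D.2
    exact ⟨x, Subtype.ext hx⟩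
  have hbar : (fun x : TemperleyLieb.RecIndex a s k => TemperleyLieb.hat a s k x.bar) =
      (fun D : {D // TemperleyLieb.IsGoodType a s k D} => TemperleyLieb.hat a s k D.1.mor) ∘ e :=
    funext fun x => by rw [x.bar_eq]; rfl
  refine ⟨⟨TemperleyLieb.RecIndex.bar_injective ha hgen, ?_⟩, ?_, ?_⟩
  · ext y
    constructor
    · rintro ⟨x, rfl⟩
      exact ⟨x.diagram, x.isGoodType_diagram ha hgen, x.bar_eq⟩
    · rintro ⟨D, hD, rfl⟩
      obtain ⟨x, rfl⟩ := TemperleyLieb.exists_diagram_eq ha hgen hD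
      exact ⟨x, x.bar_eq⟩
  · rw [hbar]
    exact (TemperleyLieb.linearIndependent_hat_good ha hgen s k).comp e he
  · rw [hbar, he'.range_comp, TemperleyLieb.span_hat_good]
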